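/- **Theorem 5.1.** Let $n_1,n_2\in(0,\infty)$. Let $(\mathcal X,d_{\mathcal X},\mu_{\mathcal X})$ and $(\mathcal Y,d_{\mathcal Y},\mu_{\mathcal Y})$ be metric measure spaces (Borel measures, all balls of positive finite measure) that are Ahlfors $n_1$- and $n_2$-regular, respectively; here $(\mathcal X,d,\mu)$ is Ahlfors $n$-regular if there are constants $0<C_1\le 1\le C_2$ with $C_1\lambda^n\mu(B(x,r))\le\mu(B(x,\lambda r))\le C_2\lambda^n\mu(B(x,r))$ for all $x$, $0<r<2\,\mathrm{diam}\,\mathcal X$ and $1\le\lambda<2\,\mathrm{diam}\,\mathcal X/r$. Let $f$ be a quasisymmetric homeomorphism from $\mathcal X$ onto $\mathcal Y$, that is, $\frac{d_{\mathcal Y}(f(x),f(a))}{d_{\mathcal Y}(f(x),f(b))}\le\eta\left(\frac{d_{\mathcal X}(x,a)}{d_{\mathcal X}(x,b)}\right)$ for all $a,b,x\in\mathcal X$ with $x\ne b$, for some homeomorphism $\eta:[0,\infty)\to[0,\infty)$. Let $s_i\in(0,n_i)$, $i=1,2$, with $p:=n_1/s_1=n_2/s_2$. For a (real- or complex-valued)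 measurable function $u$, the space $\dot M^{s}_{p,p}(\mathcal X)$ is given by the finiteness of $\|u\|_{\dot M^s_{p,p}(\mathcal X)}=\inf_{(g_k)}\left(\int_{\mathcal X}\sum_{k\in\mathbb Z}g_k^p\,d\mu\right)^{1/p}$, where the infimum is over all sequences $(g_k)_{k\in\mathbb Z}$ of nonnegative measurable functions such that, off a null set, $|u(x)-u(y)|\le d(x,y)^s[g_k(x)+g_k(y)]$ whenever $2^{-k-1}\le d(x,y)<2^{-k}$. The Bourdon–Pajot Besov space $\dot{\mathcal B}^s_p(\mathcal X)$ consists of all $u\in L^p_{\mathrm{loc}}(\mathcal X)$ ($p$-integrable on balls) with $\|u\|_{\dot{\mathcal B}^s_p(\mathcal X)}=\left(\int_{\mathcal X}\int_{\mathcal X}\frac{|u(x)-u(y)|^p}{d(x,y)^{sp}\,\mu(B(x,d(x,y)))}\,d\mu(y)\,d\mu(x)\right)^{1/p}<\infty$. Then $f$ induces an equivalence between $\dot M^{s_1}_{p,p}(\mathcal X)$ and $\dot M^{s_2}_{p,p}(\mathcal Y)$, and likewise between $\dot{\mathcal B}^{s_1}_{p}(\mathcal X)$ and $\dot{\mathcal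 B}^{s_2}_{p}(\mathcal Y)$, in the following sense (stated for either pair of spaces). There is a constant $C$ such that every $u$ in the space on $\mathcal Y$ is integrable on balls, and: the limit $\widetilde u(y)=\lim_{r\to0}\frac1{\mu_{\mathcal Y}(B(y,r))}\int_{B(y,r)}u\,d\mu_{\mathcal Y}$ exists off a set $N_u\subset\mathcal Y$ of Hausdorff dimension zero with $\mu_{\mathcal X}(f^{-1}(N_u))=0$ (put $\widetilde u=0$ on $N_u$); $\widetilde u=u$ almost everywhere; and $\widetilde u\circ f$ belongs to the corresponding space on $\mathcal X$ with $\|\widetilde u\circ f\|\le C\|u\|$. The same holds for $f^{-1}$, with the roles of $\mathcal X$ and $\mathcal Y$ exchanged, and the operators $u\mapsto\widetilde u\circ f$ and $v\mapsto\widetilde v\circ f^{-1}$ are inverse to each other modulo equality almost everywhere. -/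

import Mathlib

open MeasureTheory Set Filter Topology
open scoped ENNReal NNReal

namespace HajlaszBesov

noncomputable section

/-- A metric measure space (a Borel measure on a metric space all of whose balls have positive and
finite measure) which is Ahlfors `n`-regular: for some constants `0 < C₁ ≤ 1 ≤ C₂`,
`C₁ lam ^ n μ(B(x, r)) ≤ μ(B(x, lam r)) ≤ C₂ lam ^ n μ(B(x, r))`
for all `x`, all `0 < r < 2 diam X` and all `1 ≤ lam < 2 diam X / r`.
Every measure on the Borel σ-algebra, extended to all sets as an outer measure as in Mathlib, is
Borel regular. -/
structure IsAhlforsRegular {X : Type*} [MetricSpace X] [MeasurableSpace X] [BorelSpace X]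
    (μ : Measure X) (n : ℝ) : Prop where
  ball_pos : ∀ (x : X) (r : ℝ), 0 < r → 0 < μ (Metric.ball x r)
  ball_lt_top : ∀ (x : X) (r : ℝ), 0 < r → μ (Metric.ball x r) < ∞
  regular : ∃ C₁ C₂ : ℝ, 0 < C₁ ∧ C₁ ≤ 1 ∧ 1 ≤ C₂ ∧
    ∀ (x : X) (r lam : ℝ), 0 < r → ENNReal.ofReal r < 2 * Metric.ediam (univ : Set X) →
      1 ≤ lam → ENNReal.ofReal (lam * r) < 2 * Metric.ediam (univ : Set X) →
      ENNReal.ofReal (C₁ * lam ^ n) * μ (Metric.ball x r) ≤ μ (Metric.ball x (lam * r)) ∧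
      μ (Metric.ball x (lam * r)) ≤ ENNReal.ofReal (C₂ * lam ^ n) * μ (Metric.ball x r)

/-- A homeomorphism `f` is quasisymmetric if there is a homeomorphism `η` of `[0, ∞)` with
`d(f x, f a) / d(f x, f b) ≤ η (d(x, a) / d(x, b))` whenever `x ≠ b`. -/
def IsQuasisymmetric {X Y : Type*} [MetricSpace X] [MetricSpace Y] (f : X ≃ₜ Y) : Prop :=
  ∃ η : ℝ≥0 ≃ₜ ℝ≥0, ∀ a b x : X, x ≠ b →
    nndist (f x) (f a) / nndist (f x) (f b) ≤ η (nndist x a / nndist x b)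

section Spaces

variable {𝕜 X : Type*} [RCLike 𝕜] [MetricSpace X] [MeasurableSpace X]

/-- `g = (g_k)_{k ∈ ℤ}` is a fractional `s`-Hajłasz gradient of `u`. (Functions with values in
`[0, ∞]` are allowed; a sequence of finite mixed norm is finite off a null set.) -/
def IsFracHajlaszGradient (μ : Measure X) (s : ℝ) (u : X → 𝕜) (g : ℤ → X → ℝ≥0∞) : Prop :=
  (∀ k, AEMeasurable (g k) μ) ∧
  ∃ E : Set X, μ E = 0 ∧ ∀ (k : ℤ) (x y : X), x ∉ E → y ∉ E →
    (2 : ℝ) ^ (-k - 1) ≤ dist x y → dist x y < (2 : ℝ) ^ (-k) →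
    ‖u x - u y‖ₑ ≤ edist x y ^ s * (g k x + g k y)

/-- The `ℓ^q` (quasi-)norm of a two-sided sequence, `0 < q ≤ ∞`. -/
def lqNorm (q : ℝ≥0∞) (a : ℤ → ℝ≥0∞) : ℝ≥0∞ :=
  if q = ∞ then ⨆ k, a k else (∑' k, a k ^ q.toReal) ^ (1 / q.toReal)

/-- The (quasi-)norm of `L^p(X, ℓ^q)`, `0 < p < ∞`, `0 < q ≤ ∞`. -/
def LpLqNorm (μ : Measure X) (p : ℝ) (q : ℝ≥0∞) (g : ℤ → X → ℝ≥0∞) : ℝ≥0∞ :=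
  (∫⁻ x, lqNorm q (fun k => g k x) ^ p ∂μ) ^ (1 / p)

/-- The homogeneous Hajłasz–Triebel–Lizorkin (quasi-)seminorm `‖u‖_{Ṁ^s_{p,q}(X)}`. -/
def hajlaszNorm (μ : Measure X) (s p : ℝ) (q : ℝ≥0∞) (u : X → 𝕜) : ℝ≥0∞ :=
  ⨅ (g : ℤ → X → ℝ≥0∞) (_ : IsFracHajlaszGradient μ s u g), LpLqNorm μ p q g

/-- The homogeneous Hajłasz–Triebel–Lizorkin space `Ṁ^s_{p,q}(X)`. -/
def hajlaszSpace (𝕜 : Type*) [RCLike 𝕜] (μ : Measure X) (s p : ℝ) (q : ℝ≥0∞) : Set (X → 𝕜) :=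
  {u | AEMeasurable u μ ∧ hajlaszNorm μ s p q u < ∞}

/-- The seminorm of the Bourdon–Pajot Besov space `𝓑̇^s_p(X)`; the weight `V(x, y)` is
`μ(B(x, d(x, y)))`. -/
def besovNorm (μ : Measure X) (s p : ℝ) (u : X → 𝕜) : ℝ≥0∞ :=
  (∫⁻ x, ∫⁻ y, ‖u x - u y‖ₑ ^ p / (edist x y ^ (s * p) * μ (Metric.ball x (dist x y))) ∂μ ∂μ)
    ^ (1 / p)

/-- The Bourdon–Pajot Besov space `𝓑̇^s_p(X)`: functions that are `p`-integrable on balls and have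
finite seminorm. -/
def besovSpace (𝕜 : Type*) [RCLike 𝕜] (μ : Measure X) (s p : ℝ) : Set (X → 𝕜) :=
  {u | (∀ (x : X) (r : ℝ), MemLp u (ENNReal.ofReal p) (μ.restrict (Metric.ball x r))) ∧
    besovNorm μ s p u < ∞}

/-- The averages of `u` over the balls `B(x, r)` converge to `a` as `r → 0`. -/
def AveragesTendTo (μ : Measure X) (u : X → 𝕜) (x : X) (a : 𝕜) : Prop :=
  Tendsto (fun r : ℝ => ⨍ z in Metric.ball x r, u z ∂μ) (𝓝[>] 0) (𝓝 a)

/-- The set where the averages of `u` over small concentric balls do not converge. -/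
def divergenceSet (μ : Measure X) (u : X → 𝕜) : Set X :=
  {x | ¬ ∃ a, AveragesTendTo μ u x a}

open Classical in
/-- The precise representative of `u`: the limit of the averages of `u` over small balls where it
exists, and `0` elsewhere. -/
def preciseRep (μ : Measure X) (u : X → 𝕜) (x : X) : 𝕜 :=
  if h : ∃ a, AveragesTendTo μ u x a then h.choose else 0

end Spaces

section Equivalence

variable {𝕜 X Y : Type*} [RCLike 𝕜] [MetricSpace X] [MeasurableSpace X]
  [MetricSpace Y] [MeasurableSpace Y]

/-- `u ↦ ũ ∘ f` is a bounded operator from the space `FY` of functions on `Y` with seminorm `NY`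
to the space `FX` of functions on `X` with seminorm `NX`. Here `ũ` is the precise representative of
`u`: the averages of the locally integrable function `u` converge off a set of Hausdorff dimension
zero, whose preimage under `f` is a null set, and `ũ = u` almost everywhere. -/
def PullbackBounded (μX : Measure X) (μY : Measure Y) (f : X ≃ₜ Y)
    (FX : Set (X → 𝕜)) (NX : (X → 𝕜) → ℝ≥0∞) (FY : Set (Y → 𝕜)) (NY : (Y → 𝕜) → ℝ≥0∞) : Prop :=
  ∃ C : ℝ≥0, ∀ u ∈ FY,
    (∀ (y : Y) (r : ℝ), IntegrableOn u (Metric.ball y r) μY) ∧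
    dimH (divergenceSet μY u) = 0 ∧
    μX (f ⁻¹' divergenceSet μY u) = 0 ∧
    preciseRep μY u =ᵐ[μY] u ∧
    preciseRep μY u ∘ f ∈ FX ∧
    NX (preciseRep μY u ∘ f) ≤ C * NY u

/-- `f` induces an equivalence between `FX` and `FY`: `u ↦ ũ ∘ f` and `v ↦ ṽ ∘ f⁻¹` are bounded
operators `FY → FX` and `FX → FY` that are inverse to each other modulo equality almost
everywhere. -/
def InducesEquivalence (μX : Measure X) (μY : Measure Y) (f : X ≃ₜ Y)
    (FX : Set (X → 𝕜)) (NX : (X → 𝕜) → ℝ≥0∞) (FY : Set (Y → 𝕜)) (NY : (Y → 𝕜) → ℝ≥0∞) : Prop :=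
  PullbackBounded μX μY f FX NX FY NY ∧
  PullbackBounded μY μX f.symm FY NY FX NX ∧
  (∀ u ∈ FY, preciseRep μX (preciseRep μY u ∘ f) ∘ f.symm =ᵐ[μY] u) ∧
  (∀ v ∈ FX, preciseRep μY (preciseRep μX v ∘ f.symm) ∘ f =ᵐ[μX] v)

end Equivalence

end

end HajlaszBesov

open HajlaszBesov

/-! When s p = n, Ahlfors regularity makes d(x,y)^(sp) comparable to μ(B(x,d(x,y))). Both seminorms,
raised to the power p, are then comparable to the energy ∬ μ(B(x,d(x,y)))⁻² |u(x)-u(y)|^p, in which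
neither n nor s occurs (`isEnergySpace_besovSpace`, `isEnergySpace_hajlaszSpace`). From there on
only two consequences of regularity are used: the measures are doubling and the spaces are uniformly
perfect.

Carry μ_Y to X as ν, its image under f⁻¹. Quasisymmetry makes ν doubling on the balls of X
(`isDoubling_map_symm`), and the ν-energy of u ∘ f is bounded by the energy of u
(`exists_energy_map_symm_le`). What remains concerns two doubling measures μ, ν on one space. They
may be mutually singular, so a ν-class of functions has no evident meaning μ-almost everywhere;
limits of ν-averages supply one.

The core is `exists_energy_limit_le`. Let osc_j(x) be the ν-mean of |w(z)-w(t)|^p over the square of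
B(x,q^(-j)). The sum over j of ∫ μ(B_j)⁻¹ osc_j dμ is bounded by the ν-energy for every doubling μ,
because after Fubini the factor μ(B_j)⁻¹ integrates to a constant over a ball
(`tsum_lintegral_oscEnergy_le`). Consecutive ν-averages differ by at most a multiple of osc_j^(1/p).
Uniform perfectness makes the μ-measure of shrinking balls decay geometrically, and a Hardy
inequality then controls the tails of the telescoping series (`exists_tsum_tailSum_le`). Hence the
ν-averages converge μ-almost everywhere, and the difference of two limits at distance about q^(-k)
is bounded by tails starting near scale k, which sum to the μ-energy.

Where the oscillations are not summable, osc_j exceeds q^(-jd) for infinitely many j, whatever d >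
0. Covering by net balls of large energy bounds the d-dimensional Hausdorff measure by the energy,
so the exceptional set has dimension zero (`dimH_not_oscSummable`). Finally the μ-averages of the
limit and the ν-averages of w become equal in the limit ν-almost everywhere
(`ae_tendsto_average_limit`), so composing with f and then with f⁻¹ gives u back. One-point spaces
are treated separately. -/

namespace HajlaszBesov

/-! ### Jensen and Hölder inequalities in [0, ∞]. -/

section Inequalities

lemma inv_le_mul_inv_of_le_mul {a b K : ℝ≥0∞} (hK0 : K ≠ 0) (hK : K ≠ ∞) (h : a ≤ K * b) :
    b⁻¹ ≤ K * a⁻¹ := by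
  have h1 : (K * b)⁻¹ ≤ a⁻¹ := ENNReal.inv_le_inv' h
  rw [ENNReal.mul_inv (Or.inl hK0) (Or.inl hK)] at h1
  calc b⁻¹ = K * (K⁻¹ * b⁻¹) := by
        rw [← mul_assoc, ENNReal.mul_inv_cancel hK0 hK, one_mul]
    _ ≤ K * a⁻¹ := by gcongr

lemma lintegral_rpow_le_of_isProbabilityMeasure {Ω : Type*} [MeasurableSpace Ω] (P : Measure Ω)
    [IsProbabilityMeasure P] {p : ℝ} (hp : 1 < p) {g : Ω → ℝ≥0∞} (hg : AEMeasurable g P) :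
    (∫⁻ x, g x ∂P) ^ p ≤ ∫⁻ x, g x ^ p ∂P := by
  have hc : p.HolderConjugate (p / (p - 1)) := Real.HolderConjugate.conjExponent hp
  have h := ENNReal.lintegral_mul_le_Lp_mul_Lq P hc hg (g := fun _ => 1) aemeasurable_const
  simp only [Pi.mul_apply, mul_one, ENNReal.one_rpow, lintegral_const, measure_univ] at h
  calc (∫⁻ x, g x ∂P) ^ p ≤ ((∫⁻ x, g x ^ p ∂P) ^ (1 / p)) ^ p := by gcongr
    _ = _ := by rw [← ENNReal.rpow_mul, one_div_mul_cancel (by positivity), ENNReal.rpow_one]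

lemma enorm_integral_rpow_le {Ω 𝕜 : Type*} [MeasurableSpace Ω] [RCLike 𝕜] (P : Measure Ω)
    [IsProbabilityMeasure P] {p : ℝ} (hp : 1 < p) {h : Ω → 𝕜} (hh : AEStronglyMeasurable h P) :
    ‖∫ x, h x ∂P‖ₑ ^ p ≤ ∫⁻ x, ‖h x‖ₑ ^ p ∂P :=
  (ENNReal.rpow_le_rpow (enorm_integral_le_lintegral_enorm h) (by positivity)).trans
    (lintegral_rpow_le_of_isProbabilityMeasure P hp hh.enorm)

lemma enorm_integral_sub_const_rpow_le {Ω 𝕜 : Type*} [MeasurableSpace Ω] [RCLike 𝕜]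
    (P : Measure Ω) [IsProbabilityMeasure P] {p : ℝ} (hp : 1 < p) {h : Ω → 𝕜}
    (hh : Integrable h P) (c : 𝕜) :
    ‖∫ x, h x ∂P - c‖ₑ ^ p ≤ ∫⁻ x, ‖h x - c‖ₑ ^ p ∂P := by
  have h1 : ∫ x, h x ∂P - c = ∫ x, (h x - c) ∂P := by
    rw [integral_sub hh (integrable_const c)]; simp
  rw [h1]
  exact enorm_integral_rpow_le P hp (hh.aestronglyMeasurable.sub aestronglyMeasurable_const)

/-- Jensen is applied twice, first under P with the Q-mean as constant, then under Q with h x as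
constant. -/
lemma enorm_integral_sub_integral_rpow_le {Ω 𝕜 : Type*} [MeasurableSpace Ω] [RCLike 𝕜]
    (P Q : Measure Ω) [IsProbabilityMeasure P] [IsProbabilityMeasure Q] {p : ℝ} (hp : 1 < p)
    {h : Ω → 𝕜} (hP : Integrable h P) (hQ : Integrable h Q) :
    ‖∫ x, h x ∂P - ∫ x, h x ∂Q‖ₑ ^ p ≤ ∫⁻ x, ∫⁻ y, ‖h x - h y‖ₑ ^ p ∂Q ∂P := by
  refine (enorm_integral_sub_const_rpow_le P hp hP _).trans (lintegral_mono fun x => ?_)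
  have := enorm_integral_sub_const_rpow_le Q hp hQ (h x)
  rw [← enorm_neg, neg_sub]
  refine this.trans_eq ?_
  congr with y
  rw [← enorm_neg, neg_sub]

/-- Hölder for the splitting a_i = (τ⁻ⁱ a_i) τⁱ with τ = σ^(1/p): the second factor lies in ℓ^q as a
geometric sequence. Summability of tails will be bought at the price of the growing weight σ⁻ⁱ. -/
lemma exists_tsum_rpow_le {p : ℝ} (hp : 1 < p) {σ : ℝ≥0} (hσ0 : 0 < σ) (hσ : σ < 1) :
    ∃ C : ℝ≥0, ∀ a : ℕ → ℝ≥0∞,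
      (∑' i, a i) ^ p ≤ C * ∑' i, ((σ : ℝ≥0∞)⁻¹) ^ i * a i ^ p := by
  have hp0 : 0 < p := by linarith
  set q := p / (p - 1) with hq
  have hc : p.HolderConjugate q := Real.HolderConjugate.conjExponent hp
  have hq0 : 0 < q := hc.symm.pos
  set τ : ℝ≥0∞ := (σ : ℝ≥0∞) ^ (1 / p) with hτ
  have hσe : (σ : ℝ≥0∞) ≠ 0 := by exact_mod_cast hσ0.ne'
  have hσ1 : (σ : ℝ≥0∞) < 1 := by exact_mod_cast hσ
  have hτ1 : τ < 1 := ENNReal.rpow_lt_one hσ1 (by positivity)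
  have hτ0 : τ ≠ 0 := by
    simp only [hτ, ne_eq, ENNReal.rpow_eq_zero_iff, not_or, not_and]
    exact ⟨fun h => absurd h hσe, fun h => absurd h ENNReal.coe_ne_top⟩
  have hτt : τ ≠ ∞ := hτ1.ne_top
  have hτp : τ ^ p = σ := by
    rw [hτ, ← ENNReal.rpow_mul, one_div_mul_cancel hp0.ne', ENNReal.rpow_one]
  clear_value τ
  have hτq : τ ^ q < 1 := ENNReal.rpow_lt_one hτ1 hq0
  set S : ℝ≥0∞ := (1 - τ ^ q)⁻¹ with hS
  have hSt : S ≠ ∞ := by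
    rw [hS]; exact ENNReal.inv_ne_top.2 (tsub_pos_of_lt hτq).ne'
  have hCt : (S ^ (1 / q)) ^ p ≠ ∞ :=
    ENNReal.rpow_ne_top_of_nonneg hp0.le (ENNReal.rpow_ne_top_of_nonneg (by positivity) hSt)
  refine ⟨((S ^ (1 / q)) ^ p).toNNReal, fun a => ?_⟩
  rw [ENNReal.coe_toNNReal hCt]
  have h := ENNReal.lintegral_mul_le_Lp_mul_Lq (Measure.count : Measure ℕ) hc
    (f := fun i => (τ⁻¹) ^ i * a i) (g := fun i => τ ^ i)
    (measurable_of_countable _).aemeasurable (measurable_of_countable _).aemeasurable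
  simp only [lintegral_count, Pi.mul_apply] at h
  have e1 : ∀ i, (τ⁻¹) ^ i * a i * τ ^ i = a i := fun i => by
    rw [mul_right_comm, ← mul_pow, ENNReal.inv_mul_cancel hτ0 hτt, one_pow, one_mul]
  have e2 : ∀ i, ((τ⁻¹) ^ i * a i) ^ p = ((σ : ℝ≥0∞)⁻¹) ^ i * a i ^ p := fun i => by
    rw [ENNReal.mul_rpow_of_nonneg _ _ hp0.le, ← hτp, ← ENNReal.rpow_natCast,
      ← ENNReal.rpow_natCast, ← ENNReal.inv_rpow, ← ENNReal.rpow_mul, ← ENNReal.rpow_mul,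
      mul_comm p]
  have e3 : ∀ i : ℕ, (τ ^ i) ^ q = (τ ^ q) ^ i := fun i => by
    rw [← ENNReal.rpow_natCast, ← ENNReal.rpow_natCast, ← ENNReal.rpow_mul, ← ENNReal.rpow_mul,
      mul_comm]
  simp only [e1, e2, e3, ENNReal.tsum_geometric] at h
  calc (∑' i, a i) ^ p
      ≤ ((∑' i, ((σ : ℝ≥0∞)⁻¹) ^ i * a i ^ p) ^ (1 / p) * S ^ (1 / q)) ^ p := by gcongr
    _ = _ := by
      rw [ENNReal.mul_rpow_of_nonneg _ _ hp0.le, ← ENNReal.rpow_mul, one_div_mul_cancel hp0.ne',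
        ENNReal.rpow_one, mul_comm]

lemma enorm_sub_rpow_le {𝕜 : Type*} [RCLike 𝕜] {p : ℝ} (hp : 1 < p) (a b c : 𝕜) :
    ‖a - b‖ₑ ^ p ≤ 2 ^ (p - 1) * (‖a - c‖ₑ ^ p + ‖b - c‖ₑ ^ p) := by
  have h1 : ‖a - b‖ₑ ≤ ‖a - c‖ₑ + ‖b - c‖ₑ := by
    have : a - b = (a - c) - (b - c) := by ring
    rw [this]; exact enorm_sub_le
  exact (ENNReal.rpow_le_rpow h1 (by linarith)).trans
    (ENNReal.rpow_add_le_mul_rpow_add_rpow _ _ hp.le)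

end Inequalities

/-! ### Homeomorphisms of the half-line. -/

section Order

/-- A continuous injection of the half-line is strictly monotone or antitone; in the second case η 0
would be a maximum, against surjectivity. -/
lemma NNReal.strictMono_homeomorph (η : ℝ≥0 ≃ₜ ℝ≥0) : StrictMono η := by
  rcases η.continuous.strictMono_of_inj η.injective with h | h
  · exact h
  · exfalso
    obtain ⟨t, ht⟩ := η.surjective (η 0 + 1)
    have : η t ≤ η 0 := h.antitone zero_le
    rw [ht] at this
    exact absurd this (not_le.2 (lt_add_of_pos_right _ one_pos))

lemma NNReal.homeomorph_pos (η : ℝ≥0 ≃ₜ ℝ≥0) {t : ℝ≥0} (ht : 0 < t) : 0 < η t :=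
  zero_le.trans_lt (NNReal.strictMono_homeomorph η ht)

end Order

/-! ### Separated nets and separability. -/

section Nets

variable {X : Type*} [MetricSpace X]

lemma exists_maximal_net (X : Type*) [MetricSpace X] (r : ℝ) (hr : 0 < r) :
    ∃ N : Set X, (∀ a ∈ N, ∀ b ∈ N, a ≠ b → r ≤ dist a b) ∧ ∀ x, ∃ a ∈ N, dist x a < r := by
  obtain ⟨N, hN⟩ := zorn_subset {N : Set X | ∀ a ∈ N, ∀ b ∈ N, a ≠ b → r ≤ dist a b} (by
    intro c hc hchain
    refine ⟨⋃₀ c, ?_, fun s hs => subset_sUnion_of_mem hs⟩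
    rintro a ⟨s, hs, has⟩ b ⟨t, ht, hbt⟩ hab
    rcases hchain.total hs ht with h | h
    · exact hc ht a (h has) b hbt hab
    · exact hc hs a has b (h hbt) hab)
  refine ⟨N, hN.prop, fun x => ?_⟩
  by_contra! hx
  have hins : insert x N ∈ {N : Set X | ∀ a ∈ N, ∀ b ∈ N, a ≠ b → r ≤ dist a b} := by
    rintro a (rfl | ha) b (rfl | hb) hab
    · exact absurd rfl hab
    · exact hx b hb
    · rw [dist_comm]; exact hx a ha
    · exact hN.prop a ha b hb hab
  have hxN : x ∈ N := hN.le_of_ge hins (subset_insert x N) (mem_insert x N)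
  have := hx x hxN
  rw [dist_self] at this
  linarith

lemma disjoint_ball_of_le_dist {x y : X} {r : ℝ} (h : 2 * r ≤ dist x y) :
    Disjoint (Metric.ball x r) (Metric.ball y r) :=
  Metric.ball_disjoint_ball (by linarith)

lemma isLocallyFiniteMeasure_of_measure_ball [MeasurableSpace X] (ν : Measure X)
    (fin : ∀ (x : X) (r : ℝ), 0 < r → ν (Metric.ball x r) < ∞) :
    IsLocallyFiniteMeasure ν :=
  ⟨fun x => ⟨Metric.ball x 1, Metric.ball_mem_nhds x one_pos, fin x 1 one_pos⟩⟩

variable [MeasurableSpace X] [BorelSpace X]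

/-- A maximal ε-separated set meets each ball in a countable set: the balls of radius ε/2 around its
points are disjoint, have positive measure and lie in a ball of finite measure. -/
lemma secondCountableTopology_of_measure_ball (ν : Measure X)
    (pos : ∀ (x : X) (r : ℝ), 0 < r → 0 < ν (Metric.ball x r))
    (fin : ∀ (x : X) (r : ℝ), 0 < r → ν (Metric.ball x r) < ∞) :
    SecondCountableTopology X := by
  refine Metric.secondCountable_of_almost_dense_set fun ε hε => ?_
  obtain ⟨N, hsep, hdense⟩ := exists_maximal_net X ε hε
  refine ⟨N, ?_, fun x => ?_⟩
  · rcases isEmpty_or_nonempty X with hX | ⟨⟨o⟩⟩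
    · exact N.to_countable
    have hcov : N = ⋃ n : ℕ, N ∩ Metric.ball o n := by
      rw [← inter_iUnion, Metric.iUnion_ball_nat, inter_univ]
    rw [hcov]
    refine countable_iUnion fun n => ?_
    set M := N ∩ Metric.ball o (n : ℝ)
    have h := Measure.countable_meas_pos_of_disjoint_of_meas_iUnion_ne_top ν
      (As := fun a : M => Metric.ball (a : X) (ε / 2)) (fun _ => measurableSet_ball)
      (by
        intro a b hab
        refine disjoint_ball_of_le_dist ?_
        have := hsep a a.2.1 b b.2.1 (fun h => hab (Subtype.ext h))
        linarith)
      (by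
        refine ((measure_mono ?_).trans_lt (fin o (n + ε) (by positivity))).ne
        refine iUnion_subset fun a => Metric.ball_subset_ball' ?_
        have := Metric.mem_ball.1 a.2.2
        linarith)
    have hu : {a : M | 0 < ν (Metric.ball (a : X) (ε / 2))} = univ :=
      eq_univ_of_forall fun a => pos _ _ (by positivity)
    rw [hu] at h
    exact Set.countable_coe_iff.1 (Set.countable_univ_iff.1 h)
  · obtain ⟨a, ha, hxa⟩ := hdense x
    exact ⟨a, ha, hxa.le⟩

end Nets

noncomputable section

/-! ### Radii in geometric progression. -/

section Scale

/-- The radius `q ^ (-j)`. -/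
def scale (q : ℝ) (j : ℤ) : ℝ := q ^ (-j)

variable {q : ℝ}

lemma scale_pos (hq : 2 ≤ q) (j : ℤ) : 0 < scale q j := zpow_pos (by linarith) _

lemma scale_sub_one (hq : 2 ≤ q) (j : ℤ) : scale q (j - 1) = q * scale q j := by
  have : q ≠ 0 := by linarith
  rw [scale, scale, neg_sub, sub_eq_add_neg, zpow_add₀ this, zpow_one]

lemma scale_anti (hq : 2 ≤ q) {i j : ℤ} (h : i ≤ j) : scale q j ≤ scale q i :=
  zpow_le_zpow_right₀ (by linarith) (by omega)

lemma two_mul_scale_le (hq : 2 ≤ q) (j : ℤ) : 2 * scale q j ≤ scale q (j - 1) := by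
  rw [scale_sub_one hq]
  exact mul_le_mul_of_nonneg_right hq (scale_pos hq j).le

lemma exists_scale (hq : 2 ≤ q) {d : ℝ} (hd : 0 < d) :
    ∃ k : ℤ, scale q (k + 1) ≤ d ∧ d < scale q k := by
  obtain ⟨n, hn1, hn2⟩ := exists_mem_Ico_zpow hd (show 1 < q by linarith)
  refine ⟨-n - 1, ?_, ?_⟩
  · simpa [scale] using hn1
  · simpa [scale, add_comm] using hn2

lemma tendsto_scale (hq : 2 ≤ q) : Tendsto (fun n : ℕ => scale q n) atTop (𝓝 0) := by
  have h : ∀ n : ℕ, scale q n = (q⁻¹) ^ n := fun n => by simp [scale]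
  simp only [h]
  exact tendsto_pow_atTop_nhds_zero_of_lt_one (by positivity) (inv_lt_one_of_one_lt₀ (by linarith))

end Scale

/-! ### Balls at the scales q^(-j), and the scales bounded by the diameter. -/

section Balls

variable {X : Type*} [MetricSpace X]

/-- The ball of radius `q ^ (-j)`. -/
abbrev sball (q : ℝ) (j : ℤ) (x : X) : Set X := Metric.ball x (scale q j)

lemma sball_subset_of_dist {q : ℝ} (hq : 2 ≤ q) {j : ℤ} {x y : X} (h : dist y x < scale q j) :
    sball q j y ⊆ sball q (j - 1) x := by
  refine Metric.ball_subset_ball' ?_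
  have := two_mul_scale_le hq j
  linarith

lemma sball_anti {q : ℝ} (hq : 2 ≤ q) {i j : ℤ} (h : i ≤ j) (x : X) :
    sball q j x ⊆ sball q i x := Metric.ball_subset_ball (scale_anti hq h)

/-- The scale `q ^ (-j)` is at most comparable to the diameter of the space. -/
def Admissible (X : Type*) [MetricSpace X] (q : ℝ) (j : ℤ) : Prop :=
  ∃ y z : X, scale q j ≤ q ^ 2 * dist y z

lemma Admissible.mono {q : ℝ} (hq : 2 ≤ q) {i j : ℤ} (hij : i ≤ j) (h : Admissible X q i) :
    Admissible X q j := by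
  obtain ⟨y, z, hyz⟩ := h
  exact ⟨y, z, (scale_anti hq hij).trans hyz⟩

lemma exists_admissible [Nontrivial X] {q : ℝ} (hq : 2 ≤ q) : ∃ J : ℕ, Admissible X q J := by
  obtain ⟨y, z, hyz⟩ := exists_pair_ne X
  have hd : 0 < q ^ 2 * dist y z := mul_pos (by positivity) (dist_pos.2 hyz)
  obtain ⟨J, hJ⟩ := ((tendsto_scale hq).eventually (gt_mem_nhds hd)).exists
  exact ⟨J, y, z, hJ.le⟩

open Classical in
/-- The indicator of the set of admissible scales. -/
def adm (X : Type*) [MetricSpace X] (q : ℝ) (j : ℤ) : ℝ≥0∞ := if Admissible X q j then 1 else 0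

lemma adm_eq_one {q : ℝ} {j : ℤ} (h : Admissible X q j) : adm X q j = 1 := if_pos h

lemma adm_eq_zero {q : ℝ} {j : ℤ} (h : ¬ Admissible X q j) : adm X q j = 0 := if_neg h

end Balls

/-! ### Doubling and geometric decay of a measure across scales. -/

section ScaleRegular

variable {X : Type*} [MetricSpace X] [MeasurableSpace X]

/-- A measure which is doubling and whose values on concentric balls decay geometrically, at the
scales up to the diameter of the space. -/
structure ScaleRegular (q : ℝ) (D θ : ℝ≥0) (ν : Measure X) : Prop where
  two_le : 2 ≤ q
  one_le : 1 ≤ D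
  theta_pos : 0 < θ
  theta_lt : θ < 1
  ball_pos : ∀ (x : X) (r : ℝ), 0 < r → 0 < ν (Metric.ball x r)
  ball_lt_top : ∀ (x : X) (r : ℝ), 0 < r → ν (Metric.ball x r) < ∞
  doubling : ∀ (x : X) (r : ℝ), 0 < r → ν (Metric.ball x (q * r)) ≤ D * ν (Metric.ball x r)
  decay : ∀ (x : X) (j : ℤ) (i : ℕ), Admissible X q j →
    ν (sball q (j + i) x) ≤ D * θ ^ i * ν (sball q j x)

namespace ScaleRegular

variable {q : ℝ} {D θ : ℝ≥0} {ν : Measure X}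

lemma coe_ne_zero (h : ScaleRegular q D θ ν) : (D : ℝ≥0∞) ≠ 0 := by
  exact_mod_cast (zero_lt_one.trans_le h.one_le).ne'

lemma one_le_coe (h : ScaleRegular q D θ ν) : (1 : ℝ≥0∞) ≤ D := by exact_mod_cast h.one_le

lemma measure_ne_zero (h : ScaleRegular q D θ ν) (j : ℤ) (x : X) : ν (sball q j x) ≠ 0 :=
  (h.ball_pos x _ (scale_pos h.two_le j)).ne'

lemma measure_ne_top (h : ScaleRegular q D θ ν) (j : ℤ) (x : X) : ν (sball q j x) ≠ ∞ :=
  (h.ball_lt_top x _ (scale_pos h.two_le j)).ne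

lemma measure_sub_one_le (h : ScaleRegular q D θ ν) (j : ℤ) (x : X) :
    ν (sball q (j - 1) x) ≤ D * ν (sball q j x) := by
  rw [sball, scale_sub_one h.two_le]
  exact h.doubling x _ (scale_pos h.two_le j)

lemma measure_le_of_dist (h : ScaleRegular q D θ ν) {j : ℤ} {x y : X}
    (hxy : dist x y < scale q j) : ν (sball q j x) ≤ D * ν (sball q j y) :=
  (measure_mono (sball_subset_of_dist h.two_le hxy)).trans (h.measure_sub_one_le j y)

lemma inv_le_of_dist (h : ScaleRegular q D θ ν) {j : ℤ} {x y : X}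
    (hxy : dist x y < scale q j) : (ν (sball q j x))⁻¹ ≤ D * (ν (sball q j y))⁻¹ :=
  inv_le_mul_inv_of_le_mul h.coe_ne_zero ENNReal.coe_ne_top
    (h.measure_le_of_dist (by rwa [dist_comm]))

lemma inv_le_sub_one (h : ScaleRegular q D θ ν) (j : ℤ) (x : X) :
    (ν (sball q j x))⁻¹ ≤ D * (ν (sball q (j - 1) x))⁻¹ :=
  inv_le_mul_inv_of_le_mul h.coe_ne_zero ENNReal.coe_ne_top (h.measure_sub_one_le j x)

lemma inv_decay (h : ScaleRegular q D θ ν) (x : X) (j : ℤ) (i : ℕ) (hj : Admissible X q j) :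
    (ν (sball q j x))⁻¹ ≤ D * θ ^ i * (ν (sball q (j + i) x))⁻¹ := by
  refine inv_le_mul_inv_of_le_mul ?_ ?_ (h.decay x j i hj)
  · refine mul_ne_zero h.coe_ne_zero (pow_ne_zero _ ?_)
    exact_mod_cast h.theta_pos.ne'
  · exact ENNReal.mul_ne_top ENNReal.coe_ne_top (ENNReal.pow_ne_top ENNReal.coe_ne_top)

lemma isLocallyFiniteMeasure (h : ScaleRegular q D θ ν) : IsLocallyFiniteMeasure ν :=
  isLocallyFiniteMeasure_of_measure_ball ν h.ball_lt_top

variable [BorelSpace X]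

lemma secondCountableTopology (h : ScaleRegular q D θ ν) : SecondCountableTopology X :=
  secondCountableTopology_of_measure_ball ν h.ball_pos h.ball_lt_top

end ScaleRegular

lemma tsum_int_eq_tsum_nat {f : ℤ → ℝ≥0∞} (m : ℤ) (hf : ∀ j, m < j → f j = 0) :
    ∑' j, f j = ∑' i : ℕ, f (m - i) := by
  have hinj : Function.Injective (fun i : ℕ => m - (i : ℤ)) := fun a b hab => by
    simp only at hab; omega
  refine (hinj.tsum_eq ?_).symm
  intro j hj
  have : j ≤ m := by
    by_contra! h
    exact hj (hf j h)
  exact ⟨(m - j).toNat, by simp only; omega⟩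

open Classical in
/-- Geometric decay makes the sum over all scales above `dist z t` comparable to its last term. -/
lemma ScaleRegular.tsum_inv_sq_le {q : ℝ} {D θ : ℝ≥0} {ν : Measure X}
    (h : ScaleRegular q D θ ν) {z t : X} (hzt : z ≠ t) :
    ∑' j : ℤ, (adm X q j * (ν (sball q j z))⁻¹ ^ 2 * if dist t z < scale q (j - 1) then 1 else 0) ≤
      (D : ℝ≥0∞) ^ 4 * (1 - θ : ℝ≥0∞)⁻¹ * (ν (Metric.ball z (dist z t)))⁻¹ ^ 2 := by
  obtain ⟨k, hk1, hk2⟩ := exists_scale h.two_le (dist_pos.2 hzt)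
  -- Terms with j > k + 1 vanish, since there scale(j-1) ≤ scale(k+1) ≤ d(z,t). What is left is a
  -- sum over growing radii, summed by the decay condition.
  rw [tsum_int_eq_tsum_nat (k + 1)]
  swap
  · intro j hj
    rw [if_neg, mul_zero]
    rw [not_lt, dist_comm]
    exact (scale_anti h.two_le (by omega)).trans hk1
  have hθ1 : (θ : ℝ≥0∞) ≤ 1 := by exact_mod_cast h.theta_lt.le
  have key : ∀ i : ℕ, (adm X q (k + 1 - i) * (ν (sball q (k + 1 - i) z))⁻¹ ^ 2 *
      if dist t z < scale q (k + 1 - i - 1) then 1 else 0) ≤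
      (D : ℝ≥0∞) ^ 4 * (ν (Metric.ball z (dist z t)))⁻¹ ^ 2 * θ ^ i := by
    intro i
    by_cases hi : Admissible X q (k + 1 - i)
    · have h1 := h.inv_decay z _ i hi
      rw [sub_add_cancel] at h1
      have h2 := h.inv_le_sub_one (k + 1) z
      rw [add_sub_cancel_right] at h2
      have h3 : (ν (sball q k z))⁻¹ ≤ (ν (Metric.ball z (dist z t)))⁻¹ :=
        ENNReal.inv_le_inv' (measure_mono (Metric.ball_subset_ball hk2.le))
      calc _ ≤ 1 * (ν (sball q (k + 1 - i) z))⁻¹ ^ 2 * 1 := by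
            rw [adm_eq_one hi]; gcongr; split_ifs <;> simp
        _ ≤ 1 * (D * θ ^ i * (D * (ν (Metric.ball z (dist z t)))⁻¹)) ^ 2 * 1 := by
            gcongr
            exact h1.trans (by gcongr; exact h2.trans (by gcongr))
        _ = (D : ℝ≥0∞) ^ 4 * (ν (Metric.ball z (dist z t)))⁻¹ ^ 2 * (θ ^ i * θ ^ i) := by ring
        _ ≤ (D : ℝ≥0∞) ^ 4 * (ν (Metric.ball z (dist z t)))⁻¹ ^ 2 * (1 * θ ^ i) := by
            gcongr; exact pow_le_one₀ zero_le hθ1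
        _ = _ := by rw [one_mul]
    · rw [adm_eq_zero hi]; simp
  refine (ENNReal.tsum_le_tsum key).trans_eq ?_
  rw [ENNReal.tsum_mul_left, ENNReal.tsum_geometric]
  ring

end ScaleRegular

/-! ### Measurability of ball integrals, and Fubini over balls. -/

section Measurability

lemma measurable_enorm_sub_rpow {𝕜 X : Type*} [RCLike 𝕜] [MeasurableSpace X] {w : X → 𝕜} (hw : Measurable w) (p : ℝ) :
    Measurable (Function.uncurry fun z t : X => ‖w z - w t‖ₑ ^ p) :=
  ((hw.comp measurable_fst).sub (hw.comp measurable_snd)).enorm.pow_const p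

variable {X : Type*} [MetricSpace X] [MeasurableSpace X] [BorelSpace X]
  [SecondCountableTopology X]

lemma measurable_setLIntegral_ball {α : Type*} [MeasurableSpace α] (ν : Measure X) [SFinite ν]
    {c : α → X} (hc : Measurable c) {G : α → X → ℝ≥0∞} (hG : Measurable (Function.uncurry G))
    (r : ℝ) : Measurable fun a => ∫⁻ z in Metric.ball (c a) r, G a z ∂ν := by
  have h1 : ∀ a, ∫⁻ z in Metric.ball (c a) r, G a z ∂ν =
      ∫⁻ z, {b : α × X | dist b.2 (c b.1) < r}.indicator (Function.uncurry G) (a, z) ∂ν := by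
    intro a
    rw [← lintegral_indicator measurableSet_ball]
    congr with z
  simp only [h1]
  have hs : MeasurableSet {b : α × X | dist b.2 (c b.1) < r} :=
    measurableSet_lt (measurable_snd.dist (hc.comp measurable_fst)) measurable_const
  exact (hG.indicator hs).lintegral_prod_right'

lemma measurable_measure_ball (ν : Measure X) [SFinite ν] (r : ℝ) :
    Measurable fun x => ν (Metric.ball x r) := by
  have := measurable_setLIntegral_ball ν measurable_id (G := fun _ _ => 1)
    (measurable_const) r
  simpa using this

lemma lintegral_setLIntegral_ball_swap (μ ν : Measure X) [SFinite μ] [SFinite ν]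
    {K : X → X → ℝ≥0∞} (hK : Measurable (Function.uncurry K)) (r : ℝ) :
    ∫⁻ x, ∫⁻ z in Metric.ball x r, K x z ∂ν ∂μ = ∫⁻ z, ∫⁻ x in Metric.ball z r, K x z ∂μ ∂ν := by
  have hs : MeasurableSet {b : X × X | dist b.2 b.1 < r} :=
    measurableSet_lt (measurable_snd.dist measurable_fst) measurable_const
  calc ∫⁻ x, ∫⁻ z in Metric.ball x r, K x z ∂ν ∂μ
      = ∫⁻ x, ∫⁻ z, {b : X × X | dist b.2 b.1 < r}.indicator (Function.uncurry K) (x, z) ∂ν ∂μ := by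
        congr with x
        rw [← lintegral_indicator measurableSet_ball]
        congr with z
    _ = ∫⁻ z, ∫⁻ x, {b : X × X | dist b.2 b.1 < r}.indicator (Function.uncurry K) (x, z) ∂μ ∂ν :=
        lintegral_lintegral_swap (hK.indicator hs).aemeasurable
    _ = _ := by
        congr with z
        rw [← lintegral_indicator measurableSet_ball]
        congr with x
        simp only [indicator, mem_ofPred_eq, Metric.mem_ball, dist_comm]
        rfl

/-- Exchanging the integrals leaves ∫ μ(B(x,r))⁻¹ dμ(x) over B(z,r), which is at most D. The measure
μ thus disappears, whatever its relation to ν; this is how energies for different measures are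
compared. -/
lemma lintegral_inv_measure_ball_mul_setLIntegral_le {D : ℝ≥0} {r : ℝ} {μ : Measure X}
    (h0 : ∀ z, μ (Metric.ball z r) ≠ 0) (ht : ∀ z, μ (Metric.ball z r) ≠ ∞)
    (hD : ∀ x z, dist x z < r → (μ (Metric.ball x r))⁻¹ ≤ D * (μ (Metric.ball z r))⁻¹)
    (ν : Measure X) [SFinite μ] [SFinite ν] {h : X → ℝ≥0∞} (hh : Measurable h) :
    ∫⁻ x, (μ (Metric.ball x r))⁻¹ * ∫⁻ z in Metric.ball x r, h z ∂ν ∂μ ≤ D * ∫⁻ z, h z ∂ν := by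
  have hm : Measurable fun x => (μ (Metric.ball x r))⁻¹ := (measurable_measure_ball μ _).inv
  calc ∫⁻ x, (μ (Metric.ball x r))⁻¹ * ∫⁻ z in Metric.ball x r, h z ∂ν ∂μ
      = ∫⁻ x, ∫⁻ z in Metric.ball x r, (μ (Metric.ball x r))⁻¹ * h z ∂ν ∂μ := by
        congr with x
        rw [lintegral_const_mul _ hh]
    _ = ∫⁻ z, ∫⁻ x in Metric.ball z r, (μ (Metric.ball x r))⁻¹ * h z ∂μ ∂ν :=
        lintegral_setLIntegral_ball_swap μ ν (K := fun x z => (μ (Metric.ball x r))⁻¹ * h z)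
          ((hm.comp measurable_fst).mul (hh.comp measurable_snd)) _
    _ ≤ ∫⁻ z, D * h z ∂ν := by
        refine lintegral_mono fun z => ?_
        calc ∫⁻ x in Metric.ball z r, (μ (Metric.ball x r))⁻¹ * h z ∂μ
            ≤ ∫⁻ x in Metric.ball z r, D * (μ (Metric.ball z r))⁻¹ * h z ∂μ := by
              refine setLIntegral_mono measurable_const fun x hx => ?_
              gcongr
              exact hD x z hx
          _ = D * h z * ((μ (Metric.ball z r))⁻¹ * μ (Metric.ball z r)) := by
              rw [setLIntegral_const]; ring
          _ = D * h z := by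
              rw [ENNReal.inv_mul_cancel (h0 z) (ht z), mul_one]
    _ = _ := lintegral_const_mul _ hh

lemma ScaleRegular.lintegral_inv_mul_setLIntegral_le {q : ℝ} {D θ : ℝ≥0} {μ : Measure X}
    (hμ : ScaleRegular q D θ μ) (ν : Measure X) [SFinite μ] [SFinite ν] {h : X → ℝ≥0∞}
    (hh : Measurable h) (j : ℤ) :
    ∫⁻ x, (μ (sball q j x))⁻¹ * ∫⁻ z in sball q j x, h z ∂ν ∂μ ≤ D * ∫⁻ z, h z ∂ν :=
  lintegral_inv_measure_ball_mul_setLIntegral_le (hμ.measure_ne_zero j) (hμ.measure_ne_top j)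
    (fun _ _ hx => hμ.inv_le_of_dist hx) ν hh

end Measurability

/-! ### The energy and its decomposition over scales. -/

section Energies

variable {𝕜 X : Type*} [RCLike 𝕜] [MetricSpace X] [MeasurableSpace X]

/-- The Besov energy of critical smoothness, in terms of the measure alone. -/
def energy (ν : Measure X) (p : ℝ) (w : X → 𝕜) : ℝ≥0∞ :=
  ∫⁻ z, ∫⁻ t, (ν (Metric.ball z (dist z t)))⁻¹ ^ 2 * ‖w z - w t‖ₑ ^ p ∂ν ∂ν

/-- The pointwise difference energy of `w` at the scale `q ^ (-j)`. -/
def diffEnergy (ν : Measure X) (q p : ℝ) (w : X → 𝕜) (j : ℤ) (z : X) : ℝ≥0∞ :=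
  adm X q j * (ν (sball q j z))⁻¹ ^ 2 * ∫⁻ t in sball q (j - 1) z, ‖w z - w t‖ₑ ^ p ∂ν

/-- The mean oscillation energy of `w` at the scale `q ^ (-j)`. -/
def oscEnergy (ν : Measure X) (q p : ℝ) (w : X → 𝕜) (j : ℤ) (x : X) : ℝ≥0∞ :=
  adm X q j * ((ν (sball q j x))⁻¹ ^ 2 *
    ∫⁻ z in sball q j x, ∫⁻ t in sball q j x, ‖w z - w t‖ₑ ^ p ∂ν ∂ν)

variable [BorelSpace X] [SecondCountableTopology X] {q p : ℝ} {D θ : ℝ≥0} {μ ν : Measure X}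
  [SFinite μ] [SFinite ν] {w : X → 𝕜}

lemma measurable_diffEnergy (ν : Measure X) [SFinite ν] (q p : ℝ) (hw : Measurable w) (j : ℤ) :
    Measurable (diffEnergy ν q p w j) :=
  ((measurable_measure_ball ν _).inv.pow_const 2 |>.const_mul _).mul
    (measurable_setLIntegral_ball ν measurable_id (measurable_enorm_sub_rpow hw p) _)

lemma measurable_oscEnergy (ν : Measure X) [SFinite ν] (q p : ℝ) (hw : Measurable w) (j : ℤ) :
    Measurable (oscEnergy ν q p w j) := by
  refine (((measurable_measure_ball ν _).inv.pow_const 2).mul ?_).const_mul _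
  refine measurable_setLIntegral_ball ν measurable_id ?_ _
  exact measurable_setLIntegral_ball ν (α := X × X) (c := Prod.fst) measurable_fst
    (G := fun b t => ‖w b.2 - w t‖ₑ ^ p)
    ((measurable_enorm_sub_rpow hw p).comp
      ((measurable_snd.comp measurable_fst).prodMk measurable_snd)) _

/-- Summing over j under the double integral reduces this to a bound for the kernel at each pair
(z,t), which is `tsum_inv_sq_le`. -/
lemma ScaleRegular.tsum_lintegral_diffEnergy_le (h : ScaleRegular q D θ ν) (hp : 0 < p)
    (hw : Measurable w) :
    ∑' j, ∫⁻ z, diffEnergy ν q p w j z ∂ν ≤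
      (D : ℝ≥0∞) ^ 4 * (1 - θ : ℝ≥0∞)⁻¹ * energy ν p w := by
  classical
  have hG := measurable_enorm_sub_rpow hw p
  have hC : (D : ℝ≥0∞) ^ 4 * (1 - θ : ℝ≥0∞)⁻¹ ≠ ∞ := by
    refine ENNReal.mul_ne_top (ENNReal.pow_ne_top ENNReal.coe_ne_top) (ENNReal.inv_ne_top.2 ?_)
    exact (tsub_pos_of_lt (by exact_mod_cast h.theta_lt)).ne'
  rw [← lintegral_tsum fun j => (measurable_diffEnergy ν q p hw j).aemeasurable, energy,
    ← lintegral_const_mul' _ _ hC]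
  refine lintegral_mono fun z => ?_
  have h1 : ∀ j, diffEnergy ν q p w j z = ∫⁻ t, (adm X q j * (ν (sball q j z))⁻¹ ^ 2 *
      if dist t z < scale q (j - 1) then 1 else 0) * ‖w z - w t‖ₑ ^ p ∂ν := by
    intro j
    have hm : Measurable fun t => ‖w z - w t‖ₑ ^ p := hG.comp measurable_prodMk_left
    rw [diffEnergy, ← lintegral_const_mul _ hm, ← lintegral_indicator measurableSet_ball]
    congr with t
    simp only [indicator, Metric.mem_ball]
    split_ifs <;> simp
  simp only [h1]
  rw [← lintegral_tsum, ← lintegral_const_mul' _ _ hC]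
  swap
  · intro j
    refine Measurable.aemeasurable ?_
    refine Measurable.mul ?_ (hG.comp measurable_prodMk_left)
    refine Measurable.const_mul ?_ _
    exact Measurable.ite measurableSet_ball measurable_const measurable_const
  refine lintegral_mono fun t => ?_
  rw [ENNReal.tsum_mul_right]
  -- On the diagonal the ball is empty and the kernel of the energy is infinite; the factor 0 ^ p =
  -- 0 makes the product vanish.
  rcases eq_or_ne z t with rfl | hzt
  · simp [hp]
  · rw [← mul_assoc]
    gcongr
    exact h.tsum_inv_sq_le hzt

/-- The centre x is replaced by z in its ball: doubling moves the normalisation, and B_j(x) ⊆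
B_{j-1}(z). This inclusion is why `diffEnergy` integrates over a ball one scale larger. -/
lemma ScaleRegular.oscEnergy_le (h : ScaleRegular q D θ ν) (p : ℝ) (hw : Measurable w) (j : ℤ)
    (x : X) : oscEnergy ν q p w j x ≤
      (D : ℝ≥0∞) ^ 2 * ∫⁻ z in sball q j x, diffEnergy ν q p w j z ∂ν := by
  have hG := measurable_enorm_sub_rpow hw p
  rw [oscEnergy, ← lintegral_const_mul _ (measurable_diffEnergy ν q p hw j), ← mul_assoc,
    ← lintegral_const_mul _ (measurable_setLIntegral_ball ν measurable_const hG _)]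
  refine setLIntegral_mono ((measurable_diffEnergy ν q p hw j).const_mul _) fun z hz => ?_
  rw [diffEnergy]
  calc adm X q j * (ν (sball q j x))⁻¹ ^ 2 * ∫⁻ t in sball q j x, ‖w z - w t‖ₑ ^ p ∂ν
      ≤ adm X q j * (D * (ν (sball q j z))⁻¹) ^ 2 *
          ∫⁻ t in sball q (j - 1) z, ‖w z - w t‖ₑ ^ p ∂ν := by
        rw [Metric.mem_ball'] at hz
        gcongr
        · exact h.inv_le_of_dist hz
        · exact sball_subset_of_dist h.two_le hz
    _ = _ := by ring

/-- At each scale the weight μ(B_j)⁻¹ cancels the integration in μ up to a constant, so the ν-energy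
controls the ν-oscillations as seen by μ. -/
lemma ScaleRegular.tsum_lintegral_oscEnergy_le (hμ : ScaleRegular q D θ μ)
    (hν : ScaleRegular q D θ ν) (hp : 0 < p) (hw : Measurable w) :
    ∑' j, ∫⁻ x, (μ (sball q j x))⁻¹ * oscEnergy ν q p w j x ∂μ ≤
      (D : ℝ≥0∞) ^ 7 * (1 - θ : ℝ≥0∞)⁻¹ * energy ν p w := by
  have h1 : ∀ j, ∫⁻ x, (μ (sball q j x))⁻¹ * oscEnergy ν q p w j x ∂μ ≤
      (D : ℝ≥0∞) ^ 3 * ∫⁻ z, diffEnergy ν q p w j z ∂ν := by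
    intro j
    have hd := measurable_diffEnergy ν q p hw j
    calc ∫⁻ x, (μ (sball q j x))⁻¹ * oscEnergy ν q p w j x ∂μ
        ≤ ∫⁻ x, (D : ℝ≥0∞) ^ 2 *
            ((μ (sball q j x))⁻¹ * ∫⁻ z in sball q j x, diffEnergy ν q p w j z ∂ν) ∂μ := by
          refine lintegral_mono fun x => ?_
          rw [mul_left_comm]
          gcongr
          exact hν.oscEnergy_le p hw j x
      _ = (D : ℝ≥0∞) ^ 2 *
            ∫⁻ x, (μ (sball q j x))⁻¹ * ∫⁻ z in sball q j x, diffEnergy ν q p w j z ∂ν ∂μ :=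
          lintegral_const_mul' _ _ (ENNReal.pow_ne_top ENNReal.coe_ne_top)
      _ ≤ (D : ℝ≥0∞) ^ 2 * (D * ∫⁻ z, diffEnergy ν q p w j z ∂ν) := by
          gcongr
          exact hμ.lintegral_inv_mul_setLIntegral_le ν hd j
      _ = _ := by ring
  calc _ ≤ ∑' j, (D : ℝ≥0∞) ^ 3 * ∫⁻ z, diffEnergy ν q p w j z ∂ν := ENNReal.tsum_le_tsum h1
    _ ≤ (D : ℝ≥0∞) ^ 3 * ((D : ℝ≥0∞) ^ 4 * (1 - θ : ℝ≥0∞)⁻¹ * energy ν p w) := by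
        rw [ENNReal.tsum_mul_left]
        gcongr
        exact hν.tsum_lintegral_diffEnergy_le hp hw
    _ = _ := by ring

end Energies

/-! ### Comparison of averages over sets that fill a ball. -/

section Averages

variable {𝕜 X : Type*} [RCLike 𝕜] [MeasurableSpace X] {ν : Measure X} {w : X → 𝕜} {p : ℝ}

lemma isProbabilityMeasure_inv_smul_restrict {S : Set X} (h0 : ν S ≠ 0) (ht : ν S ≠ ∞) :
    IsProbabilityMeasure ((ν S)⁻¹ • ν.restrict S) :=
  ⟨by simp [ENNReal.inv_mul_cancel h0 ht]⟩

lemma integrable_inv_smul_restrict {S : Set X} (h0 : ν S ≠ 0) (hw : IntegrableOn w S ν) :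
    Integrable w ((ν S)⁻¹ • ν.restrict S) :=
  hw.integrable.smul_measure (ENNReal.inv_ne_top.2 h0)

lemma enorm_setAverage_sub_const_rpow_le (hp : 1 < p) {S : Set X} (h0 : ν S ≠ 0) (ht : ν S ≠ ∞)
    (hw : IntegrableOn w S ν) (c : 𝕜) :
    ‖⨍ x in S, w x ∂ν - c‖ₑ ^ p ≤ (ν S)⁻¹ * ∫⁻ x in S, ‖w x - c‖ₑ ^ p ∂ν := by
  have := isProbabilityMeasure_inv_smul_restrict h0 ht
  rw [setAverage_eq']
  refine (enorm_integral_sub_const_rpow_le _ hp (integrable_inv_smul_restrict h0 hw) c).trans_eq ?_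
  rw [lintegral_smul_measure, smul_eq_mul]

/-- Jensen on S × T, then enlargement of both sets to B at the cost of K each. The resulting
(K²)^(1/p) is at most K² because K ≥ 1 and p > 1. -/
lemma enorm_setAverage_sub_setAverage_le (hp : 1 < p) {S T B : Set X} {K : ℝ≥0∞} (hK1 : 1 ≤ K)
    (hK : K ≠ ∞) (hSB : S ⊆ B) (hTB : T ⊆ B) (hB0 : ν B ≠ 0) (hB : ν B ≠ ∞)
    (hS : ν B ≤ K * ν S) (hT : ν B ≤ K * ν T) (hw : IntegrableOn w B ν) :
    ‖⨍ x in S, w x ∂ν - ⨍ x in T, w x ∂ν‖ₑ ≤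
      K ^ 2 * ((ν B)⁻¹ ^ 2 * ∫⁻ x in B, ∫⁻ y in B, ‖w x - w y‖ₑ ^ p ∂ν ∂ν) ^ (1 / p) := by
  have hp0 : 0 < p := by linarith
  have hK0 : K ≠ 0 := (zero_lt_one.trans_le hK1).ne'
  have hS0 : ν S ≠ 0 := fun h => hB0 (by simpa [h] using hS)
  have hT0 : ν T ≠ 0 := fun h => hB0 (by simpa [h] using hT)
  have hSt : ν S ≠ ∞ := ((measure_mono hSB).trans_lt hB.lt_top).ne
  have hTt : ν T ≠ ∞ := ((measure_mono hTB).trans_lt hB.lt_top).ne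
  have := isProbabilityMeasure_inv_smul_restrict hS0 hSt
  have := isProbabilityMeasure_inv_smul_restrict hT0 hTt
  set A := (ν B)⁻¹ ^ 2 * ∫⁻ x in B, ∫⁻ y in B, ‖w x - w y‖ₑ ^ p ∂ν ∂ν with hA
  have h1 : ‖⨍ x in S, w x ∂ν - ⨍ x in T, w x ∂ν‖ₑ ^ p ≤ K ^ 2 * A := by
    rw [setAverage_eq', setAverage_eq']
    refine (enorm_integral_sub_integral_rpow_le _ _ hp
      (integrable_inv_smul_restrict hS0 (hw.mono_set hSB))
      (integrable_inv_smul_restrict hT0 (hw.mono_set hTB))).trans ?_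
    simp only [lintegral_smul_measure, smul_eq_mul]
    rw [lintegral_const_mul' _ _ (ENNReal.inv_ne_top.2 hT0)]
    calc (ν S)⁻¹ * ((ν T)⁻¹ * ∫⁻ x in S, ∫⁻ y in T, ‖w x - w y‖ₑ ^ p ∂ν ∂ν)
        ≤ (K * (ν B)⁻¹) * ((K * (ν B)⁻¹) *
            ∫⁻ x in B, ∫⁻ y in B, ‖w x - w y‖ₑ ^ p ∂ν ∂ν) := by
          gcongr
          · exact inv_le_mul_inv_of_le_mul hK0 hK hS
          · exact inv_le_mul_inv_of_le_mul hK0 hK hT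
      _ = _ := by rw [hA]; ring
  have hK2 : (1 : ℝ≥0∞) ≤ K ^ 2 := one_le_pow₀ hK1
  calc ‖⨍ x in S, w x ∂ν - ⨍ x in T, w x ∂ν‖ₑ
      = (‖⨍ x in S, w x ∂ν - ⨍ x in T, w x ∂ν‖ₑ ^ p) ^ (1 / p) := by
        rw [← ENNReal.rpow_mul, mul_one_div_cancel hp0.ne', ENNReal.rpow_one]
    _ ≤ (K ^ 2 * A) ^ (1 / p) := by gcongr
    _ = (K ^ 2) ^ (1 / p) * A ^ (1 / p) := ENNReal.mul_rpow_of_nonneg _ _ (by positivity)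
    _ ≤ (K ^ 2) ^ (1 : ℝ) * A ^ (1 / p) := by
        gcongr ?_ * _
        refine ENNReal.rpow_le_rpow_of_exponent_le hK2 ?_
        rw [div_le_one hp0]
        exact hp.le
    _ = _ := by rw [ENNReal.rpow_one]

end Averages

/-! ### Telescoping averages, the Hardy inequality for tails, convergence almost everywhere. -/

section Tails

variable {𝕜 X : Type*} [RCLike 𝕜] [MetricSpace X] [MeasurableSpace X]

/-- The sum of the mean oscillations of `w` over the balls centred at `x` of radius at most
`q ^ (-k)`. -/
def tailSum (ν : Measure X) (q p : ℝ) (w : X → 𝕜) (k : ℤ) (x : X) : ℝ≥0∞ :=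
  ∑' i : ℕ, oscEnergy ν q p w (k + i) x ^ (1 / p)

/-- The mean oscillations of `w` over small balls centred at `x` are summable. -/
def OscSummable (ν : Measure X) (q p : ℝ) (w : X → 𝕜) (x : X) : Prop :=
  ∃ J : ℕ, Admissible X q J ∧ tailSum ν q p w J x ≠ ∞

variable {q p : ℝ} {D θ : ℝ≥0} {μ ν : Measure X} {w : X → 𝕜} {x y : X}

lemma tailSum_anti {k l : ℤ} (hkl : k ≤ l) : tailSum ν q p w l x ≤ tailSum ν q p w k x := by
  obtain ⟨m, rfl⟩ := Int.le.dest hkl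
  have hinj : Function.Injective (fun i : ℕ => m + i) := add_right_injective m
  refine le_trans (le_of_eq ?_) (ENNReal.tsum_comp_le_tsum_of_injective hinj _)
  simp only [tailSum, Nat.cast_add, add_assoc]

lemma oscEnergy_rpow_le_tailSum (k : ℤ) :
    oscEnergy ν q p w k x ^ (1 / p) ≤ tailSum ν q p w k x := by
  have := ENNReal.le_tsum (f := fun i : ℕ => oscEnergy ν q p w (k + i) x ^ (1 / p)) 0
  simpa [tailSum] using this

lemma measurable_tailSum [BorelSpace X] [SecondCountableTopology X] (ν : Measure X) [SFinite ν]
    (q p : ℝ) (hw : Measurable w) (k : ℤ) : Measurable (tailSum ν q p w k) :=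
  Measurable.tsum fun i => (measurable_oscEnergy ν q p hw (k + i)).pow_const _

namespace ScaleRegular

lemma enorm_average_sub_succ_le (h : ScaleRegular q D θ ν) (hp : 1 < p)
    (hint : ∀ x r, IntegrableOn w (Metric.ball x r) ν) {k : ℤ} (hk : Admissible X q k) :
    ‖⨍ z in sball q k x, w z ∂ν - ⨍ z in sball q (k + 1) x, w z ∂ν‖ₑ ≤
      (D : ℝ≥0∞) ^ 2 * oscEnergy ν q p w k x ^ (1 / p) := by
  rw [oscEnergy, adm_eq_one hk, one_mul]
  refine enorm_setAverage_sub_setAverage_le hp h.one_le_coe ENNReal.coe_ne_top subset_rfl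
    (sball_anti h.two_le (by omega) x) (h.measure_ne_zero _ _) (h.measure_ne_top _ _) ?_ ?_
    (hint _ _)
  · exact le_mul_of_one_le_left zero_le h.one_le_coe
  · simpa using h.measure_sub_one_le (k + 1) x

lemma enorm_average_sub_average_le (h : ScaleRegular q D θ ν) (hp : 1 < p)
    (hint : ∀ x r, IntegrableOn w (Metric.ball x r) ν) {k : ℤ} (hk : Admissible X q (k - 1))
    (hxy : dist x y < scale q k) :
    ‖⨍ z in sball q k x, w z ∂ν - ⨍ z in sball q k y, w z ∂ν‖ₑ ≤
      (D : ℝ≥0∞) ^ 4 * oscEnergy ν q p w (k - 1) x ^ (1 / p) := by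
  rw [oscEnergy, adm_eq_one hk, one_mul]
  -- Both balls lie in B_{k-1}(x). One factor D passes from this ball to B_k(x), and a second one
  -- from B_k(x) to B_k(y).
  have hD : (1 : ℝ≥0∞) ≤ (D : ℝ≥0∞) ^ 2 := one_le_pow₀ h.one_le_coe
  have h1 := h.measure_sub_one_le k x
  have := enorm_setAverage_sub_setAverage_le hp hD (ENNReal.pow_ne_top ENNReal.coe_ne_top)
    (sball_anti h.two_le (by omega) x) (sball_subset_of_dist h.two_le (by rwa [dist_comm]))
    (h.measure_ne_zero (k - 1) x) (h.measure_ne_top (k - 1) x) (S := sball q k x)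
    (T := sball q k y) (w := w) ?_ ?_ (hint _ _)
  · rwa [← pow_mul] at this
  · refine h1.trans ?_
    gcongr
    exact le_self_pow h.one_le_coe two_ne_zero
  · refine h1.trans ?_
    rw [pow_two, mul_assoc]
    gcongr
    exact h.measure_le_of_dist hxy

lemma enorm_average_sub_limit_le (h : ScaleRegular q D θ ν) (hp : 1 < p)
    (hint : ∀ x r, IntegrableOn w (Metric.ball x r) ν) {k : ℤ} (hk : Admissible X q k) {a : 𝕜}
    (ha : Tendsto (fun j : ℤ => ⨍ z in sball q j x, w z ∂ν) atTop (𝓝 a)) :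
    ‖⨍ z in sball q k x, w z ∂ν - a‖ₑ ≤ (D : ℝ≥0∞) ^ 2 * tailSum ν q p w k x := by
  have hT : Tendsto (fun i : ℕ => k + (i : ℤ)) atTop atTop :=
    tendsto_atTop_add_const_left _ _ tendsto_natCast_atTop_atTop
  have := edist_le_tsum_of_edist_le_of_tendsto₀
    (f := fun i : ℕ => ⨍ z in sball q (k + i) x, w z ∂ν)
    (fun i => (D : ℝ≥0∞) ^ 2 * oscEnergy ν q p w (k + i) x ^ (1 / p)) (fun i => by
      rw [edist_eq_enorm_sub]
      have := h.enorm_average_sub_succ_le hp hint (x := x)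
        (hk.mono h.two_le (show k ≤ k + i by omega))
      rw [add_assoc] at this
      simpa using this) (ha.comp hT)
  rw [ENNReal.tsum_mul_left, edist_eq_enorm_sub] at this
  simpa [tailSum] using this

lemma exists_tendsto_average (h : ScaleRegular q D θ ν) (hp : 1 < p)
    (hint : ∀ x r, IntegrableOn w (Metric.ball x r) ν) (hx : OscSummable ν q p w x) :
    ∃ a, Tendsto (fun j : ℤ => ⨍ z in sball q j x, w z ∂ν) atTop (𝓝 a) := by
  obtain ⟨J, hJ, hfin⟩ := hx
  have hc := cauchySeq_of_edist_le_of_tsum_ne_top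
    (f := fun i : ℕ => ⨍ z in sball q (J + i) x, w z ∂ν)
    (fun i => (D : ℝ≥0∞) ^ 2 * oscEnergy ν q p w (J + i) x ^ (1 / p)) (fun i => by
      rw [edist_eq_enorm_sub]
      have := h.enorm_average_sub_succ_le hp hint (x := x)
        (hJ.mono h.two_le (show (J : ℤ) ≤ J + i by omega))
      rw [add_assoc] at this
      simpa using this)
    (by
      rw [ENNReal.tsum_mul_left]
      exact ENNReal.mul_ne_top (ENNReal.pow_ne_top ENNReal.coe_ne_top) hfin)
  obtain ⟨a, ha⟩ := cauchySeq_tendsto_of_complete hc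
  refine ⟨a, ?_⟩
  have hT : Tendsto (fun j : ℤ => (j - J).toNat) atTop atTop := by
    refine tendsto_atTop.2 fun n => ?_
    filter_upwards [eventually_ge_atTop ((J : ℤ) + n)] with j hj
    omega
  refine (ha.comp hT).congr' ?_
  filter_upwards [eventually_ge_atTop (J : ℤ)] with j hj
  have : (J : ℤ) + ((j - J).toNat : ℤ) = j := by omega
  simp only [Function.comp, this]

/-- Where the oscillations are summable, the averages over all families of sets that are comparable
to small balls have the same limit. -/
lemma tendsto_setAverage (h : ScaleRegular q D θ ν) (hp : 1 < p)
    (hint : ∀ x r, IntegrableOn w (Metric.ball x r) ν) (hx : OscSummable ν q p w x) {a : 𝕜}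
    (ha : Tendsto (fun j : ℤ => ⨍ z in sball q j x, w z ∂ν) atTop (𝓝 a))
    {ι : Type*} {l : Filter ι} {S : ι → Set X} {K : ℝ≥0∞} (hK1 : 1 ≤ K) (hK : K ≠ ∞)
    (hS : ∀ k₀ : ℤ, ∀ᶠ i in l, ∃ k ≥ k₀, S i ⊆ sball q k x ∧ ν (sball q k x) ≤ K * ν (S i)) :
    Tendsto (fun i => ⨍ z in S i, w z ∂ν) l (𝓝 a) := by
  obtain ⟨J, hJ, hfin⟩ := hx
  have hosc : Tendsto (fun j : ℤ => K ^ 2 * oscEnergy ν q p w j x ^ (1 / p)) atTop (𝓝 0) := by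
    have h0 := ENNReal.tendsto_atTop_zero_of_tsum_ne_top hfin
    have hT : Tendsto (fun j : ℤ => (j - J).toNat) atTop atTop := by
      refine tendsto_atTop.2 fun n => ?_
      filter_upwards [eventually_ge_atTop ((J : ℤ) + n)] with j hj
      omega
    have h1 := ENNReal.Tendsto.const_mul (h0.comp hT) (a := K ^ 2)
      (Or.inr (ENNReal.pow_ne_top hK))
    rw [mul_zero] at h1
    refine h1.congr' ?_
    filter_upwards [eventually_ge_atTop (J : ℤ)] with j hj
    have : (J : ℤ) + ((j - J).toNat : ℤ) = j := by omega
    simp only [Function.comp, this]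
  rw [EMetric.tendsto_nhds]
  intro ε hε
  have hε2 : 0 < ε / 2 := ENNReal.half_pos hε.ne'
  obtain ⟨k₀, hk₀⟩ := eventually_atTop.1
    (((EMetric.tendsto_nhds.1 ha _ hε2).and (hosc.eventually (gt_mem_nhds hε2))).and
      (eventually_ge_atTop (J : ℤ)))
  filter_upwards [hS k₀] with i hi
  obtain ⟨k, hk, hsub, hm⟩ := hi
  obtain ⟨⟨h1, h2⟩, h3⟩ := hk₀ k hk
  have h4 : edist (⨍ z in S i, w z ∂ν) (⨍ z in sball q k x, w z ∂ν) ≤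
      K ^ 2 * oscEnergy ν q p w k x ^ (1 / p) := by
    rw [edist_eq_enorm_sub, oscEnergy, adm_eq_one (hJ.mono h.two_le h3), one_mul]
    exact enorm_setAverage_sub_setAverage_le hp hK1 hK hsub subset_rfl (h.measure_ne_zero _ _)
      (h.measure_ne_top _ _) hm (le_mul_of_one_le_left zero_le hK1) (hint _ _)
  calc edist (⨍ z in S i, w z ∂ν) a
      ≤ edist (⨍ z in S i, w z ∂ν) (⨍ z in sball q k x, w z ∂ν) +
        edist (⨍ z in sball q k x, w z ∂ν) a := edist_triangle _ _ _
    _ < ε / 2 + ε / 2 := ENNReal.add_lt_add (h4.trans_lt h2) h1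
    _ = ε := ENNReal.add_halves ε

/-- A discrete Hardy inequality. Write the decay factor of μ as θⁱ = σⁱσⁱ with σ = √θ: one half pays
for the weights σ⁻ⁱ of `exists_tsum_rpow_le`, and the other half makes the sum over i converge after
the scales are shifted. -/
lemma exists_tsum_tailSum_le (hμ : ScaleRegular q D θ μ) (hp : 1 < p) :
    ∃ C : ℝ≥0, ∀ (w : X → 𝕜) (x : X),
      ∑' k, adm X q k * ((μ (sball q k x))⁻¹ * tailSum ν q p w k x ^ p) ≤
        C * ∑' j, (μ (sball q j x))⁻¹ * oscEnergy ν q p w j x := by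
  have hp0 : 0 < p := by linarith
  set σ := NNReal.sqrt θ with hσ
  have hσ0 : 0 < σ := NNReal.sqrt_pos.2 hμ.theta_pos
  have hσ1 : σ < 1 := by
    rw [← NNReal.sqrt_one]; exact NNReal.sqrt_lt_sqrt.2 hμ.theta_lt
  have hσσ : (θ : ℝ≥0∞) = σ * σ := by rw [← ENNReal.coe_mul, hσ, NNReal.mul_self_sqrt]
  have hσe0 : (σ : ℝ≥0∞) ≠ 0 := by exact_mod_cast hσ0.ne'
  have hS : (1 - (σ : ℝ≥0∞))⁻¹ ≠ ∞ :=
    ENNReal.inv_ne_top.2 (tsub_pos_of_lt (by exact_mod_cast hσ1)).ne'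
  obtain ⟨C, hC⟩ := exists_tsum_rpow_le hp hσ0 hσ1
  refine ⟨C * D * ((1 - (σ : ℝ≥0∞))⁻¹).toNNReal, fun w x => ?_⟩
  rw [ENNReal.coe_mul, ENNReal.coe_mul, ENNReal.coe_toNNReal hS]
  set g : ℤ → ℝ≥0∞ := fun j => (μ (sball q j x))⁻¹ * oscEnergy ν q p w j x with hg
  have key : ∀ k, adm X q k * ((μ (sball q k x))⁻¹ * tailSum ν q p w k x ^ p) ≤
      ∑' i : ℕ, C * D * ((σ : ℝ≥0∞) ^ i * g (k + i)) := by
    intro k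
    by_cases hk : Admissible X q k
    · rw [adm_eq_one hk, one_mul, ENNReal.tsum_mul_left]
      calc (μ (sball q k x))⁻¹ * tailSum ν q p w k x ^ p
          ≤ (μ (sball q k x))⁻¹ * (C * ∑' i : ℕ, ((σ : ℝ≥0∞)⁻¹) ^ i *
              (oscEnergy ν q p w (k + i) x ^ (1 / p)) ^ p) := by gcongr; exact hC _
        _ = C * ∑' i : ℕ, (μ (sball q k x))⁻¹ * (((σ : ℝ≥0∞)⁻¹) ^ i *
              oscEnergy ν q p w (k + i) x) := by
            rw [mul_left_comm, ENNReal.tsum_mul_left]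
            congr 3 with i
            rw [← ENNReal.rpow_mul, one_div_mul_cancel hp0.ne', ENNReal.rpow_one]
        _ ≤ C * ∑' i : ℕ, D * ((σ : ℝ≥0∞) ^ i * g (k + i)) := by
            refine mul_le_mul_right (ENNReal.tsum_le_tsum fun i => ?_) _
            calc (μ (sball q k x))⁻¹ * (((σ : ℝ≥0∞)⁻¹) ^ i * oscEnergy ν q p w (k + i) x)
                ≤ (D * θ ^ i * (μ (sball q (k + i) x))⁻¹) *
                    (((σ : ℝ≥0∞)⁻¹) ^ i * oscEnergy ν q p w (k + i) x) := by
                  gcongr; exact hμ.inv_decay x k i hk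
              _ = (σ * (σ : ℝ≥0∞)⁻¹) ^ i * (D * ((σ : ℝ≥0∞) ^ i * g (k + i))) := by
                  rw [hσσ, hg]; ring
              _ = _ := by
                  rw [ENNReal.mul_inv_cancel hσe0 ENNReal.coe_ne_top, one_pow, one_mul]
        _ = _ := by rw [ENNReal.tsum_mul_left, mul_assoc]
    · rw [adm_eq_zero hk, zero_mul]; exact zero_le
  calc _ ≤ ∑' k, ∑' i : ℕ, C * D * ((σ : ℝ≥0∞) ^ i * g (k + i)) := ENNReal.tsum_le_tsum key
    _ = ∑' i : ℕ, C * D * ((σ : ℝ≥0∞) ^ i * ∑' j, g j) := by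
        rw [ENNReal.tsum_comm]
        congr with i
        rw [ENNReal.tsum_mul_left, ENNReal.tsum_mul_left]
        congr 2
        exact (Equiv.addRight (i : ℤ)).tsum_eq g
    _ = _ := by
        rw [ENNReal.tsum_mul_left, ENNReal.tsum_mul_right, ENNReal.tsum_geometric]
        ring

variable [BorelSpace X] [SecondCountableTopology X] [SFinite μ] [SFinite ν]

lemma exists_tsum_lintegral_tailSum_le (hμ : ScaleRegular q D θ μ) (hν : ScaleRegular q D θ ν)
    (hp : 1 < p) : ∃ C : ℝ≥0, ∀ w : X → 𝕜, Measurable w →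
      ∑' k, ∫⁻ x, adm X q k * ((μ (sball q k x))⁻¹ * tailSum ν q p w k x ^ p) ∂μ ≤
        C * energy ν p w := by
  obtain ⟨C, hC⟩ := hμ.exists_tsum_tailSum_le (ν := ν) (𝕜 := 𝕜) hp
  have hθ : (1 - (θ : ℝ≥0∞))⁻¹ ≠ ∞ :=
    ENNReal.inv_ne_top.2 (tsub_pos_of_lt (by exact_mod_cast hμ.theta_lt)).ne'
  refine ⟨C * (D ^ 7 * ((1 - (θ : ℝ≥0∞))⁻¹).toNNReal), fun w hw => ?_⟩
  rw [← lintegral_tsum]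
  swap
  · intro k
    exact (((measurable_measure_ball μ _).inv.mul
      ((measurable_tailSum ν q p hw k).pow_const p)).const_mul _).aemeasurable
  calc _ ≤ ∫⁻ x, C * ∑' j, (μ (sball q j x))⁻¹ * oscEnergy ν q p w j x ∂μ :=
        lintegral_mono fun x => hC w x
    _ = C * ∑' j, ∫⁻ x, (μ (sball q j x))⁻¹ * oscEnergy ν q p w j x ∂μ := by
        rw [lintegral_const_mul' _ _ ENNReal.coe_ne_top, lintegral_tsum]
        exact fun j => ((measurable_measure_ball μ _).inv.mul
          (measurable_oscEnergy ν q p hw j)).aemeasurable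
    _ ≤ C * ((D : ℝ≥0∞) ^ 7 * (1 - θ : ℝ≥0∞)⁻¹ * energy ν p w) := by
        gcongr
        exact hμ.tsum_lintegral_oscEnergy_le hν (by linarith) hw
    _ = _ := by
        rw [ENNReal.coe_mul, ENNReal.coe_mul, ENNReal.coe_pow, ENNReal.coe_toNNReal hθ]
        ring

lemma ae_oscSummable [Nontrivial X] (hμ : ScaleRegular q D θ μ) (hν : ScaleRegular q D θ ν)
    (hp : 1 < p) (hw : Measurable w) (hfin : energy ν p w ≠ ∞) :
    ∀ᵐ x ∂μ, OscSummable ν q p w x := by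
  have hp0 : 0 < p := by linarith
  obtain ⟨J, hJ⟩ := exists_admissible (X := X) hμ.two_le
  obtain ⟨C, hC⟩ := hμ.exists_tsum_lintegral_tailSum_le hν (𝕜 := 𝕜) hp
  have h1 : ∫⁻ x, adm X q J * ((μ (sball q J x))⁻¹ * tailSum ν q p w J x ^ p) ∂μ ≠ ∞ :=
    ((ENNReal.le_tsum (J : ℤ)).trans (hC w hw)).trans_lt
      (ENNReal.mul_lt_top ENNReal.coe_lt_top hfin.lt_top) |>.ne
  have hm : Measurable fun x => adm X q J * ((μ (sball q J x))⁻¹ * tailSum ν q p w J x ^ p) :=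
    ((measurable_measure_ball μ _).inv.mul
      ((measurable_tailSum ν q p hw J).pow_const p)).const_mul _
  filter_upwards [ae_lt_top hm h1] with x hx
  refine ⟨J, hJ, fun htop => ?_⟩
  rw [htop, adm_eq_one hJ, one_mul, ENNReal.top_rpow_of_pos hp0,
    ENNReal.mul_top (ENNReal.inv_ne_zero.2 (hμ.measure_ne_top _ _))] at hx
  exact lt_irrefl _ hx

/-- The averages of `w` converge to `w` almost everywhere. -/
lemma ae_tendsto_average [Nontrivial X] (hν : ScaleRegular q D θ ν) (hp : 1 < p)
    (hw : Measurable w) (hint : ∀ x r, IntegrableOn w (Metric.ball x r) ν)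
    (hfin : energy ν p w ≠ ∞) :
    ∀ᵐ x ∂ν, Tendsto (fun j : ℤ => ⨍ z in sball q j x, w z ∂ν) atTop (𝓝 (w x)) := by
  have hp0 : 0 < p := by linarith
  obtain ⟨J, hJ⟩ := exists_admissible (X := X) hν.two_le
  have hθ : (1 - (θ : ℝ≥0∞))⁻¹ ≠ ∞ :=
    ENNReal.inv_ne_top.2 (tsub_pos_of_lt (by exact_mod_cast hν.theta_lt)).ne'
  have h1 := hν.tsum_lintegral_diffEnergy_le hp0 hw
  rw [← lintegral_tsum fun j => (measurable_diffEnergy ν q p hw j).aemeasurable] at h1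
  have h2 : ∫⁻ z, ∑' j, diffEnergy ν q p w j z ∂ν ≠ ∞ :=
    (h1.trans_lt (ENNReal.mul_lt_top (ENNReal.mul_lt_top
      (ENNReal.pow_lt_top ENNReal.coe_lt_top) hθ.lt_top) hfin.lt_top)).ne
  filter_upwards [ae_lt_top
    (Measurable.tsum fun j => measurable_diffEnergy ν q p hw j) h2] with x hx
  have h3 : Tendsto (fun j : ℤ => diffEnergy ν q p w j x) atTop (𝓝 0) :=
    (ENNReal.tendsto_cofinite_zero_of_tsum_ne_top hx.ne).mono_left
      (by rw [Int.cofinite_eq]; exact le_sup_right)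
  have hT : Tendsto (fun j : ℤ => j + 1) atTop atTop := tendsto_atTop_add_const_right _ _ tendsto_id
  -- This majorises |average over B_j - w(x)|: by Jensen the p-th power is at most ν(B_j)⁻¹ ∫ |w -
  -- w(x)|^p over B_j, and ν(B_j)⁻¹ ≤ ν(B_J) ν(B_{j+1})⁻². The index j + 1 is the one whose
  -- difference energy integrates over B_j.
  have h4 : Tendsto (fun j : ℤ => (ν (sball q J x) * diffEnergy ν q p w (j + 1) x) ^ (1 / p))
      atTop (𝓝 0) := by
    have := (ENNReal.Tendsto.const_mul (h3.comp hT) (a := ν (sball q J x))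
      (Or.inr (hν.measure_ne_top _ _))).ennrpow_const (1 / p)
    rw [mul_zero, ENNReal.zero_rpow_of_pos (by positivity)] at this
    exact this
  rw [tendsto_iff_edist_tendsto_0]
  refine tendsto_of_tendsto_of_tendsto_of_le_of_le' tendsto_const_nhds h4
    (Eventually.of_forall fun _ => zero_le) ?_
  filter_upwards [eventually_ge_atTop (J : ℤ)] with j hj
  rw [edist_eq_enorm_sub, one_div, ENNReal.le_rpow_inv_iff hp0]
  refine (enorm_setAverage_sub_const_rpow_le hp (hν.measure_ne_zero _ _) (hν.measure_ne_top _ _)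
    (hint _ _) _).trans ?_
  rw [diffEnergy, adm_eq_one (hJ.mono hν.two_le (by omega)), one_mul, add_sub_cancel_right]
  have e : ∀ t, ‖w x - w t‖ₑ = ‖w t - w x‖ₑ := fun t => by rw [← enorm_neg, neg_sub]
  simp only [e]
  rw [← mul_assoc]
  gcongr
  have hn0 := hν.measure_ne_zero (j + 1) x
  have hnt := hν.measure_ne_top (j + 1) x
  calc (ν (sball q j x))⁻¹ ≤ (ν (sball q (j + 1) x))⁻¹ :=
        ENNReal.inv_le_inv' (measure_mono (sball_anti hν.two_le (by omega) x))
    _ = ν (sball q (j + 1) x) * (ν (sball q (j + 1) x))⁻¹ ^ 2 := by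
        rw [pow_two, ← mul_assoc, ENNReal.mul_inv_cancel hn0 hnt, one_mul]
    _ ≤ _ := by
        gcongr
        exact sball_anti hν.two_le (by omega) x

end ScaleRegular

end Tails

/-! ### Finite energy implies local integrability. -/

section Integrability

variable {𝕜 X : Type*} [RCLike 𝕜] [MetricSpace X] [MeasurableSpace X] [BorelSpace X]
  {ν : Measure X} {p : ℝ} {w : X → 𝕜}

/-- A measurable function of finite energy is `p`-integrable on balls. -/
lemma memLp_ball_of_energy_ne_top (pos : ∀ (x : X) (r : ℝ), 0 < r → 0 < ν (Metric.ball x r))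
    (fin : ∀ (x : X) (r : ℝ), 0 < r → ν (Metric.ball x r) < ∞)
    (hp : 1 < p) (hw : Measurable w) (hfin : energy ν p w ≠ ∞) (x : X) (r : ℝ) :
    MemLp w (ENNReal.ofReal p) (ν.restrict (Metric.ball x r)) := by
  have hp0 : 0 < p := by linarith
  have hν : ν univ ≠ 0 := ((pos x 1 one_pos).trans_le (measure_mono (subset_univ _))).ne'
  -- Finite energy and positive total measure leave some z at which the inner integral is finite.
  obtain ⟨z, hz⟩ : ∃ z,
      ∫⁻ t, (ν (Metric.ball z (dist z t)))⁻¹ ^ 2 * ‖w z - w t‖ₑ ^ p ∂ν ≠ ∞ := by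
    by_contra! h
    refine hfin ?_
    rw [energy]
    simp only [h, lintegral_const]
    exact ENNReal.top_mul hν
  -- This ball contains B(z,d(z,t)) for every t in B(x,r), so the kernel is at least m⁻² there. The
  -- absolute value and the 1 keep the radius positive for every real r.
  set m := ν (Metric.ball z (|r| + dist x z + 1)) with hm
  have hmt : m ≠ ∞ := (fin z _ (by positivity)).ne
  have hm0 : m ≠ 0 := (pos z _ (by positivity)).ne'
  have hmi : m⁻¹ ^ 2 ≠ ∞ := ENNReal.pow_ne_top (ENNReal.inv_ne_top.2 hm0)
  have h1 : m⁻¹ ^ 2 * ∫⁻ t in Metric.ball x r, ‖w z - w t‖ₑ ^ p ∂ν < ∞ := by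
    refine lt_of_le_of_lt ?_ hz.lt_top
    rw [← lintegral_const_mul' _ _ hmi]
    refine (setLIntegral_mono' measurableSet_ball fun t ht => ?_).trans
      (setLIntegral_le_lintegral (Metric.ball x r) _)
    gcongr
    refine measure_mono (Metric.ball_subset_ball ?_)
    have h2 := dist_triangle_left z t x
    have h3 := Metric.mem_ball.1 ht
    rw [dist_comm t x] at h3
    linarith [le_abs_self r]
  have h2 : ∫⁻ t in Metric.ball x r, ‖w z - w t‖ₑ ^ p ∂ν < ∞ :=
    ENNReal.lt_top_of_mul_ne_top_right h1.ne
      (pow_ne_zero _ (ENNReal.inv_ne_zero.2 hmt))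
  have : IsFiniteMeasure (ν.restrict (Metric.ball x r)) := by
    refine ⟨?_⟩
    rw [Measure.restrict_apply_univ]
    refine (measure_mono (Metric.ball_subset_ball ?_)).trans_lt (fin x (|r| + 1) (by positivity))
    linarith [le_abs_self r]
  have h3 : MemLp (fun t => w z - w t) (ENNReal.ofReal p) (ν.restrict (Metric.ball x r)) := by
    refine ⟨(measurable_const.sub hw).aestronglyMeasurable, ?_⟩
    rw [eLpNorm_lt_top_iff_lintegral_rpow_enorm_lt_top (by simpa using hp0) ENNReal.ofReal_ne_top,
      ENNReal.toReal_ofReal hp0.le]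
    exact h2
  have h4 : w = fun t => w z - (w z - w t) := by ext t; ring
  rw [h4]
  exact (memLp_const (w z)).sub h3

lemma integrableOn_ball_of_energy_ne_top
    (pos : ∀ (x : X) (r : ℝ), 0 < r → 0 < ν (Metric.ball x r))
    (fin : ∀ (x : X) (r : ℝ), 0 < r → ν (Metric.ball x r) < ∞)
    (hp : 1 < p) (hw : Measurable w) (hfin : energy ν p w ≠ ∞) (x : X) (r : ℝ) :
    IntegrableOn w (Metric.ball x r) ν := by
  have : IsFiniteMeasure (ν.restrict (Metric.ball x r)) := by
    refine ⟨?_⟩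
    rw [Measure.restrict_apply_univ]
    refine (measure_mono (Metric.ball_subset_ball ?_)).trans_lt (fin x (|r| + 1) (by positivity))
    linarith [le_abs_self r]
  exact (memLp_ball_of_energy_ne_top pos fin hp hw hfin x r).integrable
    (by rw [← ENNReal.ofReal_one]; exact ENNReal.ofReal_le_ofReal hp.le)

end Integrability

/-! ### The limit of the averages for one measure, measured by another. -/

section Limits

variable {𝕜 X : Type*} [RCLike 𝕜] [MetricSpace X] [MeasurableSpace X]
  {q p : ℝ} {D θ : ℝ≥0} {μ ν : Measure X} {w v : X → 𝕜} {x y : X}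

lemma limit_const_ne_top (D : ℝ≥0) (hp : 1 < p) : (2 * (D : ℝ≥0∞) ^ 4) ^ p ≠ ∞ :=
  ENNReal.rpow_ne_top_of_nonneg (by linarith)
    (ENNReal.mul_ne_top ENNReal.ofNat_ne_top (ENNReal.pow_ne_top ENNReal.coe_ne_top))

lemma exists_coe_eq_limit_const (D : ℝ≥0) (hp : 1 < p) :
    ∃ M : ℝ≥0, (M : ℝ≥0∞) = (D : ℝ≥0∞) ^ 4 * (2 ^ (p - 1) * (2 * (D : ℝ≥0∞) ^ 4) ^ p) := by
  have h : (D : ℝ≥0∞) ^ 4 * (2 ^ (p - 1) * (2 * (D : ℝ≥0∞) ^ 4) ^ p) ≠ ∞ :=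
    ENNReal.mul_ne_top (ENNReal.pow_ne_top ENNReal.coe_ne_top) (ENNReal.mul_ne_top
      (ENNReal.rpow_ne_top_of_nonneg (by linarith) ENNReal.ofNat_ne_top)
      (limit_const_ne_top D hp))
  exact ⟨_, ENNReal.coe_toNNReal h⟩

namespace ScaleRegular

/-- First compare the averages over B_k(x) and B_k(y), then telescope at y. The bound is a tail at y
alone, the point where the limit is taken, so that it can be integrated in y with x fixed. -/
lemma enorm_limit_sub_average_le (h : ScaleRegular q D θ ν) (hp : 1 < p)
    (hint : ∀ x r, IntegrableOn w (Metric.ball x r) ν) {k : ℤ} (hk : Admissible X q (k - 1))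
    (hxy : dist x y < scale q k) {b : 𝕜}
    (hb : Tendsto (fun j : ℤ => ⨍ z in sball q j y, w z ∂ν) atTop (𝓝 b)) :
    ‖b - ⨍ z in sball q k x, w z ∂ν‖ₑ ≤ 2 * (D : ℝ≥0∞) ^ 4 * tailSum ν q p w (k - 1) y := by
  have h1 := h.enorm_average_sub_limit_le hp hint (hk.mono h.two_le (by omega : k - 1 ≤ k)) hb
  have h2 := h.enorm_average_sub_average_le hp hint hk (x := y) (y := x) (by rwa [dist_comm])
  have h3 : b - ⨍ z in sball q k x, w z ∂ν =
      ((⨍ z in sball q k y, w z ∂ν) - ⨍ z in sball q k x, w z ∂ν) -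
        ((⨍ z in sball q k y, w z ∂ν) - b) := by ring
  rw [h3]
  refine enorm_sub_le.trans ((add_le_add h2 h1).trans ?_)
  calc _ ≤ (D : ℝ≥0∞) ^ 4 * tailSum ν q p w (k - 1) y +
        (D : ℝ≥0∞) ^ 4 * tailSum ν q p w (k - 1) y := by
        gcongr
        · exact oscEnergy_rpow_le_tailSum _
        · exact h.one_le_coe
        · omega
        · exact tailSum_anti (by omega)
    _ = _ := by ring

lemma enorm_limit_sub_limit_rpow_le (h : ScaleRegular q D θ ν) (hp : 1 < p)
    (hint : ∀ x r, IntegrableOn w (Metric.ball x r) ν) {k : ℤ} (hk : Admissible X q (k - 1))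
    (hxy : dist x y < scale q k) {a b : 𝕜}
    (ha : Tendsto (fun j : ℤ => ⨍ z in sball q j x, w z ∂ν) atTop (𝓝 a))
    (hb : Tendsto (fun j : ℤ => ⨍ z in sball q j y, w z ∂ν) atTop (𝓝 b)) :
    ‖a - b‖ₑ ^ p ≤ 2 ^ (p - 1) * (2 * (D : ℝ≥0∞) ^ 4) ^ p *
      (tailSum ν q p w (k - 1) x ^ p + tailSum ν q p w (k - 1) y ^ p) := by
  have hp0 : 0 < p := by linarith
  have h1 := h.enorm_limit_sub_average_le hp hint hk (x := x) (y := x)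
    (by rw [dist_self]; exact scale_pos h.two_le k) ha
  have h2 := h.enorm_limit_sub_average_le hp hint hk hxy hb
  refine (enorm_sub_rpow_le hp a b (⨍ z in sball q k x, w z ∂ν)).trans ?_
  calc _ ≤ 2 ^ (p - 1) * ((2 * (D : ℝ≥0∞) ^ 4 * tailSum ν q p w (k - 1) x) ^ p +
        (2 * (D : ℝ≥0∞) ^ 4 * tailSum ν q p w (k - 1) y) ^ p) := by gcongr
    _ = _ := by
      rw [ENNReal.mul_rpow_of_nonneg (2 * (D : ℝ≥0∞) ^ 4) _ hp0.le,
        ENNReal.mul_rpow_of_nonneg (2 * (D : ℝ≥0∞) ^ 4) _ hp0.le, ← mul_add, mul_assoc]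

/-- A pair with scale(k+1) ≤ d(x,y) < scale(k) is charged to the single term k - 1 of the sum; both
limits are compared with the average over B_k(x). -/
lemma mul_enorm_limit_sub_limit_rpow_le (hμ : ScaleRegular q D θ μ) (hν : ScaleRegular q D θ ν)
    (hp : 1 < p) (hint : ∀ x r, IntegrableOn w (Metric.ball x r) ν)
    (hx : Tendsto (fun j : ℤ => ⨍ z in sball q j x, w z ∂ν) atTop (𝓝 (v x)))
    (hy : Tendsto (fun j : ℤ => ⨍ z in sball q j y, w z ∂ν) atTop (𝓝 (v y))) :
    (μ (Metric.ball x (dist x y)))⁻¹ ^ 2 * ‖v x - v y‖ₑ ^ p ≤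
      (D : ℝ≥0∞) ^ 4 * (2 ^ (p - 1) * (2 * (D : ℝ≥0∞) ^ 4) ^ p) *
        ∑' k, (sball q k x).indicator (fun y => (μ (sball q k x))⁻¹ ^ 2 *
          (adm X q k * tailSum ν q p w k x ^ p + adm X q k * tailSum ν q p w k y ^ p)) y := by
  have hp0 : 0 < p := by linarith
  rcases eq_or_ne x y with rfl | hxy
  · simp [hp0]
  obtain ⟨k, hk1, hk2⟩ := exists_scale hμ.two_le (dist_pos.2 hxy)
  -- Here scale(k-1) = q² scale(k+1) ≤ q² d(x,y), which is what the factor q² in `Admissible` is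
  -- made for.
  have hadm : Admissible X q (k - 1) := by
    refine ⟨x, y, ?_⟩
    have e : scale q (k - 1) = q ^ 2 * scale q (k + 1) := by
      have e1 := scale_sub_one hμ.two_le k
      have e2 := scale_sub_one hμ.two_le (k + 1)
      rw [add_sub_cancel_right] at e2
      rw [e1, e2]
      ring
    rw [e]
    gcongr
  have h1 := hν.enorm_limit_sub_limit_rpow_le hp hint hadm hk2 hx hy
  have h2 : (μ (Metric.ball x (dist x y)))⁻¹ ≤ (D : ℝ≥0∞) ^ 2 * (μ (sball q (k - 1) x))⁻¹ := by
    have h3 := hμ.inv_le_sub_one (k + 1) x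
    rw [add_sub_cancel_right] at h3
    calc (μ (Metric.ball x (dist x y)))⁻¹ ≤ (μ (sball q (k + 1) x))⁻¹ :=
          ENNReal.inv_le_inv' (measure_mono (Metric.ball_subset_ball hk1))
      _ ≤ D * (μ (sball q k x))⁻¹ := h3
      _ ≤ D * (D * (μ (sball q (k - 1) x))⁻¹) := by gcongr; exact hμ.inv_le_sub_one _ _
      _ = _ := by ring
  have hmem : y ∈ sball q (k - 1) x := by
    rw [Metric.mem_ball, dist_comm]
    exact hk2.trans_le (scale_anti hμ.two_le (by omega))
  refine le_trans ?_ (mul_le_mul_right (ENNReal.le_tsum (k - 1)) _)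
  rw [indicator_of_mem hmem, adm_eq_one hadm, one_mul, one_mul]
  refine (mul_le_mul' (pow_le_pow_left' h2 2) h1).trans_eq ?_
  ring

variable [BorelSpace X] [SecondCountableTopology X] [SFinite μ] [SFinite ν]

/-- For h x the inner integration cancels one factor μ(B_k(x))⁻¹. For h y doubling moves one such
factor to the centre y, and Fubini over balls cancels the other. -/
lemma lintegral_setLIntegral_tailSum_le (hμ : ScaleRegular q D θ μ) {h : X → ℝ≥0∞}
    (hh : Measurable h) (k : ℤ) :
    ∫⁻ x, ∫⁻ y in sball q k x, (μ (sball q k x))⁻¹ ^ 2 * (h x + h y) ∂μ ∂μ ≤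
      (1 + (D : ℝ≥0∞) ^ 2) * ∫⁻ x, (μ (sball q k x))⁻¹ * h x ∂μ := by
  have hmu : Measurable fun x => (μ (sball q k x))⁻¹ := (measurable_measure_ball μ _).inv
  have hpt : ∀ x, ∫⁻ y in sball q k x, (μ (sball q k x))⁻¹ ^ 2 * (h x + h y) ∂μ ≤
      (μ (sball q k x))⁻¹ * h x +
        D * ((μ (sball q k x))⁻¹ * ∫⁻ y in sball q k x, (μ (sball q k y))⁻¹ * h y ∂μ) := by
    intro x
    have ha : Measurable fun y => h x + h y := measurable_const.add hh
    rw [lintegral_const_mul _ ha, lintegral_add_left measurable_const,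
      setLIntegral_const, mul_add]
    refine add_le_add ?_ ?_
    · apply le_of_eq
      rw [pow_two, mul_comm (h x), mul_assoc, ← mul_assoc (μ (sball q k x))⁻¹ (μ _),
        ENNReal.inv_mul_cancel (hμ.measure_ne_zero k x) (hμ.measure_ne_top k x), one_mul]
    · rw [pow_two, mul_assoc, mul_left_comm (D : ℝ≥0∞)]
      refine mul_le_mul_right ?_ _
      have hm : Measurable fun y => (μ (sball q k y))⁻¹ * h y := hmu.mul hh
      rw [← lintegral_const_mul _ hh, ← lintegral_const_mul _ hm]
      refine setLIntegral_mono ((hmu.mul hh).const_mul _) fun y hy => ?_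
      rw [← mul_assoc]
      gcongr
      exact hμ.inv_le_of_dist (by rwa [dist_comm])
  refine (lintegral_mono hpt).trans ?_
  have hm : Measurable fun x => (μ (sball q k x))⁻¹ * h x := hmu.mul hh
  rw [lintegral_add_left hm, lintegral_const_mul' _ _ ENNReal.coe_ne_top, add_mul, one_mul]
  refine add_le_add le_rfl ?_
  rw [pow_two, mul_assoc]
  refine mul_le_mul_right ?_ _
  exact hμ.lintegral_inv_mul_setLIntegral_le μ (hmu.mul hh) k

/-- The energy, with respect to one measure, of the limit of the averages with respect to another
measure. -/
lemma exists_energy_limit_le (hμ : ScaleRegular q D θ μ) (hν : ScaleRegular q D θ ν)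
    (hp : 1 < p) : ∃ C : ℝ≥0, ∀ w v : X → 𝕜, Measurable w →
      (∀ x r, IntegrableOn w (Metric.ball x r) ν) →
      (∀ᵐ x ∂μ, Tendsto (fun j : ℤ => ⨍ z in sball q j x, w z ∂ν) atTop (𝓝 (v x))) →
      energy μ p v ≤ C * energy ν p w := by
  have hp0 : 0 < p := by linarith
  obtain ⟨C, hC⟩ := hμ.exists_tsum_lintegral_tailSum_le hν (𝕜 := 𝕜) hp
  obtain ⟨M, hM⟩ := exists_coe_eq_limit_const D hp
  refine ⟨M * ((1 + D ^ 2) * C), fun w v hw hint hv => ?_⟩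
  obtain ⟨h, hh⟩ : ∃ h : ℤ → X → ℝ≥0∞, h = fun k x => adm X q k * tailSum ν q p w k x ^ p :=
    ⟨_, rfl⟩
  have hhm : ∀ k, Measurable (h k) := fun k => hh ▸
    ((measurable_tailSum ν q p hw k).pow_const p).const_mul _
  have hmu : ∀ k, Measurable fun x => (μ (sball q k x))⁻¹ := fun k =>
    (measurable_measure_ball μ _).inv
  obtain ⟨F, hF⟩ : ∃ F : ℤ → X → X → ℝ≥0∞,
      F = fun k x y => (μ (sball q k x))⁻¹ ^ 2 * (h k x + h k y) := ⟨_, rfl⟩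
  have hFm : ∀ k, Measurable (Function.uncurry (F k)) := fun k => hF ▸
    (((hmu k).comp measurable_fst).pow_const 2).mul
      (((hhm k).comp measurable_fst).add ((hhm k).comp measurable_snd))
  have hpt : ∀ᵐ x ∂μ, ∀ᵐ y ∂μ, (μ (Metric.ball x (dist x y)))⁻¹ ^ 2 * ‖v x - v y‖ₑ ^ p ≤
      M * ∑' k, (sball q k x).indicator (F k x) y := by
    filter_upwards [hv] with x hx
    filter_upwards [hv] with y hy
    rw [hM, hF, hh]
    exact hμ.mul_enorm_limit_sub_limit_rpow_le hν hp hint hx hy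
  have hFx : ∀ k x, Measurable (F k x) := fun k x => (hFm k).comp measurable_prodMk_left
  calc energy μ p v
      ≤ ∫⁻ x, ∫⁻ y, M * ∑' k, (sball q k x).indicator (F k x) y ∂μ ∂μ := by
        refine lintegral_mono_ae ?_
        filter_upwards [hpt] with x hx using lintegral_mono_ae hx
    _ = M * ∑' k, ∫⁻ x, ∫⁻ y in sball q k x, F k x y ∂μ ∂μ := by
        simp only [lintegral_const_mul' _ _ ENNReal.coe_ne_top]
        congr 1
        have hm : ∀ k, Measurable fun x => ∫⁻ y in sball q k x, F k x y ∂μ := fun k =>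
          measurable_setLIntegral_ball μ measurable_id (hFm k) _
        rw [← lintegral_tsum fun k => (hm k).aemeasurable]
        congr with x
        rw [lintegral_tsum fun k => ((hFx k x).indicator measurableSet_ball).aemeasurable]
        congr with k
        exact lintegral_indicator measurableSet_ball _
    _ ≤ M * ∑' k, (1 + (D : ℝ≥0∞) ^ 2) * ∫⁻ x, (μ (sball q k x))⁻¹ * h k x ∂μ :=
        mul_le_mul_right (ENNReal.tsum_le_tsum fun k =>
          hF ▸ hμ.lintegral_setLIntegral_tailSum_le (hhm k) k) _
    _ ≤ M * ((1 + (D : ℝ≥0∞) ^ 2) * (C * energy ν p w)) := by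
        rw [ENNReal.tsum_mul_left]
        refine mul_le_mul_right (mul_le_mul_right (le_trans (le_of_eq ?_) (hC w hw)) _) _
        congr with k
        congr with x
        rw [hh]
        ring
    _ = _ := by
        push_cast
        ring

/-- The averages of the limit `v` of the averages of `w` are asymptotic to the averages of `w`. -/
lemma ae_tendsto_average_limit [Nontrivial X] (hμ : ScaleRegular q D θ μ)
    (hν : ScaleRegular q D θ ν) (hp : 1 < p) (hw : Measurable w)
    (hint : ∀ x r, IntegrableOn w (Metric.ball x r) ν) (hfin : energy ν p w ≠ ∞)
    (hintv : ∀ x r, IntegrableOn v (Metric.ball x r) μ)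
    (hv : ∀ᵐ x ∂μ, Tendsto (fun j : ℤ => ⨍ z in sball q j x, w z ∂ν) atTop (𝓝 (v x))) :
    ∀ᵐ x ∂ν, Tendsto (fun j : ℤ => edist (⨍ z in sball q j x, v z ∂μ)
      (⨍ z in sball q j x, w z ∂ν)) atTop (𝓝 0) := by
  have hp0 : 0 < p := by linarith
  obtain ⟨J, hJ⟩ := exists_admissible (X := X) hν.two_le
  obtain ⟨C, hC⟩ := hμ.exists_tsum_lintegral_tailSum_le hν (𝕜 := 𝕜) hp
  set h : ℤ → X → ℝ≥0∞ := fun k x =>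
    adm X q k * ((μ (sball q k x))⁻¹ * tailSum ν q p w k x ^ p) with hh
  have hmu : ∀ k, Measurable fun x => (μ (sball q k x))⁻¹ := fun k =>
    (measurable_measure_ball μ _).inv
  have hmν : ∀ k, Measurable fun x => (ν (sball q k x))⁻¹ := fun k =>
    (measurable_measure_ball ν _).inv
  have hhm : ∀ k, Measurable (h k) := fun k =>
    ((hmu k).mul ((measurable_tailSum ν q p hw k).pow_const p)).const_mul _
  -- Fubini over balls is now used with ν outside and μ inside: the sum of the G_k is ν-integrable,
  -- so G_k tends to 0 at ν-almost every point.
  set G : ℤ → X → ℝ≥0∞ := fun k x => (ν (sball q k x))⁻¹ * ∫⁻ z in sball q k x, h k z ∂μ with hG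
  have hGm : ∀ k, Measurable (G k) := fun k => (hmν k).mul
    (measurable_setLIntegral_ball μ measurable_id (G := fun _ z => h k z)
      ((hhm k).comp measurable_snd) _)
  have h1 : ∫⁻ x, ∑' k, G k x ∂ν ≠ ∞ := by
    rw [lintegral_tsum fun k => (hGm k).aemeasurable]
    refine ((ENNReal.tsum_le_tsum fun k =>
      hν.lintegral_inv_mul_setLIntegral_le μ (hhm k) k).trans_lt ?_).ne
    rw [ENNReal.tsum_mul_left]
    exact ENNReal.mul_lt_top ENNReal.coe_lt_top ((hC w hw).trans_lt
      (ENNReal.mul_lt_top ENNReal.coe_lt_top hfin.lt_top))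
  filter_upwards [ae_lt_top (Measurable.tsum hGm) h1] with x hx
  have h3 : Tendsto (fun k : ℤ => G k x) atTop (𝓝 0) :=
    (ENNReal.tendsto_cofinite_zero_of_tsum_ne_top hx.ne).mono_left
      (by rw [Int.cofinite_eq]; exact le_sup_right)
  have hT : Tendsto (fun j : ℤ => j - 1) atTop atTop := tendsto_atTop_add_const_right _ (-1)
    tendsto_id
  set M : ℝ≥0∞ := D ^ 2 * (2 * (D : ℝ≥0∞) ^ 4) ^ p * ν (sball q J x) with hM
  have hMt : M ≠ ∞ := by
    refine ENNReal.mul_ne_top (ENNReal.mul_ne_top (ENNReal.pow_ne_top ENNReal.coe_ne_top)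
      (ENNReal.rpow_ne_top_of_nonneg hp0.le ?_)) (hν.measure_ne_top _ _)
    exact ENNReal.mul_ne_top ENNReal.ofNat_ne_top (ENNReal.pow_ne_top ENNReal.coe_ne_top)
  have h4 : Tendsto (fun j : ℤ => (M * G (j - 1) x) ^ (1 / p)) atTop (𝓝 0) := by
    have := (ENNReal.Tendsto.const_mul (h3.comp hT) (a := M) (Or.inr hMt)).ennrpow_const (1 / p)
    rw [mul_zero, ENNReal.zero_rpow_of_pos (by positivity)] at this
    exact this
  refine tendsto_of_tendsto_of_tendsto_of_le_of_le' tendsto_const_nhds h4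
    (Eventually.of_forall fun _ => zero_le) ?_
  filter_upwards [eventually_ge_atTop ((J : ℤ) + 1)] with k hk
  have hadm : Admissible X q (k - 1) := hJ.mono hν.two_le (by omega)
  rw [edist_eq_enorm_sub, one_div, ENNReal.le_rpow_inv_iff hp0]
  refine (enorm_setAverage_sub_const_rpow_le hp (hμ.measure_ne_zero _ _) (hμ.measure_ne_top _ _)
    (hintv _ _) _).trans ?_
  have hm1 : Measurable fun z => (D : ℝ≥0∞) * (2 * (D : ℝ≥0∞) ^ 4) ^ p * h (k - 1) z :=
    (hhm _).const_mul _
  -- The normalisation is moved from B_k(x) to B_{k-1}(z), which is where the tail at z is weighted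
  -- in `h (k - 1)`.
  have key : ∀ᵐ z ∂μ, z ∈ sball q k x →
      (μ (sball q k x))⁻¹ * ‖v z - ⨍ y in sball q k x, w y ∂ν‖ₑ ^ p ≤
        D ^ 2 * (2 * (D : ℝ≥0∞) ^ 4) ^ p * h (k - 1) z := by
    filter_upwards [hv] with z hz hzx
    rw [Metric.mem_ball'] at hzx
    have h5 := hν.enorm_limit_sub_average_le hp hint hadm hzx hz
    have h6 : (μ (sball q k x))⁻¹ ≤ D * (D * (μ (sball q (k - 1) z))⁻¹) :=
      (hμ.inv_le_of_dist hzx).trans (by gcongr; exact hμ.inv_le_sub_one _ _)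
    calc _ ≤ D * (D * (μ (sball q (k - 1) z))⁻¹) *
          (2 * (D : ℝ≥0∞) ^ 4 * tailSum ν q p w (k - 1) z) ^ p := by gcongr
      _ = _ := by
        rw [hh, ENNReal.mul_rpow_of_nonneg _ _ hp0.le]
        simp only [adm_eq_one hadm]
        ring
  have hmi : (μ (sball q k x))⁻¹ ≠ ∞ := ENNReal.inv_ne_top.2 (hμ.measure_ne_zero _ _)
  have hDt : (D : ℝ≥0∞) ^ 2 * (2 * (D : ℝ≥0∞) ^ 4) ^ p ≠ ∞ := by
    refine ENNReal.mul_ne_top (ENNReal.pow_ne_top ENNReal.coe_ne_top)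
      (ENNReal.rpow_ne_top_of_nonneg hp0.le ?_)
    exact ENNReal.mul_ne_top ENNReal.ofNat_ne_top (ENNReal.pow_ne_top ENNReal.coe_ne_top)
  rw [← lintegral_const_mul' _ _ hmi]
  calc _ ≤ ∫⁻ z in sball q k x, D ^ 2 * (2 * (D : ℝ≥0∞) ^ 4) ^ p * h (k - 1) z ∂μ :=
        setLIntegral_mono_ae' measurableSet_ball key
    _ ≤ D ^ 2 * (2 * (D : ℝ≥0∞) ^ 4) ^ p * ∫⁻ z in sball q (k - 1) x, h (k - 1) z ∂μ := by
        rw [lintegral_const_mul' _ _ hDt]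
        gcongr
        exact sball_anti hμ.two_le (by omega) x
    _ = D ^ 2 * (2 * (D : ℝ≥0∞) ^ 4) ^ p * (ν (sball q (k - 1) x) * G (k - 1) x) := by
        rw [hG]
        simp only
        rw [← mul_assoc (ν _), ENNReal.mul_inv_cancel (hν.measure_ne_zero _ _)
          (hν.measure_ne_top _ _), one_mul]
    _ ≤ D ^ 2 * (2 * (D : ℝ≥0∞) ^ 4) ^ p * (ν (sball q J x) * G (k - 1) x) := by
        gcongr
        exact sball_anti hμ.two_le (by omega) x
    _ = _ := by rw [hM]; ring

end ScaleRegular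

end Limits

/-! ### Hausdorff dimension of the exceptional set. -/

section Dimension

lemma disjoint_sball_of_separated {X : Type*} [MetricSpace X] {q : ℝ} (hq : 2 ≤ q) {j : ℤ} {a b : X} (h : scale q j ≤ dist a b) :
    Disjoint (sball q (j + 1) a) (sball q (j + 1) b) := by
  refine disjoint_ball_of_le_dist (le_trans ?_ h)
  simpa using two_mul_scale_le hq (j + 1)

/-- If the oscillation energies were at most scale(j)^d from some index on, their p-th roots would
be dominated by a geometric series of ratio q^(-d/p), and the oscillations would be summable. -/
lemma ScaleRegular.exists_large_oscEnergy {𝕜 X : Type*} [RCLike 𝕜] [MetricSpace X] [MeasurableSpace X]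
    {q p : ℝ} {D θ : ℝ≥0} {ν : Measure X} {w : X → 𝕜} (h : ScaleRegular q D θ ν) [Nontrivial X] (hp : 0 < p) {x : X}
    (hx : ¬ OscSummable ν q p w x) {d : ℝ} (hd : 0 < d) (n : ℕ) :
    ∃ j : ℕ, n ≤ j ∧ ENNReal.ofReal (scale q j) ^ d < oscEnergy ν q p w j x := by
  by_contra! hc
  obtain ⟨J, hJ⟩ := exists_admissible (X := X) h.two_le
  refine hx ⟨max J n, hJ.mono h.two_le (by simp), ?_⟩
  set ρ := ENNReal.ofReal q⁻¹ with hρ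
  have hq0 : 0 < q := by linarith [h.two_le]
  have hρ1 : ρ ^ (d / p) < 1 := by
    refine ENNReal.rpow_lt_one ?_ (by positivity)
    rw [hρ, ENNReal.ofReal_lt_one]
    exact inv_lt_one_of_one_lt₀ (by linarith [h.two_le])
  have hs : ∀ i : ℕ, ENNReal.ofReal (scale q i) = ρ ^ i := by
    intro i
    rw [hρ, ← ENNReal.ofReal_pow (by positivity)]
    simp [scale]
  have hb : tailSum ν q p w (max J n : ℕ) x ≤ ∑' i : ℕ, (ρ ^ (d / p)) ^ i := by
    refine ENNReal.tsum_le_tsum fun i => ?_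
    have h1 := hc (max J n + i) (by omega)
    rw [hs] at h1
    push_cast at h1 ⊢
    calc _ ≤ ((ρ ^ (max J n + i)) ^ d) ^ (1 / p) := ENNReal.rpow_le_rpow h1 (by positivity)
      _ = (ρ ^ (d / p)) ^ (max J n + i) := by
        rw [← ENNReal.rpow_natCast, ← ENNReal.rpow_natCast, ← ENNReal.rpow_mul,
          ← ENNReal.rpow_mul, ← ENNReal.rpow_mul]
        congr 1
        ring
      _ ≤ _ := pow_le_pow_right_of_le_one' hρ1.le (by omega)
  refine (hb.trans_lt ?_).ne
  rw [ENNReal.tsum_geometric]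
  exact (ENNReal.inv_ne_top.2 (tsub_pos_of_lt hρ1).ne').lt_top

variable {𝕜 X : Type*} [RCLike 𝕜] [MetricSpace X] [MeasurableSpace X] [BorelSpace X]
  {q p : ℝ} {D θ : ℝ≥0} {ν : Measure X} {w : X → 𝕜}

namespace ScaleRegular

/-- Balls centred at the points of a separated set have bounded overlap. -/
lemma tsum_indicator_ball_le (h : ScaleRegular q D θ ν) {j : ℤ} {N : Set X} [Countable N]
    (hN : ∀ a ∈ N, ∀ b ∈ N, a ≠ b → scale q j ≤ dist a b) (z : X) :
    ∑' a : N, (Metric.ball (a : X) (2 * scale q j)).indicator (fun _ => (1 : ℝ≥0∞)) z ≤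
      (D : ℝ≥0∞) ^ 4 := by
  set V := ν (sball q (j - 2) z) with hV
  have hV0 : V ≠ 0 := h.measure_ne_zero _ _
  have hVt : V ≠ ∞ := h.measure_ne_top _ _
  -- A volume count: the smaller balls about the net points near z are disjoint, lie in B_{j-2}(z),
  -- and each has at least D⁻⁴ times its measure.
  set T : N → Set X := fun a => if dist z a < 2 * scale q j then sball q (j + 1) (a : X) else ∅
    with hT
  have h2 := two_mul_scale_le h.two_le j
  have e12 : j - 1 - 1 = j - 2 := by ring
  have hdisj : Pairwise (Function.onFun Disjoint T) := by
    intro a b hab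
    simp only [Function.onFun, hT]
    split_ifs
    · exact disjoint_sball_of_separated h.two_le
        (hN a a.2 b b.2 fun hh => hab (Subtype.ext hh))
    all_goals simp
  have hmeas : ∀ a, MeasurableSet (T a) := by
    intro a
    simp only [hT]
    split_ifs
    · exact measurableSet_ball
    · exact MeasurableSet.empty
  have hsub : ⋃ a, T a ⊆ sball q (j - 2) z := by
    refine iUnion_subset fun a => ?_
    simp only [hT]
    split_ifs with hza
    · refine (sball_anti h.two_le (by omega : j - 1 ≤ j + 1) _).trans ?_
      rw [← e12]
      refine sball_subset_of_dist h.two_le ?_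
      rw [dist_comm]
      linarith
    · exact empty_subset _
  have hterm : ∀ a : N, (Metric.ball (a : X) (2 * scale q j)).indicator (fun _ => (1 : ℝ≥0∞)) z * V ≤
      (D : ℝ≥0∞) ^ 4 * ν (T a) := by
    intro a
    simp only [indicator, Metric.mem_ball, hT]
    split_ifs with hza
    · have h3 := h.measure_sub_one_le (j - 1) z
      rw [e12] at h3
      have h4 : ν (sball q (j - 1) z) ≤ D * ν (sball q (j - 1) (a : X)) :=
        h.measure_le_of_dist (by linarith)
      have h5 := h.measure_sub_one_le j (a : X)
      have h6 := h.measure_sub_one_le (j + 1) (a : X)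
      rw [add_sub_cancel_right] at h6
      calc 1 * V ≤ D * (D * (D * (D * ν (sball q (j + 1) (a : X))))) := by
            rw [one_mul]
            exact h3.trans (mul_le_mul_right (h4.trans (mul_le_mul_right
              (h5.trans (mul_le_mul_right h6 _)) _)) _)
        _ = _ := by ring
    · simp
  have hsum : (∑' a : N, (Metric.ball (a : X) (2 * scale q j)).indicator
      (fun _ => (1 : ℝ≥0∞)) z) * V ≤ (D : ℝ≥0∞) ^ 4 * V := by
    rw [← ENNReal.tsum_mul_right]
    refine (ENNReal.tsum_le_tsum hterm).trans ?_
    rw [ENNReal.tsum_mul_left, ← measure_iUnion hdisj hmeas]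
    exact mul_le_mul_right (measure_mono hsub) _
  exact (ENNReal.mul_le_mul_iff_left hV0 hVt).1 hsum

lemma tsum_setLIntegral_net_le (h : ScaleRegular q D θ ν) {j : ℤ} {N : Set X} [Countable N]
    (hN : ∀ a ∈ N, ∀ b ∈ N, a ≠ b → scale q j ≤ dist a b) {g : X → ℝ≥0∞} (hg : Measurable g) :
    ∑' a : N, ∫⁻ z in Metric.ball (a : X) (2 * scale q j), g z ∂ν ≤
      (D : ℝ≥0∞) ^ 4 * ∫⁻ z, g z ∂ν := by
  have e : ∀ a : N, ∫⁻ z in Metric.ball (a : X) (2 * scale q j), g z ∂ν =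
      ∫⁻ z, (Metric.ball (a : X) (2 * scale q j)).indicator (fun _ => (1 : ℝ≥0∞)) z * g z ∂ν := by
    intro a
    rw [← lintegral_indicator measurableSet_ball]
    congr with z
    simp only [indicator]
    split_ifs <;> simp
  simp only [e]
  rw [← lintegral_tsum, ← lintegral_const_mul _ hg]
  · refine lintegral_mono fun z => ?_
    rw [ENNReal.tsum_mul_right]
    exact mul_le_mul_left (h.tsum_indicator_ball_le hN z) _
  · exact fun a => ((measurable_const.indicator measurableSet_ball).mul hg).aemeasurable

/-- The set where the oscillations of a function of finite energy are not summable has Hausdorff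
dimension zero. -/
lemma dimH_not_oscSummable [Nontrivial X] [SecondCountableTopology X] [SFinite ν]
    (h : ScaleRegular q D θ ν) (hp : 1 < p) (hw : Measurable w) (hfin : energy ν p w ≠ ∞) :
    dimH {x | ¬ OscSummable ν q p w x} = 0 := by
  have hp0 : 0 < p := by linarith
  choose N hNsep hNdense using fun j : ℕ => exists_maximal_net X (scale q j) (scale_pos h.two_le j)
  have hcount : ∀ j, Countable (N j) := fun j => by
    rw [Set.countable_coe_iff]
    refine Set.PairwiseDisjoint.countable_of_isOpen (s := fun a => sball q (j + 1) a) ?_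
      (fun _ _ => Metric.isOpen_ball)
      (fun a _ => ⟨a, Metric.mem_ball_self (scale_pos h.two_le _)⟩)
    exact fun a ha b hb hab => disjoint_sball_of_separated h.two_le (hNsep j a ha b hb hab)
  -- The radius is doubled so that E j a dominates the oscillation energy at every point within
  -- scale(j) of a. Bounded overlap keeps the total finite.
  set E : ∀ j : ℕ, N j → ℝ≥0∞ := fun j a =>
    (D : ℝ≥0∞) ^ 2 * ∫⁻ z in Metric.ball (a : X) (2 * scale q j), diffEnergy ν q p w j z ∂ν with hE
  have hEsum : ∑' j : ℕ, ∑' a : N j, E j a ≠ ∞ := by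
    have h1 : ∀ j : ℕ, ∑' a : N j, E j a ≤
        (D : ℝ≥0∞) ^ 6 * ∫⁻ z, diffEnergy ν q p w j z ∂ν := by
      intro j
      simp only [hE, ENNReal.tsum_mul_left]
      refine (mul_le_mul_right (h.tsum_setLIntegral_net_le (hNsep j)
        (measurable_diffEnergy ν q p hw j)) _).trans_eq ?_
      ring
    refine ((ENNReal.tsum_le_tsum h1).trans_lt ?_).ne
    rw [ENNReal.tsum_mul_left]
    refine ENNReal.mul_lt_top (ENNReal.pow_lt_top ENNReal.coe_lt_top) ?_
    refine (ENNReal.tsum_comp_le_tsum_of_injective Nat.cast_injective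
      (fun j : ℤ => ∫⁻ z, diffEnergy ν q p w j z ∂ν)).trans_lt ?_
    refine (h.tsum_lintegral_diffEnergy_le hp0 hw).trans_lt ?_
    refine ENNReal.mul_lt_top (ENNReal.mul_lt_top (ENNReal.pow_lt_top ENNReal.coe_lt_top) ?_)
      hfin.lt_top
    exact (ENNReal.inv_ne_top.2 (tsub_pos_of_lt (by exact_mod_cast h.theta_lt)).ne').lt_top
  refine le_antisymm (le_of_forall_gt fun c hc => ?_) zero_le
  obtain ⟨d, hd0, hdc⟩ := ENNReal.lt_iff_exists_nnreal_btwn.1 hc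
  refine (dimH_le_of_hausdorffMeasure_ne_top (d := d) ?_).trans_lt hdc
  have hd : 0 < (d : ℝ) := by exact_mod_cast hd0
  -- The n-th cover uses only net balls of index at least n whose energy exceeds radius^d. The sum
  -- of diam^d is then at most 2^d times the total of E, uniformly in n.
  set ι : ℕ → Type _ := fun n => {i : Σ j : ℕ, N j //
    n ≤ i.1 ∧ ENNReal.ofReal (scale q i.1) ^ (d : ℝ) < E i.1 i.2} with hι
  set t : ∀ n, ι n → Set X := fun n i => sball q i.1.1 (i.1.2 : X) with ht
  have hdiam : ∀ n (i : ι n), Metric.ediam (t n i) ≤ 2 * ENNReal.ofReal (scale q i.1.1) := by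
    intro n i
    refine (Metric.ediam_mono (Metric.ball_subset_closedBall)).trans ?_
    rw [← Metric.closedEBall_ofReal (scale_pos h.two_le _).le]
    exact Metric.ediam_closedEBall_le
  have hbound := Measure.hausdorffMeasure_le_liminf_tsum (ι := ι) (l := atTop) (d : ℝ)
    {x | ¬ OscSummable ν q p w x} (fun n : ℕ => 2 * ENNReal.ofReal (scale q n)) ?_ t ?_ ?_
  · refine (hbound.trans_lt ?_).ne
    have hle : ∀ n, ∑' i, Metric.ediam (t n i) ^ (d : ℝ) ≤
        2 ^ (d : ℝ) * ∑' j : ℕ, ∑' a : N j, E j a := by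
      intro n
      rw [← ENNReal.tsum_sigma, ← ENNReal.tsum_mul_left]
      refine le_trans (ENNReal.tsum_le_tsum fun i => ?_) (ENNReal.tsum_comp_le_tsum_of_injective
        (Subtype.val_injective (p := fun i : Σ j : ℕ, N j => n ≤ i.1 ∧
          ENNReal.ofReal (scale q i.1) ^ (d : ℝ) < E i.1 i.2)) _)
      calc Metric.ediam (t n i) ^ (d : ℝ) ≤ (2 * ENNReal.ofReal (scale q i.1.1)) ^ (d : ℝ) :=
            ENNReal.rpow_le_rpow (hdiam n i) hd.le
        _ = 2 ^ (d : ℝ) * ENNReal.ofReal (scale q i.1.1) ^ (d : ℝ) :=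
            ENNReal.mul_rpow_of_nonneg _ _ hd.le
        _ ≤ 2 ^ (d : ℝ) * E i.1.1 i.1.2 := mul_le_mul_right i.2.2.le _
    refine (liminf_le_liminf (Eventually.of_forall hle)).trans_lt ?_
    rw [liminf_const]
    exact ENNReal.mul_lt_top (ENNReal.rpow_lt_top_of_nonneg hd.le ENNReal.ofNat_ne_top)
      hEsum.lt_top
  · have h1 := ENNReal.tendsto_ofReal (tendsto_scale h.two_le)
    have h2 := ENNReal.Tendsto.const_mul h1 (a := 2) (Or.inr ENNReal.ofNat_ne_top)
    simpa using h2
  · refine Eventually.of_forall fun n i => (hdiam n i).trans ?_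
    refine mul_le_mul_right (ENNReal.ofReal_le_ofReal (scale_anti h.two_le ?_)) _
    exact_mod_cast i.2.1
  · refine Eventually.of_forall fun n x hx => ?_
    obtain ⟨j, hnj, hj⟩ := h.exists_large_oscEnergy hp0 hx hd n
    obtain ⟨a, ha, hxa⟩ := hNdense j x
    refine mem_iUnion.2 ⟨⟨⟨j, ⟨a, ha⟩⟩, hnj, hj.trans_le ?_⟩, hxa⟩
    refine (h.oscEnergy_le p hw j x).trans (mul_le_mul_right ?_ _)
    refine lintegral_mono_set (Metric.ball_subset_ball' ?_)
    linarith

end ScaleRegular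

end Dimension

/-! ### Doubling and reverse doubling on uniformly perfect spaces. -/

section Doubling

variable {X : Type*} [MetricSpace X]

/-- Concentric balls of comparable radii have comparable measures. -/
def IsDoubling [MeasurableSpace X] (ν : Measure X) : Prop :=
  ∀ l : ℝ, ∃ D : ℝ≥0, ∀ (x : X) (r : ℝ), 0 < r →
    ν (Metric.ball x (l * r)) ≤ D * ν (Metric.ball x r)

/-- Annuli `B(x, r) \ B(x, r / κ)` are nonempty unless `B(x, r)` is the whole space. -/
def IsUniformlyPerfect (X : Type*) [MetricSpace X] (κ : ℝ) : Prop :=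
  1 < κ ∧ ∀ (x : X) (r : ℝ), 0 < r → (∃ y, r ≤ dist x y) → ∃ b, r / κ ≤ dist x b ∧ dist x b < r

lemma IsUniformlyPerfect.exists_ne_dist_lt [Nontrivial X] {κ : ℝ} (h : IsUniformlyPerfect X κ) (x : X)
    {ε : ℝ} (hε : 0 < ε) : ∃ b, b ≠ x ∧ dist x b < ε := by
  obtain ⟨y, hy⟩ := exists_ne x
  have hd : 0 < dist x y := dist_pos.2 hy.symm
  have hκ : 0 < κ := zero_lt_one.trans h.1
  obtain ⟨b, hb1, hb2⟩ := h.2 x (min ε (dist x y)) (lt_min hε hd) ⟨y, min_le_right _ _⟩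
  refine ⟨b, ?_, hb2.trans_le (min_le_left _ _)⟩
  rintro rfl
  rw [dist_self] at hb1
  exact absurd hb1 (not_le.2 (div_pos (lt_min hε hd) hκ))

variable [MeasurableSpace X] {ν : Measure X}

lemma ScaleRegular.mono {q : ℝ} {D D' θ θ' : ℝ≥0} (h : ScaleRegular q D θ ν) (hD : D ≤ D')
    (hθ : θ ≤ θ') (hθ' : θ' < 1) : ScaleRegular q D' θ' ν where
  two_le := h.two_le
  one_le := h.one_le.trans hD
  theta_pos := h.theta_pos.trans_le hθ
  theta_lt := hθ'
  ball_pos := h.ball_pos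
  ball_lt_top := h.ball_lt_top
  doubling x r hr := (h.doubling x r hr).trans (by gcongr)
  decay x j i hj := (h.decay x j i hj).trans (by gcongr)

/-- Doubling measures on uniformly perfect spaces are reverse doubling. -/
lemma reverse_doubling [BorelSpace X] {κ : ℝ} (hX : IsUniformlyPerfect X κ) {D : ℝ≥0}
    (hD : ∀ (x : X) (r : ℝ), 0 < r →
      ν (Metric.ball x ((2 * κ + 1) * r)) ≤ D * ν (Metric.ball x r))
    {x y : X} {r : ℝ} (hr : 0 < r) (hy : 2 * r ≤ dist x y) :
    ν (Metric.ball x r) ≤ (D / (D + 1) : ℝ≥0) * ν (Metric.ball x ((2 * κ + 1) * r)) := by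
  obtain ⟨hκ, hX⟩ := hX
  -- B(b,r) is disjoint from B(x,r), lies in B(x,(2κ+1)r), and has at least D⁻¹ times the measure of
  -- B(x,r). So the large ball has at least 1 + 1/D times the measure of the small one.
  obtain ⟨b, hb1, hb2⟩ : ∃ b, 2 * r ≤ dist x b ∧ dist x b < 2 * κ * r := by
    by_cases h : dist x y < 2 * κ * r
    · exact ⟨y, hy, h⟩
    · obtain ⟨b, h1, h2⟩ := hX x (2 * κ * r) (by positivity) ⟨y, not_lt.1 h⟩
      refine ⟨b, ?_, h2⟩
      rwa [mul_right_comm, mul_div_cancel_right₀ _ (by positivity)] at h1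
  have hdisj : Disjoint (Metric.ball x r) (Metric.ball b r) := disjoint_ball_of_le_dist hb1
  have h1 : ν (Metric.ball x r) + ν (Metric.ball b r) ≤
      ν (Metric.ball x ((2 * κ + 1) * r)) := by
    rw [← measure_union hdisj measurableSet_ball]
    refine measure_mono (union_subset (Metric.ball_subset_ball ?_) (Metric.ball_subset_ball' ?_))
    · nlinarith
    · rw [dist_comm]; linarith
  have h2 : ν (Metric.ball x r) ≤ D * ν (Metric.ball b r) := by
    refine (measure_mono (Metric.ball_subset_ball' ?_)).trans (hD b r hr)
    linarith
  have h3 : ((D : ℝ≥0∞) + 1) * ν (Metric.ball x r) ≤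
      D * ν (Metric.ball x ((2 * κ + 1) * r)) := by
    calc ((D : ℝ≥0∞) + 1) * ν (Metric.ball x r)
        = D * ν (Metric.ball x r) + ν (Metric.ball x r) := by ring
      _ ≤ D * ν (Metric.ball x r) + D * ν (Metric.ball b r) := by gcongr
      _ = D * (ν (Metric.ball x r) + ν (Metric.ball b r)) := by ring
      _ ≤ _ := by gcongr
  have hD1 : ((D : ℝ≥0∞) + 1) ≠ 0 := by simp
  have hD2 : ((D : ℝ≥0∞) + 1) ≠ ∞ := by simp
  calc ν (Metric.ball x r) = ((D : ℝ≥0∞) + 1)⁻¹ * (((D : ℝ≥0∞) + 1) * ν (Metric.ball x r)) := by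
        rw [← mul_assoc, ENNReal.inv_mul_cancel hD1 hD2, one_mul]
    _ ≤ ((D : ℝ≥0∞) + 1)⁻¹ * (D * ν (Metric.ball x ((2 * κ + 1) * r))) := by gcongr
    _ = _ := by
        rw [ENNReal.coe_div (by positivity), ENNReal.coe_add, ENNReal.coe_one, div_eq_mul_inv]
        ring

/-- Decay iterates reverse doubling with q = 2κ + 1. That needs a point at distance at least twice
the radius, and admissibility of j only provides one at distance scale(j+2)/2 or more. The first
three steps may therefore gain nothing, and the factor θ⁻³ in the constant absorbs them. -/
lemma IsDoubling.exists_scaleRegular [BorelSpace X] {κ : ℝ} (hX : IsUniformlyPerfect X κ)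
    (pos : ∀ (x : X) (r : ℝ), 0 < r → 0 < ν (Metric.ball x r))
    (fin : ∀ (x : X) (r : ℝ), 0 < r → ν (Metric.ball x r) < ∞) (hν : IsDoubling ν) :
    ∃ D θ : ℝ≥0, ScaleRegular (2 * κ + 1) D θ ν := by
  obtain ⟨D₀, hD₀⟩ := hν (2 * κ + 1)
  set D := max D₀ 1 with hDdef
  have hD : ∀ (x : X) (r : ℝ), 0 < r →
      ν (Metric.ball x ((2 * κ + 1) * r)) ≤ D * ν (Metric.ball x r) := fun x r hr =>
    (hD₀ x r hr).trans (by gcongr; exact le_max_left _ _)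
  have hD1 : 1 ≤ D := le_max_right _ _
  have hD0 : 0 < D := zero_lt_one.trans_le hD1
  set θ : ℝ≥0 := D / (D + 1) with hθ
  have hθ0 : 0 < θ := by positivity
  have hθ1 : θ < 1 := by
    rw [hθ, div_lt_one (by positivity)]
    exact lt_add_of_pos_right _ one_pos
  have hq : (2 : ℝ) ≤ 2 * κ + 1 := by linarith [hX.1]
  have hθinv : 1 ≤ θ⁻¹ := (one_le_inv₀ hθ0).2 hθ1.le
  refine ⟨D * (θ⁻¹) ^ 3, θ, hq, ?_, hθ0, hθ1, pos, fin, fun x r hr => ?_, fun x j i hj => ?_⟩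
  · exact one_le_mul hD1 (one_le_pow₀ hθinv)
  · refine (hD x r hr).trans ?_
    gcongr
    exact le_mul_of_one_le_right zero_le (one_le_pow₀ hθinv)
  · have hθe : (θ : ℝ≥0∞) ≤ 1 := by exact_mod_cast hθ1.le
    have hθe0 : (θ : ℝ≥0∞) ≠ 0 := by exact_mod_cast hθ0.ne'
    have key : (θ : ℝ≥0∞) ^ 3 * ν (sball (2 * κ + 1) (j + i) x) ≤
        θ ^ i * ν (sball (2 * κ + 1) j x) := by
      induction i with
      | zero =>
        simp only [Nat.cast_zero, add_zero, pow_zero, one_mul]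
        exact mul_le_of_le_one_left zero_le (pow_le_one₀ zero_le hθe)
      | succ i ih =>
        rcases le_or_gt 3 i with hi | hi
        · obtain ⟨y, z, hyz⟩ := hj
          obtain ⟨y', hy'⟩ : ∃ y', dist y z ≤ 2 * dist x y' := by
            by_contra! h
            have h1 := h y
            have h2 := h z
            have h3 := dist_triangle_left y z x
            linarith
          have hs : ∀ j : ℤ, 2 * scale (2 * κ + 1) (j + 1) ≤ scale (2 * κ + 1) j := fun j => by
            simpa using two_mul_scale_le hq (j + 1)
          have hq0 : (0 : ℝ) < (2 * κ + 1) ^ 2 := by positivity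
          have e : scale (2 * κ + 1) j = (2 * κ + 1) ^ 2 * scale (2 * κ + 1) (j + 2) := by
            have e1 := scale_sub_one hq (j + 1)
            have e2 := scale_sub_one hq (j + 2)
            rw [add_sub_cancel_right] at e1
            rw [show j + 2 - 1 = j + 1 by ring] at e2
            rw [e1, e2]
            ring
          rw [e] at hyz
          have h1 : scale (2 * κ + 1) (j + 2) ≤ dist y z := le_of_mul_le_mul_left hyz hq0
          have h2 : scale (2 * κ + 1) (j + (i + 1 : ℕ)) ≤ scale (2 * κ + 1) (j + 4) :=
            scale_anti hq (by push_cast; omega)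
          have h3 := hs (j + 2)
          have h4 := hs (j + 3)
          rw [show j + 2 + 1 = j + 3 by ring] at h3
          rw [show j + 3 + 1 = j + 4 by ring] at h4
          have h5 := reverse_doubling hX hD (x := x) (y := y')
            (scale_pos hq (j + (i + 1 : ℕ))) (by linarith)
          rw [← scale_sub_one hq] at h5
          have e3 : j + ((i + 1 : ℕ) : ℤ) - 1 = j + i := by push_cast; ring
          rw [e3] at h5
          calc (θ : ℝ≥0∞) ^ 3 * ν (sball (2 * κ + 1) (j + (i + 1 : ℕ)) x)
              ≤ (θ : ℝ≥0∞) ^ 3 * (θ * ν (sball (2 * κ + 1) (j + i) x)) :=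
                mul_le_mul_right h5 _
            _ = θ * ((θ : ℝ≥0∞) ^ 3 * ν (sball (2 * κ + 1) (j + i) x)) := by ring
            _ ≤ θ * (θ ^ i * ν (sball (2 * κ + 1) j x)) := mul_le_mul_right ih _
            _ = _ := by ring
        · exact mul_le_mul' (pow_le_pow_right_of_le_one' hθe (by omega))
            (measure_mono (sball_anti hq (by omega) x))
    calc ν (sball (2 * κ + 1) (j + i) x)
        = ((θ : ℝ≥0∞)⁻¹) ^ 3 * (θ ^ 3 * ν (sball (2 * κ + 1) (j + i) x)) := by
          rw [← mul_assoc, ← mul_pow, ENNReal.inv_mul_cancel hθe0 ENNReal.coe_ne_top, one_pow,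
            one_mul]
      _ ≤ ((θ : ℝ≥0∞)⁻¹) ^ 3 * (θ ^ i * ν (sball (2 * κ + 1) j x)) := by gcongr
      _ ≤ D * (((θ : ℝ≥0∞)⁻¹) ^ 3 * (θ ^ i * ν (sball (2 * κ + 1) j x))) :=
          le_mul_of_one_le_left zero_le (by exact_mod_cast hD1)
      _ = _ := by
          rw [ENNReal.coe_mul, ENNReal.coe_pow, ENNReal.coe_inv hθ0.ne']
          ring

/-- Two doubling measures on a uniformly perfect space are regular with the same constants. -/
lemma exists_scaleRegular_pair [BorelSpace X] {κ : ℝ} (hX : IsUniformlyPerfect X κ)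
    {μ ν : Measure X} (hμ : IsDoubling μ) (hν : IsDoubling ν)
    (posμ : ∀ (x : X) (r : ℝ), 0 < r → 0 < μ (Metric.ball x r))
    (finμ : ∀ (x : X) (r : ℝ), 0 < r → μ (Metric.ball x r) < ∞)
    (posν : ∀ (x : X) (r : ℝ), 0 < r → 0 < ν (Metric.ball x r))
    (finν : ∀ (x : X) (r : ℝ), 0 < r → ν (Metric.ball x r) < ∞) :
    ∃ (q : ℝ) (D θ : ℝ≥0), ScaleRegular q D θ μ ∧ ScaleRegular q D θ ν := by
  obtain ⟨D₁, θ₁, h₁⟩ := hμ.exists_scaleRegular hX posμ finμ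
  obtain ⟨D₂, θ₂, h₂⟩ := hν.exists_scaleRegular hX posν finν
  have hθ := max_lt h₁.theta_lt h₂.theta_lt
  exact ⟨_, _, _, h₁.mono (le_max_left D₁ D₂) (le_max_left θ₁ θ₂) hθ,
    h₂.mono (le_max_right D₁ D₂) (le_max_right θ₁ θ₂) hθ⟩

end Doubling

/-! ### Consequences of Ahlfors regularity. -/

section Ahlfors

variable {X : Type*} [MetricSpace X]

lemma ball_eq_univ_of_ediam_lt {x : X} {r : ℝ} (h : Metric.ediam (univ : Set X) < ENNReal.ofReal r) :
    Metric.ball x r = univ := by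
  refine eq_univ_of_forall fun y => ?_
  have h1 := (Metric.edist_le_ediam_of_mem (mem_univ y) (mem_univ x)).trans_lt h
  rw [edist_dist] at h1
  exact (ENNReal.ofReal_lt_ofReal_iff').1 h1 |>.1

lemma ofReal_lt_two_mul_ediam {x y : X} {r : ℝ} (hr : 0 < r) (h : r ≤ dist x y) :
    ENNReal.ofReal r < 2 * Metric.ediam (univ : Set X) := by
  have h1 : edist x y ≤ Metric.ediam (univ : Set X) :=
    Metric.edist_le_ediam_of_mem (mem_univ x) (mem_univ y)
  rw [edist_dist] at h1
  calc ENNReal.ofReal r < ENNReal.ofReal (2 * r) := by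
        rw [ENNReal.ofReal_lt_ofReal_iff (by positivity)]; linarith
    _ = 2 * ENNReal.ofReal r := by
        rw [ENNReal.ofReal_mul (by norm_num)]; simp
    _ ≤ 2 * Metric.ediam (univ : Set X) := by
        gcongr
        exact (ENNReal.ofReal_le_ofReal h).trans h1

/-- In a bounded space there are balls, of radius less than twice the diameter, that are the whole
space. -/
lemma exists_radius_ball_eq_univ [Nontrivial X] (h : Metric.ediam (univ : Set X) ≠ ∞) :
    ∃ R : ℝ, 0 < R ∧ Metric.ediam (univ : Set X) < ENNReal.ofReal R ∧
      ENNReal.ofReal R < 2 * Metric.ediam (univ : Set X) := by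
  have h0 : 0 < Metric.ediam (univ : Set X) := Metric.ediam_pos_iff.2 nontrivial_univ
  set δ := (Metric.ediam (univ : Set X)).toReal with hδ
  have hδ0 : 0 < δ := ENNReal.toReal_pos h0.ne' h
  have e : Metric.ediam (univ : Set X) = ENNReal.ofReal δ := (ENNReal.ofReal_toReal h).symm
  refine ⟨3 / 2 * δ, by positivity, ?_, ?_⟩
  · rw [e, ENNReal.ofReal_lt_ofReal_iff (by positivity)]; linarith
  · rw [e, show (2 : ℝ≥0∞) = ENNReal.ofReal 2 by simp, ← ENNReal.ofReal_mul (by norm_num),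
      ENNReal.ofReal_lt_ofReal_iff (by positivity)]
    linarith

variable [MeasurableSpace X] [BorelSpace X] {μ : Measure X} {n : ℝ}

/-- Regularity speaks only of radii below twice the diameter. When l r is beyond that, either B(x,r)
is already the whole space or some R between r and l r is an allowed radius whose ball is the whole
space. -/
lemma IsAhlforsRegular.isDoubling [Nontrivial X] (h : IsAhlforsRegular μ n) (hn : 0 < n) :
    IsDoubling μ := by
  obtain ⟨C₁, C₂, hC₁, hC₁1, hC₂, hreg⟩ := h.regular
  intro l₀
  set l := max l₀ 1 with hl
  have hl1 : 1 ≤ l := le_max_right _ _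
  have hln : 1 ≤ l ^ n := Real.one_le_rpow hl1 hn.le
  have hC : 1 ≤ C₂ * l ^ n := one_le_mul_of_one_le_of_one_le hC₂ hln
  refine ⟨(C₂ * l ^ n).toNNReal, fun x r hr => ?_⟩
  change _ ≤ ENNReal.ofReal (C₂ * l ^ n) * _
  have hCe : (1 : ℝ≥0∞) ≤ ENNReal.ofReal (C₂ * l ^ n) := by
    rw [← ENNReal.ofReal_one]; exact ENNReal.ofReal_le_ofReal hC
  have hsub : Metric.ball x (l₀ * r) ⊆ Metric.ball x (l * r) :=
    Metric.ball_subset_ball (by gcongr; exact le_max_left _ _)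
  refine (measure_mono hsub).trans ?_
  have hrl : r ≤ l * r := le_mul_of_one_le_left hr.le hl1
  by_cases h1 : ENNReal.ofReal (l * r) < 2 * Metric.ediam (univ : Set X)
  · exact (hreg x r l hr ((ENNReal.ofReal_le_ofReal hrl).trans_lt h1) hl1 h1).2
  · rw [not_lt] at h1
    by_cases h2 : Metric.ediam (univ : Set X) < ENNReal.ofReal r
    · rw [ball_eq_univ_of_ediam_lt h2]
      exact (measure_mono (subset_univ _)).trans (le_mul_of_one_le_left zero_le hCe)
    · rw [not_lt] at h2
      have hfin : Metric.ediam (univ : Set X) ≠ ∞ := by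
        intro htop
        rw [htop, ENNReal.mul_top two_ne_zero] at h1
        exact absurd (top_le_iff.1 h1) ENNReal.ofReal_ne_top
      obtain ⟨R, hR0, hR1, hR2⟩ := exists_radius_ball_eq_univ hfin
      have hrR : r ≤ R := by
        by_contra! hlt
        exact absurd (h2.trans_lt hR1) (not_lt.2 (ENNReal.ofReal_le_ofReal hlt.le))
      have hRl : R ≤ l * r := by
        by_contra! hlt
        exact absurd (hR2.trans_le h1) (not_lt.2 (ENNReal.ofReal_le_ofReal hlt.le))
      have e : R / r * r = R := div_mul_cancel₀ R hr.ne'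
      have h3 := (hreg x r (R / r) hr ((ENNReal.ofReal_le_ofReal hrR).trans_lt hR2)
        ((one_le_div hr).2 hrR) (by rwa [e])).2
      rw [e, ball_eq_univ_of_ediam_lt hR1] at h3
      refine (measure_mono (subset_univ _)).trans (h3.trans ?_)
      gcongr
      rwa [div_le_iff₀ hr]

/-- With C₁ κⁿ = 2, an empty annulus would make B(x,r) and B(x,r/κ) equal although the first has at
least twice the measure of the second. -/
lemma IsAhlforsRegular.exists_isUniformlyPerfect (h : IsAhlforsRegular μ n) (hn : 0 < n) :
    ∃ κ, IsUniformlyPerfect X κ := by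
  obtain ⟨C₁, C₂, hC₁, hC₁1, hC₂, hreg⟩ := h.regular
  have h2 : 1 < 2 / C₁ := by rw [lt_div_iff₀ hC₁]; linarith
  set κ := (2 / C₁) ^ (1 / n) with hκ
  have hκ1 : 1 < κ := Real.one_lt_rpow h2 (by positivity)
  have hκ0 : 0 < κ := zero_lt_one.trans hκ1
  have hκn : C₁ * κ ^ n = 2 := by
    rw [hκ, ← Real.rpow_mul (by positivity), one_div_mul_cancel hn.ne', Real.rpow_one]
    field_simp
  refine ⟨κ, hκ1, fun x r hr ⟨y, hy⟩ => ?_⟩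
  by_contra! hb
  have hrκ : 0 < r / κ := by positivity
  have hle : r / κ ≤ r := div_le_self hr.le hκ1.le
  have heq : Metric.ball x r ⊆ Metric.ball x (r / κ) := by
    intro b hbr
    rw [Metric.mem_ball'] at hbr ⊢
    by_contra! hlt
    exact absurd hbr (not_lt.2 (hb b hlt))
  have hd := ofReal_lt_two_mul_ediam hr hy
  have e : κ * (r / κ) = r := mul_div_cancel₀ r hκ0.ne'
  have h1 := (hreg x (r / κ) κ hrκ ((ENNReal.ofReal_le_ofReal hle).trans_lt hd) hκ1.le
    (by rwa [e])).1
  rw [e, hκn] at h1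
  have h3 := h1.trans (measure_mono heq)
  have hp := h.ball_pos x _ hrκ
  have ht := h.ball_lt_top x _ hrκ
  have h4 : μ (Metric.ball x (r / κ)) < ENNReal.ofReal 2 * μ (Metric.ball x (r / κ)) := by
    rw [show ENNReal.ofReal 2 = 2 by simp, two_mul]
    exact ENNReal.lt_add_right ht.ne hp.ne'
  exact absurd h3 (not_le.2 h4)

/-- A bridge between balls with different centres that stays among the allowed radii. In an
unbounded space R' = 2R with R ≥ d(x,y); in a bounded one R' = R is so large that the balls are the
whole space. -/
lemma exists_common_radius (X : Type*) [MetricSpace X] [Nontrivial X] (x y : X) {r ρ : ℝ}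
    (hr : 0 < r) (hr' : ENNReal.ofReal r < 2 * Metric.ediam (univ : Set X))
    (hρ' : ENNReal.ofReal ρ < 2 * Metric.ediam (univ : Set X)) :
    ∃ R R' : ℝ, r ≤ R ∧ ρ ≤ R ∧ R ≤ R' ∧ R' ≤ 2 * R ∧
      ENNReal.ofReal R' < 2 * Metric.ediam (univ : Set X) ∧
      Metric.ball x R ⊆ Metric.ball y R' := by
  by_cases hfin : Metric.ediam (univ : Set X) = ∞
  · set R := max (max r ρ) (dist x y) with hR
    have h1 : r ≤ R := (le_max_left r ρ).trans (le_max_left _ _)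
    have h2 : ρ ≤ R := (le_max_right r ρ).trans (le_max_left _ _)
    have h3 : dist x y ≤ R := le_max_right _ _
    refine ⟨R, 2 * R, h1, h2, by linarith, le_rfl, ?_, Metric.ball_subset_ball' (by linarith)⟩
    rw [hfin, ENNReal.mul_top two_ne_zero]
    exact ENNReal.ofReal_lt_top
  · obtain ⟨S, hS0, hS1, hS2⟩ := exists_radius_ball_eq_univ hfin
    set R := max (max r ρ) S with hR
    have h1 : r ≤ R := (le_max_left r ρ).trans (le_max_left _ _)
    have h2 : ρ ≤ R := (le_max_right r ρ).trans (le_max_left _ _)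
    have h3 : S ≤ R := le_max_right _ _
    refine ⟨R, R, h1, h2, le_rfl, by linarith, ?_, ?_⟩
    · rcases max_choice (max r ρ) S with h | h
      · rcases max_choice r ρ with h' | h'
        · rwa [hR, h, h']
        · rwa [hR, h, h']
      · rwa [hR, h]
    · rw [ball_eq_univ_of_ediam_lt (hS1.trans_le (ENNReal.ofReal_le_ofReal h3)) (x := y)]
      exact subset_univ _

/-- Balls of the same radius, at all centres, have comparable measures. -/
lemma IsAhlforsRegular.exists_measure_ball_le [Nontrivial X] (h : IsAhlforsRegular μ n)
    (hn : 0 < n) : ∃ K : ℝ, 0 < K ∧ ∀ (x y : X) (r ρ : ℝ), 0 < r → 0 < ρ →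
      ENNReal.ofReal r < 2 * Metric.ediam (univ : Set X) →
      ENNReal.ofReal ρ < 2 * Metric.ediam (univ : Set X) →
      ρ ^ n * μ.real (Metric.ball x r) ≤ K * r ^ n * μ.real (Metric.ball y ρ) := by
  obtain ⟨C₁, C₂, hC₁, hC₁1, hC₂, hreg⟩ := h.regular
  have hreg' : ∀ (x : X) (r R : ℝ), 0 < r → r ≤ R →
      ENNReal.ofReal R < 2 * Metric.ediam (univ : Set X) →
      C₁ * (R / r) ^ n * μ.real (Metric.ball x r) ≤ μ.real (Metric.ball x R) ∧
      μ.real (Metric.ball x R) ≤ C₂ * (R / r) ^ n * μ.real (Metric.ball x r) := by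
    intro x r R hr hrR hR
    have hR0 : 0 < R := hr.trans_le hrR
    have e : R / r * r = R := div_mul_cancel₀ R hr.ne'
    obtain ⟨h1, h2⟩ := hreg x r (R / r) hr ((ENNReal.ofReal_le_ofReal hrR).trans_lt hR)
      ((one_le_div hr).2 hrR) (by rwa [e])
    rw [e] at h1 h2
    have ht := (h.ball_lt_top x R hR0).ne
    have ht' := (h.ball_lt_top x r hr).ne
    constructor
    · have := ENNReal.toReal_mono ht h1
      rwa [ENNReal.toReal_mul, ENNReal.toReal_ofReal (by positivity)] at this
    · have := ENNReal.toReal_mono (ENNReal.mul_ne_top ENNReal.ofReal_ne_top ht') h2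
      rwa [ENNReal.toReal_mul, ENNReal.toReal_ofReal (by positivity)] at this
  -- Regularity is used at x from r up to R and at y from ρ up to R'. The powers of R cancel, and 2ⁿ
  -- comes from R' ≤ 2R.
  refine ⟨C₂ * 2 ^ n / C₁, by positivity, fun x y r ρ hr hρ hr' hρ' => ?_⟩
  obtain ⟨R, R', h1, h2, h3, h4, h5, h6⟩ := exists_common_radius X x y hr hr' hρ'
  have hR0 : 0 < R := hr.trans_le h1
  have hR'0 : 0 < R' := hR0.trans_le h3
  have hR : ENNReal.ofReal R < 2 * Metric.ediam (univ : Set X) :=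
    (ENNReal.ofReal_le_ofReal h3).trans_lt h5
  have a1 := (hreg' x r R hr h1 hR).1
  have a2 : μ.real (Metric.ball x R) ≤ μ.real (Metric.ball y R') :=
    measureReal_mono h6 (h.ball_lt_top y R' hR'0).ne
  have a3 := (hreg' y ρ R' hρ (h2.trans h3) h5).2
  have hm0 : 0 ≤ μ.real (Metric.ball y ρ) := measureReal_nonneg
  have a4 : C₁ * (R / r) ^ n * μ.real (Metric.ball x r) ≤
      C₂ * (2 * R / ρ) ^ n * μ.real (Metric.ball y ρ) := by
    refine a1.trans (a2.trans (a3.trans ?_))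
    gcongr
  rw [Real.div_rpow hR0.le hr.le, Real.div_rpow (by positivity) hρ.le,
    Real.mul_rpow (by norm_num) hR0.le] at a4
  have hRn : 0 < R ^ n := Real.rpow_pos_of_pos hR0 n
  have hrn : 0 < r ^ n := Real.rpow_pos_of_pos hr n
  have hρn : 0 < ρ ^ n := Real.rpow_pos_of_pos hρ n
  have a5 := mul_le_mul_of_nonneg_right a4 (show 0 ≤ r ^ n * ρ ^ n / (R ^ n * C₁) by positivity)
  have e1 : C₁ * (R ^ n / r ^ n) * μ.real (Metric.ball x r) * (r ^ n * ρ ^ n / (R ^ n * C₁)) =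
      ρ ^ n * μ.real (Metric.ball x r) := by field_simp
  have e2 : C₂ * (2 ^ n * R ^ n / ρ ^ n) * μ.real (Metric.ball y ρ) *
      (r ^ n * ρ ^ n / (R ^ n * C₁)) = C₂ * 2 ^ n / C₁ * r ^ n * μ.real (Metric.ball y ρ) := by
    field_simp
  rwa [e1, e2] at a5

/-- The measure of `B(x, d(x, y))` is comparable to `d(x, y) ^ n`. -/
lemma IsAhlforsRegular.exists_edist_rpow_comparable [Nontrivial X] (h : IsAhlforsRegular μ n)
    (hn : 0 < n) : ∃ c : ℝ≥0, 0 < c ∧ ∀ x y : X, x ≠ y →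
      edist x y ^ n ≤ c * μ (Metric.ball x (dist x y)) ∧
      μ (Metric.ball x (dist x y)) ≤ c * edist x y ^ n := by
  obtain ⟨K, hK0, hK⟩ := h.exists_measure_ball_le hn
  obtain ⟨o, o', hoo⟩ := exists_pair_ne X
  set ρ := dist o o' with hρ
  have hρ0 : 0 < ρ := dist_pos.2 hoo
  have hρd := ofReal_lt_two_mul_ediam hρ0 hρ.le
  have hm0 : 0 < μ.real (Metric.ball o ρ) :=
    ENNReal.toReal_pos (h.ball_pos o ρ hρ0).ne' (h.ball_lt_top o ρ hρ0).ne
  have hρn : 0 < ρ ^ n := Real.rpow_pos_of_pos hρ0 n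
  set A := K * ρ ^ n / μ.real (Metric.ball o ρ) with hA
  set B := K * μ.real (Metric.ball o ρ) / ρ ^ n with hB
  have hA0 : 0 < A := by positivity
  refine ⟨(max A B).toNNReal, Real.toNNReal_pos.2 (lt_max_of_lt_left hA0), fun x y hxy => ?_⟩
  change _ ≤ ENNReal.ofReal (max A B) * _ ∧ _ ≤ ENNReal.ofReal (max A B) * _
  have hd0 : 0 < dist x y := dist_pos.2 hxy
  have hdd := ofReal_lt_two_mul_ediam hd0 le_rfl
  have ht := (h.ball_lt_top x _ hd0).ne
  have h1 := hK x o (dist x y) ρ hd0 hρ0 hdd hρd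
  have h2 := hK o x ρ (dist x y) hρ0 hd0 hρd hdd
  have em : μ (Metric.ball x (dist x y)) = ENNReal.ofReal (μ.real (Metric.ball x (dist x y))) :=
    (ENNReal.ofReal_toReal ht).symm
  have hmx : 0 ≤ μ.real (Metric.ball x (dist x y)) := measureReal_nonneg
  have hAB : 0 ≤ max A B := hA0.le.trans (le_max_left _ _)
  rw [em, edist_dist, ENNReal.ofReal_rpow_of_pos hd0, ← ENNReal.ofReal_mul hAB,
    ← ENNReal.ofReal_mul hAB]
  constructor
  · refine ENNReal.ofReal_le_ofReal (le_trans ?_ (mul_le_mul_of_nonneg_right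
      (le_max_left A B) hmx))
    rw [hA, div_mul_eq_mul_div, le_div_iff₀ hm0]
    exact h2
  · refine ENNReal.ofReal_le_ofReal (le_trans ?_ (mul_le_mul_of_nonneg_right
      (le_max_right A B) (by positivity)))
    rw [hB, div_mul_eq_mul_div, le_div_iff₀ hρn]
    linarith

end Ahlfors

/-! ### Distortion of balls and pull-back of doubling measures. -/

section Quasisymmetric

variable {X Y : Type*} [MetricSpace X] [MetricSpace Y] {f : X ≃ₜ Y}

/-- The ratios of the distances of the images of three points are controlled by the ratios of the
distances of the points. -/
def HasControlledDistortion (f : X ≃ₜ Y) : Prop :=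
  ∃ η : ℝ → ℝ, (∀ t, 0 < t → 0 < η t) ∧ ∀ (x a b : X) (t : ℝ), 0 < t → x ≠ a →
    dist x b ≤ t * dist x a → dist (f x) (f b) ≤ η t * dist (f x) (f a)

lemma IsQuasisymmetric.hasControlledDistortion (hf : IsQuasisymmetric f) :
    HasControlledDistortion f := by
  obtain ⟨η, hη⟩ := hf
  refine ⟨fun t => η t.toNNReal, fun t ht => ?_, fun x a b t ht hxa hb => ?_⟩
  · exact_mod_cast NNReal.homeomorph_pos η (Real.toNNReal_pos.2 ht)
  · have hd : 0 < dist x a := dist_pos.2 hxa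
    have hfd : 0 < nndist (f x) (f a) := by
      rw [← NNReal.coe_pos, coe_nndist]
      exact dist_pos.2 fun h => hxa (f.injective h)
    have h1 := hη b a x hxa
    rw [div_le_iff₀ hfd] at h1
    have h2 : nndist x b / nndist x a ≤ t.toNNReal := by
      rw [← NNReal.coe_le_coe, NNReal.coe_div, coe_nndist, coe_nndist, Real.coe_toNNReal t ht.le,
        div_le_iff₀ hd]
      exact hb
    have h3 := h1.trans (mul_le_mul_left ((NNReal.strictMono_homeomorph η).monotone h2) _)
    exact_mod_cast h3

/-- The inverse has control function t ↦ 1/η⁻¹(1/t): apply the condition for f with a and b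
exchanged and invert η, which is increasing. -/
lemma IsQuasisymmetric.hasControlledDistortion_symm (hf : IsQuasisymmetric f) :
    HasControlledDistortion f.symm := by
  obtain ⟨η, hη⟩ := hf
  have hmono := NNReal.strictMono_homeomorph η
  have hpos : ∀ t : ℝ, 0 < t → 0 < η.symm (t⁻¹).toNNReal := fun t ht =>
    NNReal.homeomorph_pos η.symm (Real.toNNReal_pos.2 (inv_pos.2 ht))
  refine ⟨fun t => ((η.symm (t⁻¹).toNNReal)⁻¹ : ℝ≥0), fun t ht => ?_,
    fun x a b t ht hxa hb => ?_⟩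
  · exact_mod_cast inv_pos.2 (hpos t ht)
  · obtain ⟨x, rfl⟩ := f.surjective x
    obtain ⟨a, rfl⟩ := f.surjective a
    obtain ⟨b, rfl⟩ := f.surjective b
    simp only [Homeomorph.symm_apply_apply]
    rcases eq_or_ne x b with rfl | hxb
    · rw [dist_self]; positivity
    have hd : 0 < dist x b := dist_pos.2 hxb
    have hfb : 0 < dist (f x) (f b) := dist_pos.2 fun h => hxb (f.injective h)
    have h1 := hη a b x hxb
    have h2 : (t⁻¹).toNNReal ≤ nndist (f x) (f a) / nndist (f x) (f b) := by
      rw [← NNReal.coe_le_coe, NNReal.coe_div, coe_nndist, coe_nndist,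
        Real.coe_toNNReal _ (inv_pos.2 ht).le, le_div_iff₀ hfb, inv_mul_le_iff₀ ht]
      exact hb
    have h3 : η.symm (t⁻¹).toNNReal ≤ nndist x a / nndist x b := by
      rw [← hmono.le_iff_le, η.apply_symm_apply]
      exact h2.trans h1
    have h4 : ((η.symm (t⁻¹).toNNReal : ℝ≥0) : ℝ) ≤ dist x a / dist x b := by
      exact_mod_cast h3
    have h5 : (0 : ℝ) < (η.symm (t⁻¹).toNNReal : ℝ≥0) := by exact_mod_cast hpos t ht
    rw [le_div_iff₀ hd] at h4
    rw [NNReal.coe_inv, inv_mul_eq_div, le_div_iff₀ h5]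
    linarith

lemma hasControlledDistortion_refl (X : Type*) [MetricSpace X] :
    HasControlledDistortion (Homeomorph.refl X) :=
  ⟨id, fun _ ht => ht, fun _ _ _ _ _ _ h => h⟩

variable [MeasurableSpace X] [BorelSpace X] [MeasurableSpace Y] [BorelSpace Y]
  {μY : Measure Y}

lemma map_symm_apply (f : X ≃ₜ Y) (μY : Measure Y) (s : Set X) :
    μY.map f.symm s = μY (f '' s) := by
  have := f.symm.toMeasurableEquiv.map_apply (μ := μY) s
  rw [Homeomorph.toMeasurableEquiv_coe] at this
  rw [this, f.image_eq_preimage_symm]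

lemma map_symm_ball_pos (f : X ≃ₜ Y)
    (pos : ∀ (y : Y) (r : ℝ), 0 < r → 0 < μY (Metric.ball y r)) (x : X) (r : ℝ) (hr : 0 < r) :
    0 < μY.map f.symm (Metric.ball x r) := by
  rw [map_symm_apply]
  have hopen : IsOpen (f '' Metric.ball x r) := f.isOpenMap _ Metric.isOpen_ball
  obtain ⟨δ, hδ, hsub⟩ := Metric.isOpen_iff.1 hopen (f x)
    (mem_image_of_mem f (Metric.mem_ball_self hr))
  exact (pos _ _ hδ).trans_le (measure_mono hsub)

/-- Small balls in the target are comparable to images of balls, in the sense of the measure. -/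
def ComparableBalls (f : X ≃ₜ Y) (μY : Measure Y) (q : ℝ) : Prop :=
  ∃ K : ℝ≥0, 1 ≤ K ∧ ∀ (x : X) (k₀ : ℤ), ∀ᶠ ρ in 𝓝[>] (0 : ℝ), ∃ k ≥ k₀,
    f ⁻¹' Metric.ball (f x) ρ ⊆ sball q k x ∧
      μY.map f.symm (sball q k x) ≤ K * μY.map f.symm (f ⁻¹' Metric.ball (f x) ρ)

namespace HasControlledDistortion

lemma map_symm_ball_lt_top [Nontrivial X] (hf : HasControlledDistortion f)
    (fin : ∀ (y : Y) (r : ℝ), 0 < r → μY (Metric.ball y r) < ∞) (x : X) (r : ℝ) (hr : 0 < r) :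
    μY.map f.symm (Metric.ball x r) < ∞ := by
  obtain ⟨η, hη0, hη⟩ := hf
  obtain ⟨a, ha⟩ := exists_ne x
  have hd : 0 < dist x a := dist_pos.2 ha.symm
  have hfd : 0 < dist (f x) (f a) := dist_pos.2 fun h => ha.symm (f.injective h)
  have ht := hη0 (r / dist x a) (by positivity)
  rw [map_symm_apply]
  refine (measure_mono ?_).trans_lt (fin (f x) (η (r / dist x a) * dist (f x) (f a) + 1)
    (by positivity))
  rintro _ ⟨b, hb, rfl⟩
  rw [Metric.mem_ball'] at hb ⊢
  have := hη x a b (r / dist x a) (by positivity) ha.symm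
    (by rw [div_mul_cancel₀ r hd.ne']; exact hb.le)
  linarith

/-- The pull-back of a doubling measure under a homeomorphism of controlled distortion is doubling. -/
lemma isDoubling_map_symm (hf : HasControlledDistortion f) (hY : IsDoubling μY) :
    IsDoubling (μY.map f.symm) := by
  obtain ⟨η, hη0, hη⟩ := hf
  intro l₀
  set l := max l₀ 1 with hl
  have hl0 : 0 < l := zero_lt_one.trans_le (le_max_right _ _)
  have hηl := hη0 l hl0
  obtain ⟨D₀, hD₀⟩ := hY (2 * η l + 1)
  refine ⟨max D₀ 1, fun x r hr => ?_⟩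
  have hD1 : (1 : ℝ≥0∞) ≤ (max D₀ 1 : ℝ≥0) := by exact_mod_cast le_max_right D₀ 1
  have hsub : Metric.ball x (l₀ * r) ⊆ Metric.ball x (l * r) :=
    Metric.ball_subset_ball (by gcongr; exact le_max_left _ _)
  refine (measure_mono hsub).trans ?_
  by_cases hall : ∀ a, dist x a < r
  · refine (measure_mono fun b _ => ?_).trans (le_mul_of_one_le_left zero_le hD1)
    rw [Metric.mem_ball']
    exact hall b
  push Not at hall
  set S := (fun a => dist (f x) (f a)) '' {a | r ≤ dist x a} with hS
  have hSne : S.Nonempty := by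
    obtain ⟨a, ha⟩ := hall
    exact ⟨_, a, ha, rfl⟩
  have hSb : BddBelow S := ⟨0, by rintro _ ⟨a, _, rfl⟩; exact dist_nonneg⟩
  set ρ := sInf S with hρ
  have hρ0 : 0 < ρ := by
    have hopen : IsOpen (f '' Metric.ball x r) := f.isOpenMap _ Metric.isOpen_ball
    obtain ⟨δ, hδ, hsub⟩ := Metric.isOpen_iff.1 hopen (f x)
      (mem_image_of_mem f (Metric.mem_ball_self hr))
    refine hδ.trans_le (le_csInf hSne ?_)
    rintro _ ⟨a, ha, rfl⟩
    by_contra! hlt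
    obtain ⟨b, hb, hba⟩ := hsub (Metric.mem_ball'.2 hlt)
    rw [f.injective hba, Metric.mem_ball'] at hb
    exact absurd ha (not_le.2 hb)
  obtain ⟨_, ⟨a, ha, rfl⟩, haρ⟩ := exists_lt_of_csInf_lt hSne (show sInf S < 2 * ρ by linarith)
  have hxa : x ≠ a := by
    rintro rfl
    rw [mem_ofPred_eq, dist_self] at ha
    linarith
  have h1 : f '' Metric.ball x (l * r) ⊆ Metric.ball (f x) ((2 * η l + 1) * ρ) := by
    rintro _ ⟨b, hb, rfl⟩
    rw [Metric.mem_ball'] at hb ⊢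
    have h2 := hη x a b l hl0 hxa (hb.le.trans (by gcongr; exact ha))
    calc dist (f x) (f b) ≤ η l * dist (f x) (f a) := h2
      _ ≤ η l * (2 * ρ) := by gcongr
      _ < (2 * η l + 1) * ρ := by linarith
  have h3 : Metric.ball (f x) ρ ⊆ f '' Metric.ball x r := by
    intro y hy
    refine ⟨f.symm y, ?_, f.apply_symm_apply y⟩
    rw [Metric.mem_ball']
    by_contra! hlt
    have h4 : ρ ≤ dist (f x) y := csInf_le hSb ⟨f.symm y, hlt, by simp⟩
    rw [Metric.mem_ball'] at hy
    linarith
  rw [map_symm_apply, map_symm_apply]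
  calc μY (f '' Metric.ball x (l * r)) ≤ μY (Metric.ball (f x) ((2 * η l + 1) * ρ)) :=
        measure_mono h1
    _ ≤ D₀ * μY (Metric.ball (f x) ρ) := hD₀ _ _ hρ0
    _ ≤ (max D₀ 1 : ℝ≥0) * μY (f '' Metric.ball x r) := by
        gcongr
        exact le_max_left _ _

/-- The image of `B(z, d(z, t))` has at least the measure of a ball of radius `d(f z, f t)`. -/
lemma exists_measure_ball_le_map_symm (hf : HasControlledDistortion f) (hY : IsDoubling μY) :
    ∃ D : ℝ≥0, 0 < D ∧ ∀ z t : X, z ≠ t → μY (Metric.ball (f z) (dist (f z) (f t))) ≤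
      D * μY.map f.symm (Metric.ball z (dist z t)) := by
  obtain ⟨η, hη0, hη⟩ := hf
  have hη1 := hη0 1 one_pos
  obtain ⟨D₀, hD₀⟩ := hY (η 1 + 1)
  refine ⟨max D₀ 1, zero_lt_one.trans_le (le_max_right _ _), fun z t hzt => ?_⟩
  have hfd : 0 < dist (f z) (f t) := dist_pos.2 fun h => hzt (f.injective h)
  have h1 := hD₀ (f z) (dist (f z) (f t) / (η 1 + 1)) (by positivity)
  rw [mul_div_cancel₀ _ (by positivity : η 1 + 1 ≠ 0)] at h1
  refine h1.trans ?_
  rw [map_symm_apply]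
  gcongr
  · exact le_max_left _ _
  · intro y hy
    refine ⟨f.symm y, ?_, f.apply_symm_apply y⟩
    rw [Metric.mem_ball'] at hy ⊢
    by_contra! hlt
    have hza : z ≠ f.symm y := by
      intro h
      rw [← h, dist_self] at hlt
      exact absurd hlt (not_le.2 (dist_pos.2 hzt))
    have h2 := hη z (f.symm y) t 1 one_pos hza (by rwa [one_mul])
    rw [f.apply_symm_apply] at h2
    have hy0 : 0 ≤ dist (f z) y := dist_nonneg
    rw [lt_div_iff₀ (by positivity)] at hy
    nlinarith

/-- Precise representatives average over balls of Y, the estimates over balls of X. If s is the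
outer radius of f⁻¹(B(f x,ρ)), positive because there are no isolated points, and k is its scale, a
point a of this set at distance over s/2 satisfies scale(k) ≤ q² d(x,a). Hence f(B_k(x)) lies in a
ball of radius (η(q²)+1)ρ, and doubling concludes. -/
lemma exists_sball_comparable [Nontrivial X] (hf : HasControlledDistortion f) (hY : IsDoubling μY)
    {κ : ℝ} (hX : IsUniformlyPerfect X κ) {q : ℝ} (hq : 2 ≤ q) :
    ComparableBalls f μY q := by
  obtain ⟨η, hη0, hη⟩ := hf
  have hq0 : 0 < q := by linarith
  have hηq := hη0 (q ^ 2) (by positivity)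
  obtain ⟨D₀, hD₀⟩ := hY (η (q ^ 2) + 1)
  refine ⟨max D₀ 1, le_max_right _ _, fun x k₀ => ?_⟩
  have hopen : IsOpen (f '' sball q (k₀ + 1) x) := f.isOpenMap _ Metric.isOpen_ball
  obtain ⟨δ, hδ, hsub⟩ := Metric.isOpen_iff.1 hopen (f x)
    (mem_image_of_mem f (Metric.mem_ball_self (scale_pos hq _)))
  filter_upwards [Ioo_mem_nhdsGT hδ] with ρ hρ
  set S := f ⁻¹' Metric.ball (f x) ρ with hS
  have hSsub : S ⊆ sball q (k₀ + 1) x := by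
    intro b hb
    obtain ⟨c, hc, hcb⟩ := hsub (Metric.ball_subset_ball hρ.2.le hb)
    rwa [f.injective hcb] at hc
  set s := sSup ((fun b => dist x b) '' S) with hs
  have hbdd : BddAbove ((fun b => dist x b) '' S) := by
    refine ⟨scale q (k₀ + 1), ?_⟩
    rintro _ ⟨b, hb, rfl⟩
    exact (Metric.mem_ball'.1 (hSsub hb)).le
  have hxS : x ∈ S := by simp [hS, hρ.1]
  have hne : ((fun b => dist x b) '' S).Nonempty := ⟨_, x, hxS, rfl⟩
  have hs1 : s ≤ scale q (k₀ + 1) := by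
    refine csSup_le hne ?_
    rintro _ ⟨b, hb, rfl⟩
    exact (Metric.mem_ball'.1 (hSsub hb)).le
  have hs0 : 0 < s := by
    obtain ⟨ε, hε, hεS⟩ := Metric.isOpen_iff.1 (Metric.isOpen_ball.preimage f.continuous) x hxS
    obtain ⟨b, hbx, hb⟩ := hX.exists_ne_dist_lt x hε
    exact (dist_pos.2 hbx.symm).trans_le
      (le_csSup hbdd ⟨b, hεS (Metric.mem_ball'.2 hb), rfl⟩)
  obtain ⟨k, hk1, hk2⟩ := exists_scale hq hs0
  have hk : k₀ ≤ k := by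
    by_contra! hlt
    have h1 := two_mul_scale_le hq (k₀ + 1)
    rw [add_sub_cancel_right] at h1
    have h2 := scale_anti hq (show k + 1 ≤ k₀ by omega)
    have h3 := scale_pos hq (k₀ + 1)
    linarith
  obtain ⟨_, ⟨a, ha, rfl⟩, has⟩ := exists_lt_of_lt_csSup hne (show s / 2 < s by linarith)
  have hxa : x ≠ a := by
    rintro rfl
    simp only [dist_self] at has
    linarith
  refine ⟨k, hk, ?_, ?_⟩
  · intro b hb
    exact Metric.mem_ball'.2 ((le_csSup hbdd ⟨b, hb, rfl⟩).trans_lt hk2)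
  · have hsc : scale q k ≤ q ^ 2 * dist x a := by
      have e1 := scale_sub_one hq (k + 1)
      have e2 := scale_sub_one hq (k + 2)
      rw [add_sub_cancel_right] at e1
      rw [show k + 2 - 1 = k + 1 by ring] at e2
      have h1 := two_mul_scale_le hq (k + 2)
      rw [show k + 2 - 1 = k + 1 by ring] at h1
      rw [e1, e2, ← mul_assoc, ← pow_two]
      gcongr
      simp only at has
      linarith
    have himg : f '' sball q k x ⊆ Metric.ball (f x) ((η (q ^ 2) + 1) * ρ) := by
      rintro _ ⟨b, hb, rfl⟩
      rw [Metric.mem_ball'] at hb ⊢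
      have h1 := hη x a b (q ^ 2) (by positivity) hxa (hb.le.trans hsc)
      have h2 : dist (f x) (f a) < ρ := Metric.mem_ball'.1 ha
      calc dist (f x) (f b) ≤ η (q ^ 2) * dist (f x) (f a) := h1
        _ ≤ η (q ^ 2) * ρ := by gcongr
        _ < _ := by linarith [hρ.1]
    rw [map_symm_apply, map_symm_apply, hS, f.image_preimage]
    refine (measure_mono himg).trans ((hD₀ _ _ hρ.1).trans ?_)
    gcongr
    exact le_max_left _ _

end HasControlledDistortion

end Quasisymmetric

/-! ### Precise representatives and their dependence on the almost-everywhere class. -/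

section Representatives

variable {𝕜 X : Type*} [RCLike 𝕜] [MetricSpace X] [MeasurableSpace X] {μ : Measure X}
  {u v : X → 𝕜} {x : X} {a : 𝕜}

lemma AveragesTendTo.preciseRep_eq (h : AveragesTendTo μ u x a) : preciseRep μ u x = a := by
  have hex : ∃ a, AveragesTendTo μ u x a := ⟨a, h⟩
  rw [preciseRep, dif_pos hex]
  exact tendsto_nhds_unique hex.choose_spec h

lemma averagesTendTo_preciseRep (h : x ∉ divergenceSet μ u) :
    AveragesTendTo μ u x (preciseRep μ u x) := by
  obtain ⟨a, ha⟩ := not_not.1 h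
  rwa [ha.preciseRep_eq]

lemma averagesTendTo_congr (h : u =ᵐ[μ] v) : AveragesTendTo μ u = AveragesTendTo μ v := by
  ext x a
  have : ∀ r, ⨍ z in Metric.ball x r, u z ∂μ = ⨍ z in Metric.ball x r, v z ∂μ := fun r =>
    average_congr (ae_restrict_of_ae h)
  simp only [AveragesTendTo, this]

lemma divergenceSet_congr (h : u =ᵐ[μ] v) : divergenceSet μ u = divergenceSet μ v := by
  simp only [divergenceSet, averagesTendTo_congr h]

lemma preciseRep_congr (h : u =ᵐ[μ] v) : preciseRep μ u = preciseRep μ v := by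
  ext x
  by_cases hx : ∃ a, AveragesTendTo μ u x a
  · obtain ⟨a, ha⟩ := hx
    have hb : AveragesTendTo μ v x a := by rwa [← averagesTendTo_congr h]
    rw [ha.preciseRep_eq, hb.preciseRep_eq]
  · have hx' : ¬ ∃ a, AveragesTendTo μ v x a := by rwa [← averagesTendTo_congr h]
    rw [preciseRep, preciseRep, dif_neg hx, dif_neg hx']

lemma energy_congr (p : ℝ) (h : u =ᵐ[μ] v) : energy μ p u = energy μ p v := by
  refine lintegral_congr_ae ?_
  filter_upwards [h] with x hx
  refine lintegral_congr_ae ?_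
  filter_upwards [h] with y hy
  rw [hx, hy]

lemma AveragesTendTo.tendsto_sball {q : ℝ} (hq : 2 ≤ q) (h : AveragesTendTo μ u x a) :
    Tendsto (fun j : ℤ => ⨍ z in sball q j x, u z ∂μ) atTop (𝓝 a) := by
  refine Tendsto.comp (g := fun r => ⨍ z in Metric.ball x r, u z ∂μ) h ?_
  refine tendsto_nhdsWithin_iff.2 ⟨?_, Eventually.of_forall fun j => scale_pos hq j⟩
  have hT : Tendsto (fun j : ℤ => j.toNat) atTop atTop := by
    refine tendsto_atTop.2 fun n => ?_
    filter_upwards [eventually_ge_atTop (n : ℤ)] with j hj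
    omega
  refine ((tendsto_scale hq).comp hT).congr' ?_
  filter_upwards [eventually_ge_atTop (0 : ℤ)] with j hj
  simp only [Function.comp, Int.toNat_of_nonneg hj]

lemma measurable_setAverage_ball [BorelSpace X] [SecondCountableTopology X] (μ : Measure X)
    [SFinite μ] (hu : Measurable u) (r : ℝ) :
    Measurable fun x => ⨍ z in Metric.ball x r, u z ∂μ := by
  simp only [setAverage_eq]
  refine Measurable.smul (measurable_measure_ball μ r).ennreal_toReal.inv ?_
  have h1 : ∀ x, ∫ z in Metric.ball x r, u z ∂μ =
      ∫ z, {b : X × X | dist b.2 b.1 < r}.indicator (fun b => u b.2) (x, z) ∂μ := by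
    intro x
    rw [← integral_indicator measurableSet_ball]
    congr with z
  simp only [h1]
  have hs : MeasurableSet {b : X × X | dist b.2 b.1 < r} :=
    measurableSet_lt (measurable_snd.dist measurable_fst) measurable_const
  exact (((hu.comp measurable_snd).indicator hs).stronglyMeasurable.integral_prod_right').measurable

end Representatives

/-! ### Transport of energies and averages along f. -/

section Transport

variable {𝕜 X Y : Type*} [RCLike 𝕜] [MetricSpace X] [MeasurableSpace X] [BorelSpace X]
  [MetricSpace Y] [MeasurableSpace Y] [BorelSpace Y] {μX : Measure X} {μY : Measure Y}
  {f : X ≃ₜ Y} {u : Y → 𝕜} {q p : ℝ} {D θ : ℝ≥0}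

lemma setAverage_map_symm (f : X ≃ₜ Y) (μY : Measure Y) (u : Y → 𝕜) (B : Set Y) :
    ⨍ x in f ⁻¹' B, u (f x) ∂(μY.map f.symm) = ⨍ y in B, u y ∂μY := by
  have h1 : (μY.map f.symm).real (f ⁻¹' B) = μY.real B := by
    rw [measureReal_def, map_symm_apply, f.image_preimage, measureReal_def]
  have h2 := f.symm.toMeasurableEquiv.measurableEmbedding.setIntegral_map (μ := μY)
    (fun x => u (f x)) (f ⁻¹' B)
  rw [Homeomorph.toMeasurableEquiv_coe] at h2
  have h3 : f.symm ⁻¹' (f ⁻¹' B) = B := by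
    rw [← preimage_comp]; simp
  rw [setAverage_eq, setAverage_eq, h1, h2, h3]
  simp

/-- After the change of variables the kernels are compared pointwise, by the one-sided measure bound
`exists_measure_ball_le_map_symm`. -/
lemma exists_energy_map_symm_le (hf : HasControlledDistortion f) (hY : IsDoubling μY) :
    ∃ C : ℝ≥0, ∀ (p : ℝ) (u : Y → 𝕜), 0 < p →
      energy (μY.map f.symm) p (u ∘ f) ≤ C * energy μY p u := by
  obtain ⟨D, hD0, hD⟩ := hf.exists_measure_ball_le_map_symm hY
  refine ⟨D ^ 2, fun p u hp => ?_⟩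
  have hmap : ∀ g : X → ℝ≥0∞, ∫⁻ x, g x ∂(μY.map f.symm) = ∫⁻ y, g (f.symm y) ∂μY := fun g => by
    have := lintegral_map_equiv (μ := μY) g f.symm.toMeasurableEquiv
    rwa [Homeomorph.toMeasurableEquiv_coe] at this
  have hDt : ((D ^ 2 : ℝ≥0) : ℝ≥0∞) ≠ ∞ := ENNReal.coe_ne_top
  rw [energy, hmap, energy, ← lintegral_const_mul' _ _ hDt]
  refine lintegral_mono fun z => ?_
  rw [hmap, ← lintegral_const_mul' _ _ hDt]
  refine lintegral_mono fun t => ?_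
  rcases eq_or_ne z t with rfl | hzt
  · simp [hp]
  have h1 := hD (f.symm z) (f.symm t) fun h => hzt (f.symm.injective h)
  simp only [Homeomorph.apply_symm_apply] at h1
  have h2 := inv_le_mul_inv_of_le_mul (by exact_mod_cast hD0.ne') ENNReal.coe_ne_top h1
  simp only [Function.comp, Homeomorph.apply_symm_apply]
  rw [ENNReal.coe_pow, ← mul_assoc, ← mul_pow]
  gcongr

lemma averagesTendTo_of_oscSummable (hν : ScaleRegular q D θ (μY.map f.symm))
    (hcomp : ComparableBalls f μY q) (hp : 1 < p)
    (hint : ∀ x r, IntegrableOn (u ∘ f) (Metric.ball x r) (μY.map f.symm)) {x : X}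
    (hx : OscSummable (μY.map f.symm) q p (u ∘ f) x) :
    ∃ a, Tendsto (fun j : ℤ => ⨍ z in sball q j x, (u ∘ f) z ∂(μY.map f.symm)) atTop (𝓝 a) ∧
      AveragesTendTo μY u (f x) a := by
  obtain ⟨a, ha⟩ := hν.exists_tendsto_average hp hint hx
  obtain ⟨K, hK1, hK⟩ := hcomp
  refine ⟨a, ha, ?_⟩
  have h1 := hν.tendsto_setAverage hp hint hx ha (K := K) (by exact_mod_cast hK1)
    ENNReal.coe_ne_top (hK x)
  refine h1.congr fun r => ?_
  exact setAverage_map_symm f μY u (Metric.ball (f x) r)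

/-- The setting of the boundedness of the composition operator: both the measure of the domain and
the pull-back of the measure of the target are regular at the same scales. -/
structure PullbackRegular (μX : Measure X) (μY : Measure Y) (f : X ≃ₜ Y) (q : ℝ) (D θ : ℝ≥0) :
    Prop where
  regular_left : ScaleRegular q D θ μX
  regular_right : ScaleRegular q D θ (μY.map f.symm)
  comparable : ComparableBalls f μY q

namespace PullbackRegular

lemma integrableOn_ball (h : PullbackRegular μX μY f q D θ) (hp : 1 < p) (hu : Measurable u)
    (hfin : energy (μY.map f.symm) p (u ∘ f) ≠ ∞) (x : X) (r : ℝ) :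
    IntegrableOn (u ∘ f) (Metric.ball x r) (μY.map f.symm) :=
  integrableOn_ball_of_energy_ne_top h.regular_right.ball_pos h.regular_right.ball_lt_top hp
    (hu.comp f.continuous.measurable) hfin x r

variable [Nontrivial X]

lemma ae_averagesTendTo (h : PullbackRegular μX μY f q D θ) (hp : 1 < p) (hu : Measurable u)
    (hfin : energy (μY.map f.symm) p (u ∘ f) ≠ ∞) :
    ∀ᵐ x ∂μX, Tendsto (fun j : ℤ => ⨍ z in sball q j x, (u ∘ f) z ∂(μY.map f.symm)) atTop
      (𝓝 (preciseRep μY u (f x))) ∧ f x ∉ divergenceSet μY u := by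
  have := h.regular_left.secondCountableTopology
  have := h.regular_left.isLocallyFiniteMeasure
  have := h.regular_right.isLocallyFiniteMeasure
  filter_upwards [h.regular_left.ae_oscSummable h.regular_right hp
    (hu.comp f.continuous.measurable) hfin] with x hx
  obtain ⟨a, ha, hb⟩ := averagesTendTo_of_oscSummable h.regular_right h.comparable hp
    (h.integrableOn_ball hp hu hfin) hx
  rw [hb.preciseRep_eq]
  exact ⟨ha, fun hd => hd ⟨a, hb⟩⟩

lemma measure_preimage_divergenceSet (h : PullbackRegular μX μY f q D θ) (hp : 1 < p)
    (hu : Measurable u) (hfin : energy (μY.map f.symm) p (u ∘ f) ≠ ∞) :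
    μX (f ⁻¹' divergenceSet μY u) = 0 := by
  have := h.ae_averagesTendTo hp hu hfin
  rw [ae_iff] at this
  refine measure_mono_null (fun x hx => ?_) this
  exact fun hx' => hx'.2 hx

lemma aemeasurable_preciseRep_comp (h : PullbackRegular μX μY f q D θ) (hp : 1 < p)
    (hu : Measurable u) (hfin : energy (μY.map f.symm) p (u ∘ f) ≠ ∞) :
    AEMeasurable (preciseRep μY u ∘ f) μX := by
  have := h.regular_left.secondCountableTopology
  have := h.regular_right.isLocallyFiniteMeasure
  refine aemeasurable_of_tendsto_metrizable_ae' (f := fun (n : ℕ) x =>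
    ⨍ z in sball q n x, (u ∘ f) z ∂(μY.map f.symm)) (fun n =>
    (measurable_setAverage_ball _ (hu.comp f.continuous.measurable) _).aemeasurable) ?_
  filter_upwards [h.ae_averagesTendTo hp hu hfin] with x hx
  exact hx.1.comp tendsto_natCast_atTop_atTop

lemma exists_energy_preciseRep_comp_le (h : PullbackRegular μX μY f q D θ) (hp : 1 < p) :
    ∃ C : ℝ≥0, ∀ u : Y → 𝕜, Measurable u → energy (μY.map f.symm) p (u ∘ f) ≠ ∞ →
      energy μX p (preciseRep μY u ∘ f) ≤ C * energy (μY.map f.symm) p (u ∘ f) := by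
  have := h.regular_left.secondCountableTopology
  have := h.regular_left.isLocallyFiniteMeasure
  have := h.regular_right.isLocallyFiniteMeasure
  obtain ⟨C, hC⟩ := h.regular_left.exists_energy_limit_le h.regular_right (𝕜 := 𝕜) hp
  refine ⟨C, fun u hu hfin => hC _ _ (hu.comp f.continuous.measurable)
    (h.integrableOn_ball hp hu hfin) ?_⟩
  filter_upwards [h.ae_averagesTendTo hp hu hfin] with x hx using hx.1

/-- The averages, with respect to the measure of the domain, of the pull-back of `u` converge to `u`
almost everywhere with respect to the measure of the target. -/
lemma ae_tendsto_average_preciseRep_comp (h : PullbackRegular μX μY f q D θ) (hp : 1 < p)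
    (hu : Measurable u) (hfin : energy (μY.map f.symm) p (u ∘ f) ≠ ∞)
    (hint : ∀ x r, IntegrableOn (preciseRep μY u ∘ f) (Metric.ball x r) μX) :
    ∀ᵐ y ∂μY, Tendsto (fun j : ℤ => ⨍ z in sball q j (f.symm y), (preciseRep μY u ∘ f) z ∂μX)
      atTop (𝓝 (u y)) := by
  have := h.regular_left.secondCountableTopology
  have := h.regular_left.isLocallyFiniteMeasure
  have := h.regular_right.isLocallyFiniteMeasure
  have hw := hu.comp f.continuous.measurable
  have hintw := h.integrableOn_ball hp hu hfin
  have h1 := h.regular_left.ae_tendsto_average_limit h.regular_right hp hw hintw hfin hint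
    (by filter_upwards [h.ae_averagesTendTo hp hu hfin] with x hx using hx.1)
  have h2 := h.regular_right.ae_tendsto_average hp hw hintw hfin
  have h3 := ae_of_ae_map f.symm.continuous.measurable.aemeasurable (h1.and h2)
  filter_upwards [h3] with y hy
  obtain ⟨hy1, hy2⟩ := hy
  simp only [Function.comp_apply, Homeomorph.apply_symm_apply] at hy2
  rw [tendsto_iff_edist_tendsto_0] at hy2 ⊢
  have hsum := hy1.add hy2
  rw [add_zero] at hsum
  exact tendsto_of_tendsto_of_tendsto_of_le_of_le tendsto_const_nhds hsum (fun _ => zero_le)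
    fun j => edist_triangle _ _ _

end PullbackRegular

section SelfMaps

variable [Nontrivial Y]

/-- The identity map is a case of the same setting, so the statements about the precise
representative on Y alone follow from those about pull-backs. -/
lemma ScaleRegular.pullbackRegular_refl (h : ScaleRegular q D θ μY) (hY : IsDoubling μY) {κ : ℝ}
    (hU : IsUniformlyPerfect Y κ) : PullbackRegular μY μY (Homeomorph.refl Y) q D θ where
  regular_left := h
  regular_right := by
    have : μY.map (Homeomorph.refl Y).symm = μY := Measure.map_id
    rwa [this]
  comparable := (hasControlledDistortion_refl Y).exists_sball_comparable hY hU h.two_le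

lemma ScaleRegular.dimH_divergenceSet (h : ScaleRegular q D θ μY) (hY : IsDoubling μY) {κ : ℝ}
    (hU : IsUniformlyPerfect Y κ) (hp : 1 < p) (hu : Measurable u)
    (hfin : energy μY p u ≠ ∞) : dimH (divergenceSet μY u) = 0 := by
  have := h.secondCountableTopology
  have := h.isLocallyFiniteMeasure
  have hr := h.pullbackRegular_refl hY hU
  have e : μY.map (Homeomorph.refl Y).symm = μY := Measure.map_id
  have e' : u ∘ (Homeomorph.refl Y) = u := rfl
  refine le_antisymm (le_trans (dimH_mono fun y hy => ?_)
    (h.dimH_not_oscSummable hp hu hfin).le) zero_le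
  intro hosc
  have hint := hr.integrableOn_ball hp hu (by rw [e, e']; exact hfin)
  obtain ⟨a, -, ha⟩ := averagesTendTo_of_oscSummable hr.regular_right hr.comparable hp hint
    (x := y) (by rw [e, e']; exact hosc)
  exact hy ⟨a, ha⟩

lemma ScaleRegular.preciseRep_ae_eq (h : ScaleRegular q D θ μY) (hY : IsDoubling μY) {κ : ℝ}
    (hU : IsUniformlyPerfect Y κ) (hp : 1 < p) (hu : Measurable u)
    (hfin : energy μY p u ≠ ∞) : preciseRep μY u =ᵐ[μY] u := by
  have := h.secondCountableTopology
  have := h.isLocallyFiniteMeasure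
  have hr := h.pullbackRegular_refl hY hU
  have e : μY.map (Homeomorph.refl Y).symm = μY := Measure.map_id
  have e' : u ∘ (Homeomorph.refl Y) = u := rfl
  have h1 := hr.ae_averagesTendTo hp hu (by rw [e, e']; exact hfin)
  rw [e, e'] at h1
  have hint := integrableOn_ball_of_energy_ne_top h.ball_pos h.ball_lt_top hp hu hfin
  filter_upwards [h1, h.ae_tendsto_average hp hu hint hfin] with y hy1 hy2
  exact tendsto_nhds_unique hy1.1 hy2

end SelfMaps

end Transport

/-! ### The equivalence for spaces described by the energy. -/

section EnergySpaces

/-- A doubling measure with positive and finite values on balls, on a uniformly perfect space. -/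
structure IsDoublingPerfect {X : Type*} [MetricSpace X] [MeasurableSpace X] (μ : Measure X) :
    Prop where
  ball_pos : ∀ (x : X) (r : ℝ), 0 < r → 0 < μ (Metric.ball x r)
  ball_lt_top : ∀ (x : X) (r : ℝ), 0 < r → μ (Metric.ball x r) < ∞
  isDoubling : IsDoubling μ
  exists_isUniformlyPerfect : ∃ κ, IsUniformlyPerfect X κ

/-- The space `F` with the seminorm `N` consists of the measurable functions of finite energy, and
`N` is comparable to the energy seminorm. -/
structure IsEnergySpace {𝕜 X : Type*} [RCLike 𝕜] [MetricSpace X] [MeasurableSpace X]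
    (μ : Measure X) (p : ℝ) (F : Set (X → 𝕜)) (N : (X → 𝕜) → ℝ≥0∞) : Prop where
  mem_iff : ∀ u, u ∈ F ↔ AEMeasurable u μ ∧ energy μ p u ≠ ∞
  exists_le : ∃ c : ℝ≥0, ∀ u, AEMeasurable u μ → N u ≤ c * energy μ p u ^ (1 / p)
  exists_ge : ∃ c : ℝ≥0, ∀ u, AEMeasurable u μ → energy μ p u ^ (1 / p) ≤ c * N u

variable {𝕜 X Y : Type*} [RCLike 𝕜] [MetricSpace X] [MeasurableSpace X] [BorelSpace X]
  [MetricSpace Y] [MeasurableSpace Y] [BorelSpace Y] {μX : Measure X} {μY : Measure Y}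
  {f : X ≃ₜ Y} {p : ℝ} {FX : Set (X → 𝕜)} {NX : (X → 𝕜) → ℝ≥0∞} {FY : Set (Y → 𝕜)}
  {NY : (Y → 𝕜) → ℝ≥0∞}

lemma IsDoublingPerfect.exists_pullbackRegular [Nontrivial X] (hX : IsDoublingPerfect μX)
    (hY : IsDoublingPerfect μY) (hf : HasControlledDistortion f) :
    ∃ (q : ℝ) (D θ : ℝ≥0), PullbackRegular μX μY f q D θ := by
  obtain ⟨κ, hκ⟩ := hX.exists_isUniformlyPerfect
  obtain ⟨q, D, θ, h1, h2⟩ := exists_scaleRegular_pair hκ hX.isDoubling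
    (hf.isDoubling_map_symm hY.isDoubling) hX.ball_pos hX.ball_lt_top
    (map_symm_ball_pos f hY.ball_pos) (hf.map_symm_ball_lt_top hY.ball_lt_top)
  exact ⟨q, D, θ, h1, h2, hf.exists_sball_comparable hY.isDoubling hκ h1.two_le⟩

/-- The energy and the precise representative depend only on the class of u, so u may be replaced by
a measurable w. The bound chains Y-energy, transported energy on X, and μX-energy of the limit. -/
lemma IsEnergySpace.pullbackBounded [Nontrivial X] [Nontrivial Y] (hX : IsDoublingPerfect μX)
    (hY : IsDoublingPerfect μY) (hf : HasControlledDistortion f) (hp : 1 < p)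
    (hFX : IsEnergySpace μX p FX NX) (hFY : IsEnergySpace μY p FY NY) :
    PullbackBounded μX μY f FX NX FY NY := by
  have hp0 : 0 < p := by linarith
  have hp1 : 0 ≤ 1 / p := by positivity
  obtain ⟨q, D, θ, h⟩ := hX.exists_pullbackRegular hY hf
  obtain ⟨κ, hκ⟩ := hY.exists_isUniformlyPerfect
  obtain ⟨D', θ', hreg⟩ := hY.isDoubling.exists_scaleRegular hκ hY.ball_pos hY.ball_lt_top
  obtain ⟨C₁, hC₁⟩ := exists_energy_map_symm_le (𝕜 := 𝕜) hf hY.isDoubling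
  obtain ⟨C₂, hC₂⟩ := h.exists_energy_preciseRep_comp_le (𝕜 := 𝕜) hp
  obtain ⟨cX, hcX⟩ := hFX.exists_le
  obtain ⟨cY, hcY⟩ := hFY.exists_ge
  refine ⟨cX * (C₂ * C₁) ^ (1 / p) * cY, fun u hu => ?_⟩
  obtain ⟨hum, hue⟩ := (hFY.mem_iff u).1 hu
  obtain ⟨w, hw, huw⟩ : ∃ w, Measurable w ∧ u =ᵐ[μY] w := ⟨hum.mk u, hum.measurable_mk, hum.ae_eq_mk⟩
  have hwe : energy μY p w ≠ ∞ := by rwa [← energy_congr p huw]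
  have hwf : energy (μY.map f.symm) p (w ∘ f) ≠ ∞ :=
    ne_top_of_le_ne_top (ENNReal.mul_ne_top ENNReal.coe_ne_top hwe) (hC₁ p w hp0)
  have hv := h.aemeasurable_preciseRep_comp hp hw hwf
  have hle : energy μX p (preciseRep μY w ∘ f) ≤ ((C₂ * C₁ : ℝ≥0) : ℝ≥0∞) * energy μY p u := by
    rw [ENNReal.coe_mul, mul_assoc, energy_congr p huw]
    exact (hC₂ w hw hwf).trans (by gcongr; exact hC₁ p w hp0)
  rw [divergenceSet_congr huw, preciseRep_congr huw]
  refine ⟨fun y r => ?_, hreg.dimH_divergenceSet hY.isDoubling hκ hp hw hwe,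
    h.measure_preimage_divergenceSet hp hw hwf,
    (hreg.preciseRep_ae_eq hY.isDoubling hκ hp hw hwe).trans huw.symm, ?_, ?_⟩
  · exact (integrableOn_ball_of_energy_ne_top hY.ball_pos hY.ball_lt_top hp hw hwe y r).congr
      (ae_restrict_of_ae huw.symm)
  · exact (hFX.mem_iff _).2 ⟨hv, ne_top_of_le_ne_top (ENNReal.mul_ne_top ENNReal.coe_ne_top hue) hle⟩
  · calc NX (preciseRep μY w ∘ f) ≤ cX * energy μX p (preciseRep μY w ∘ f) ^ (1 / p) := hcX _ hv
      _ ≤ cX * (((C₂ * C₁ : ℝ≥0) : ℝ≥0∞) * energy μY p u) ^ (1 / p) := by gcongr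
      _ = cX * ((C₂ * C₁ : ℝ≥0) : ℝ≥0∞) ^ (1 / p) * energy μY p u ^ (1 / p) := by
        rw [ENNReal.mul_rpow_of_nonneg _ _ hp1, mul_assoc]
      _ ≤ cX * ((C₂ * C₁ : ℝ≥0) : ℝ≥0∞) ^ (1 / p) * (cY * NY u) := by gcongr; exact hcY u hum
      _ = _ := by
        push_cast [ENNReal.coe_rpow_of_nonneg _ hp1]
        ring

/-- At almost every y the μX-averages of the pull-back around f⁻¹(y) converge to u(y). Boundedness
for f⁻¹ puts f⁻¹(y) almost surely off the divergence set, so the same averages converge to the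
precise representative. -/
lemma IsEnergySpace.preciseRep_comp_ae_eq [Nontrivial X] (hX : IsDoublingPerfect μX)
    (hY : IsDoublingPerfect μY) (hf : HasControlledDistortion f) (hp : 1 < p)
    (hFY : IsEnergySpace μY p FY NY) (h₁ : PullbackBounded μX μY f FX NX FY NY)
    (h₂ : PullbackBounded μY μX f.symm FY NY FX NX) {u : Y → 𝕜} (hu : u ∈ FY) :
    preciseRep μX (preciseRep μY u ∘ f) ∘ f.symm =ᵐ[μY] u := by
  obtain ⟨q, D, θ, h⟩ := hX.exists_pullbackRegular hY hf
  obtain ⟨C, hC⟩ := exists_energy_map_symm_le (𝕜 := 𝕜) hf hY.isDoubling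
  obtain ⟨_, h₁⟩ := h₁
  obtain ⟨_, h₂⟩ := h₂
  obtain ⟨-, -, -, -, hv, -⟩ := h₁ u hu
  obtain ⟨hint, -, hnull, -⟩ := h₂ _ hv
  obtain ⟨hum, hue⟩ := (hFY.mem_iff u).1 hu
  obtain ⟨w, hw, huw⟩ : ∃ w, Measurable w ∧ u =ᵐ[μY] w := ⟨hum.mk u, hum.measurable_mk, hum.ae_eq_mk⟩
  rw [energy_congr p huw] at hue
  rw [preciseRep_congr huw] at hint hnull ⊢
  have hwf : energy (μY.map f.symm) p (w ∘ f) ≠ ∞ :=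
    ne_top_of_le_ne_top (ENNReal.mul_ne_top ENNReal.coe_ne_top hue) (hC p w (by linarith))
  filter_upwards [huw, h.ae_tendsto_average_preciseRep_comp hp hw hwf hint,
    measure_eq_zero_iff_ae_notMem.1 hnull] with y hy1 hy2 hy3
  rw [hy1]
  exact tendsto_nhds_unique
    ((averagesTendTo_preciseRep hy3).tendsto_sball h.regular_left.two_le) hy2

theorem IsEnergySpace.inducesEquivalence [Nontrivial X] [Nontrivial Y]
    (hX : IsDoublingPerfect μX) (hY : IsDoublingPerfect μY) (hf : HasControlledDistortion f)
    (hf' : HasControlledDistortion f.symm) (hp : 1 < p)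
    (hFX : IsEnergySpace μX p FX NX) (hFY : IsEnergySpace μY p FY NY) :
    InducesEquivalence μX μY f FX NX FY NY := by
  have h₁ := hFX.pullbackBounded hX hY hf hp hFY
  have h₂ := hFY.pullbackBounded hY hX hf' hp hFX
  exact ⟨h₁, h₂, fun u hu => hFY.preciseRep_comp_ae_eq hX hY hf hp h₁ h₂ hu,
    fun v hv => hFX.preciseRep_comp_ae_eq hY hX hf' hp h₂ h₁ hv⟩

end EnergySpaces

/-! ### The Bourdon–Pajot space as an energy space. -/

section BesovSpace

lemma LpLqNorm_ofReal {X : Type*} [MeasurableSpace X] {μ : Measure X} {p : ℝ} (hp : 0 < p) (g : ℤ → X → ℝ≥0∞) :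
    LpLqNorm μ p (ENNReal.ofReal p) g = (∫⁻ x, ∑' k, g k x ^ p ∂μ) ^ (1 / p) := by
  simp only [LpLqNorm, lqNorm, ENNReal.ofReal_ne_top, if_false, ENNReal.toReal_ofReal hp.le]
  congr 2 with x
  rw [← ENNReal.rpow_mul, one_div_mul_cancel hp.ne', ENNReal.rpow_one]

variable {𝕜 X : Type*} [RCLike 𝕜] [MetricSpace X] [MeasurableSpace X] {μ : Measure X}
  {n s p : ℝ} {u : X → 𝕜}

lemma IsAhlforsRegular.isDoublingPerfect [BorelSpace X] [Nontrivial X] (h : IsAhlforsRegular μ n) (hn : 0 < n) :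
    IsDoublingPerfect μ :=
  ⟨h.ball_pos, h.ball_lt_top, h.isDoubling hn, h.exists_isUniformlyPerfect hn⟩

lemma lintegral_lintegral_le_of_le_const_mul {X : Type*} [MeasurableSpace X] {μ : Measure X}
    {F G : X → X → ℝ≥0∞} (c : ℝ≥0)
    (h : ∀ x y, F x y ≤ c * G x y) :
    ∫⁻ x, ∫⁻ y, F x y ∂μ ∂μ ≤ c * ∫⁻ x, ∫⁻ y, G x y ∂μ ∂μ := by
  rw [← lintegral_const_mul' _ _ ENNReal.coe_ne_top]
  refine lintegral_mono fun x => ?_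
  rw [← lintegral_const_mul' _ _ ENNReal.coe_ne_top]
  exact lintegral_mono fun y => h x y

lemma rpow_one_div_le_of_le_mul (hp : 0 < p) {c : ℝ≥0} {a b : ℝ≥0∞} (h : a ≤ c * b) :
    a ^ (1 / p) ≤ ((c ^ (1 / p) : ℝ≥0) : ℝ≥0∞) * b ^ (1 / p) := by
  have hp1 : 0 ≤ 1 / p := by positivity
  rw [ENNReal.coe_rpow_of_nonneg _ hp1, ← ENNReal.mul_rpow_of_nonneg _ _ hp1]
  gcongr

lemma energy_ne_top_iff_of_le (hp : 0 < p) {N : ℝ≥0∞} {c c' : ℝ≥0}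
    (h : N ≤ c * energy μ p u ^ (1 / p)) (h' : energy μ p u ^ (1 / p) ≤ c' * N) :
    energy μ p u ≠ ∞ ↔ N < ∞ := by
  have hp1 : 0 ≤ 1 / p := by positivity
  constructor
  · intro he
    exact h.trans_lt (ENNReal.mul_lt_top ENNReal.coe_lt_top
      (ENNReal.rpow_lt_top_of_nonneg hp1 he))
  · intro hN he
    rw [he, ENNReal.top_rpow_of_pos (by positivity), top_le_iff] at h'
    exact ENNReal.mul_ne_top ENNReal.coe_ne_top hN.ne h'

lemma aemeasurable_of_forall_ball [BorelSpace X] [Nonempty X]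
    (h : ∀ (x : X) (r : ℝ), AEMeasurable u (μ.restrict (Metric.ball x r))) : AEMeasurable u μ := by
  obtain ⟨x⟩ := ‹Nonempty X›
  rw [← Measure.restrict_univ (μ := μ), ← Metric.iUnion_ball_nat x]
  exact AEMeasurable.iUnion fun k => h x k

/-- Since s (n/s) = n, the two kernels differ by the bounded ratio of d(x,y)ⁿ to μ(B(x,d(x,y))). The
condition of p-integrability on balls follows from measurability and finite energy. -/
theorem IsAhlforsRegular.isEnergySpace_besovSpace [BorelSpace X] [Nontrivial X]
    (h : IsAhlforsRegular μ n) (hs : s ∈ Ioo 0 n) :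
    IsEnergySpace μ (n / s) (besovSpace 𝕜 μ s (n / s)) (besovNorm μ s (n / s)) := by
  have hs0 := hs.1
  have hn : 0 < n := hs.1.trans hs.2
  have hsp : s * (n / s) = n := by field_simp
  have hp : 1 < n / s := (one_lt_div hs.1).2 hs.2
  obtain ⟨p, hpe⟩ : ∃ p, p = n / s := ⟨_, rfl⟩
  rw [← hpe] at hsp hp ⊢
  have hp0 : 0 < p := by linarith
  obtain ⟨c, hc0, hc⟩ := h.exists_edist_rpow_comparable hn
  have hc0' : (c : ℝ≥0∞) ≠ 0 := by exact_mod_cast hc0.ne'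
  have hball : ∀ x y : X, x ≠ y → μ (Metric.ball x (dist x y)) ≠ 0 ∧
      μ (Metric.ball x (dist x y)) ≠ ∞ := fun x y hxy =>
    ⟨(h.ball_pos x _ (dist_pos.2 hxy)).ne', (h.ball_lt_top x _ (dist_pos.2 hxy)).ne⟩
  have h1 : ∀ u : X → 𝕜,
      besovNorm μ s p u ≤ ((c ^ (1 / p) : ℝ≥0) : ℝ≥0∞) * energy μ p u ^ (1 / p) := by
    intro u
    refine rpow_one_div_le_of_le_mul hp0 (lintegral_lintegral_le_of_le_const_mul c fun x y => ?_)
    rcases eq_or_ne x y with rfl | hxy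
    · simp [hp0]
    obtain ⟨hb0, hbt⟩ := hball x y hxy
    rw [hsp, ENNReal.div_eq_inv_mul, ENNReal.mul_inv (Or.inr hbt) (Or.inr hb0), sq, ← mul_assoc,
      ← mul_assoc]
    gcongr
    exact inv_le_mul_inv_of_le_mul hc0' ENNReal.coe_ne_top (hc x y hxy).2
  have h2 : ∀ u : X → 𝕜,
      energy μ p u ^ (1 / p) ≤ ((c ^ (1 / p) : ℝ≥0) : ℝ≥0∞) * besovNorm μ s p u := by
    intro u
    refine rpow_one_div_le_of_le_mul hp0 (lintegral_lintegral_le_of_le_const_mul c fun x y => ?_)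
    rcases eq_or_ne x y with rfl | hxy
    · simp [hp0]
    obtain ⟨hb0, hbt⟩ := hball x y hxy
    rw [hsp, ENNReal.div_eq_inv_mul, ENNReal.mul_inv (Or.inr hbt) (Or.inr hb0), sq, ← mul_assoc,
      ← mul_assoc]
    gcongr
    exact inv_le_mul_inv_of_le_mul hc0' ENNReal.coe_ne_top (hc x y hxy).1
  refine ⟨fun u => ?_, ⟨_, fun u _ => h1 u⟩, ⟨_, fun u _ => h2 u⟩⟩
  rw [besovSpace, mem_ofPred_eq, energy_ne_top_iff_of_le hp0 (h1 u) (h2 u)]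
  refine ⟨fun hu => ⟨aemeasurable_of_forall_ball fun x r =>
    (hu.1 x r).aestronglyMeasurable.aemeasurable, hu.2⟩, fun hu => ⟨fun x r => ?_, hu.2⟩⟩
  have hue := (energy_ne_top_iff_of_le hp0 (h1 u) (h2 u)).2 hu.2
  rw [energy_congr p hu.1.ae_eq_mk] at hue
  exact (memLp_congr_ae (ae_restrict_of_ae hu.1.ae_eq_mk)).2
    (memLp_ball_of_energy_ne_top h.ball_pos h.ball_lt_top hp hu.1.measurable_mk hue x r)

end BesovSpace

/-! ### The energy is bounded by any Hajłasz gradient. -/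

section GradientUpperBound

variable {𝕜 X : Type*} [RCLike 𝕜] [MetricSpace X] [MeasurableSpace X]
  {μ : Measure X} {n s p : ℝ} {u : X → 𝕜}

/-- The hypotheses on a measure under which Hajłasz gradients are compared with energies. -/
structure IsRegularMeasure (μ : Measure X) (n : ℝ) (D c : ℝ≥0) : Prop where
  ball_pos : ∀ (x : X) (r : ℝ), 0 < r → 0 < μ (Metric.ball x r)
  ball_lt_top : ∀ (x : X) (r : ℝ), 0 < r → μ (Metric.ball x r) < ∞
  doubling : ∀ (x : X) (r : ℝ), 0 < r → μ (Metric.ball x (2 * r)) ≤ D * μ (Metric.ball x r)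
  one_le : 1 ≤ D
  comparable_pos : 0 < c
  comparable : ∀ x y : X, x ≠ y → edist x y ^ n ≤ c * μ (Metric.ball x (dist x y)) ∧
    μ (Metric.ball x (dist x y)) ≤ c * edist x y ^ n

lemma IsAhlforsRegular.exists_isRegularMeasure [BorelSpace X] [Nontrivial X] (h : IsAhlforsRegular μ n)
    (hn : 0 < n) : ∃ D c : ℝ≥0, IsRegularMeasure μ n D c := by
  obtain ⟨c, hc0, hc⟩ := h.exists_edist_rpow_comparable hn
  obtain ⟨D, hD⟩ := h.isDoubling hn 2
  refine ⟨max D 1, c, h.ball_pos, h.ball_lt_top, fun x r hr => (hD x r hr).trans ?_,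
    le_max_right _ _, hc0, hc⟩
  gcongr
  exact le_max_left _ _

namespace IsRegularMeasure

variable {D c : ℝ≥0}

lemma coe_ne_zero (h : IsRegularMeasure μ n D c) : (D : ℝ≥0∞) ≠ 0 := by
  exact_mod_cast (zero_lt_one.trans_le h.one_le).ne'

lemma inv_le_of_ball_subset (h : IsRegularMeasure μ n D c) {x y : X} {r : ℝ} (hr : 0 < r)
    (hxy : Metric.ball y r ⊆ Metric.ball x (2 * r)) :
    (μ (Metric.ball x r))⁻¹ ≤ D * (μ (Metric.ball y r))⁻¹ :=
  inv_le_mul_inv_of_le_mul (h.coe_ne_zero) ENNReal.coe_ne_top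
    ((measure_mono hxy).trans (h.doubling x r hr))

/-- Only the dyadic index of d(x,y) is used. The gradient inequality produces d(x,y)ⁿ, which cancels
one of the two factors μ(B)⁻¹; doubling adjusts the other. -/
lemma enorm_sub_rpow_le_tsum (h : IsRegularMeasure μ n D c) (hp : 1 < p) (hsp : s * p = n)
    {g : ℤ → X → ℝ≥0∞} {x y : X} (hxy : x ≠ y)
    (hg : ∀ k : ℤ, (2 : ℝ) ^ (-k - 1) ≤ dist x y → dist x y < (2 : ℝ) ^ (-k) →
      ‖u x - u y‖ₑ ≤ edist x y ^ s * (g k x + g k y)) :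
    (μ (Metric.ball x (dist x y)))⁻¹ ^ 2 * ‖u x - u y‖ₑ ^ p ≤ c * D * 2 ^ (p - 1) *
      ∑' k : ℤ, (μ (sball 2 k x))⁻¹ * (sball 2 k x).indicator (fun y => g k x ^ p + g k y ^ p) y := by
  have hp0 : 0 < p := by linarith
  have hd : 0 < dist x y := dist_pos.2 hxy
  obtain ⟨k, hk1, hk2⟩ := exists_scale (le_refl (2 : ℝ)) hd
  have hk3 : scale 2 k = 2 * scale 2 (k + 1) := by
    have := scale_sub_one (le_refl (2 : ℝ)) (k + 1)
    rwa [add_sub_cancel_right] at this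
  have hb0 := (h.ball_pos x _ hd).ne'
  have hbt := (h.ball_lt_top x _ hd).ne
  have hu : ‖u x - u y‖ₑ ^ p ≤
      c * μ (Metric.ball x (dist x y)) * (2 ^ (p - 1) * (g k x ^ p + g k y ^ p)) := by
    calc ‖u x - u y‖ₑ ^ p ≤ (edist x y ^ s * (g k x + g k y)) ^ p := by
          refine ENNReal.rpow_le_rpow (hg k ?_ hk2) hp0.le
          have : -k - 1 = -(k + 1) := by ring
          rw [this]; exact hk1
      _ = edist x y ^ n * (g k x + g k y) ^ p := by
          rw [ENNReal.mul_rpow_of_nonneg _ _ hp0.le, ← ENNReal.rpow_mul, hsp]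
      _ ≤ _ := by
          gcongr
          · exact (h.comparable x y hxy).1
          · exact ENNReal.rpow_add_le_mul_rpow_add_rpow _ _ hp.le
  have hinv : (μ (Metric.ball x (dist x y)))⁻¹ ≤ D * (μ (sball 2 k x))⁻¹ := by
    refine inv_le_mul_inv_of_le_mul (h.coe_ne_zero) ENNReal.coe_ne_top
      (le_trans (measure_mono (Metric.ball_subset_ball ?_)) (h.doubling x _ hd))
    linarith
  calc (μ (Metric.ball x (dist x y)))⁻¹ ^ 2 * ‖u x - u y‖ₑ ^ p
      ≤ (μ (Metric.ball x (dist x y)))⁻¹ ^ 2 *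
        (c * μ (Metric.ball x (dist x y)) * (2 ^ (p - 1) * (g k x ^ p + g k y ^ p))) := by gcongr
    _ = ((μ (Metric.ball x (dist x y)))⁻¹ * μ (Metric.ball x (dist x y))) *
        ((μ (Metric.ball x (dist x y)))⁻¹ * (c * (2 ^ (p - 1) * (g k x ^ p + g k y ^ p)))) := by ring
    _ ≤ D * (μ (sball 2 k x))⁻¹ * (c * (2 ^ (p - 1) * (g k x ^ p + g k y ^ p))) := by
        rw [ENNReal.inv_mul_cancel hb0 hbt, one_mul]
        gcongr
    _ = c * D * 2 ^ (p - 1) * ((μ (sball 2 k x))⁻¹ *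
        (sball 2 k x).indicator (fun y => g k x ^ p + g k y ^ p) y) := by
        rw [indicator_of_mem (by rwa [Metric.mem_ball, dist_comm])]
        ring
    _ ≤ _ := by
        gcongr
        exact ENNReal.le_tsum k

lemma energy_le_of_gradient [BorelSpace X] [SecondCountableTopology X] [SFinite μ]
    (h : IsRegularMeasure μ n D c) (hp : 1 < p) (hsp : s * p = n)
    {g : ℤ → X → ℝ≥0∞} (hg : IsFracHajlaszGradient μ s u g) :
    energy μ p u ≤ c * D * 2 ^ (p - 1) * (1 + D) * ∫⁻ x, ∑' k, g k x ^ p ∂μ := by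
  obtain ⟨hgm, E, hE0, hE⟩ := hg
  have hp0 : 0 < p := by linarith
  have hCt : (c * D * 2 ^ (p - 1) : ℝ≥0∞) ≠ ∞ :=
    ENNReal.mul_ne_top (ENNReal.mul_ne_top ENNReal.coe_ne_top ENNReal.coe_ne_top)
      (ENNReal.rpow_ne_top_of_nonneg (by linarith) ENNReal.ofNat_ne_top)
  obtain ⟨C, hC⟩ : ∃ C : ℝ≥0∞, C = c * D * 2 ^ (p - 1) := ⟨_, rfl⟩
  have hpt := fun {x y} hxy hg => h.enorm_sub_rpow_le_tsum (u := u) hp hsp (g := g) (x := x) (y := y)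
    hxy hg
  rw [← hC] at hCt ⊢
  simp only [← hC] at hpt
  choose G hG hgG using fun k => hgm k
  have hgG' : ∀ᵐ x ∂μ, ∀ k, g k x = G k x := ae_all_iff.2 hgG
  have hEae : ∀ᵐ x ∂μ, x ∉ E := measure_eq_zero_iff_ae_notMem.1 hE0
  have hGp : ∀ k, Measurable fun x => G k x ^ p := fun k => (hG k).pow_const p
  have hpos : ∀ (k : ℤ) x, μ (sball 2 k x) ≠ 0 := fun k x => (h.ball_pos x _ (scale_pos le_rfl k)).ne'
  have hfin : ∀ (k : ℤ) x, μ (sball 2 k x) ≠ ∞ := fun k x =>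
    (h.ball_lt_top x _ (scale_pos le_rfl k)).ne
  calc energy μ p u
      ≤ ∫⁻ x, ∫⁻ y, C * ∑' k : ℤ, (μ (sball 2 k x))⁻¹ *
        (sball 2 k x).indicator (fun y => G k x ^ p + G k y ^ p) y ∂μ ∂μ := by
        refine lintegral_mono_ae ?_
        filter_upwards [hgG', hEae] with x hx hxE
        refine lintegral_mono_ae ?_
        filter_upwards [hgG', hEae] with y hy hyE
        rcases eq_or_ne x y with rfl | hxy
        · simp [hp0]
        refine (hpt hxy fun k => hE k x y hxE hyE).trans_eq ?_
        congr 2 with k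
        simp only [indicator, hx, hy]
    _ = ∫⁻ x, C * ∑' k : ℤ, (G k x ^ p + (μ (sball 2 k x))⁻¹ * ∫⁻ y in sball 2 k x, G k y ^ p ∂μ) ∂μ := by
        congr with x
        have hm : ∀ k : ℤ, Measurable fun y =>
            (sball 2 k x).indicator (fun y => G k x ^ p + G k y ^ p) y := fun k =>
          (measurable_const.add (hGp k)).indicator measurableSet_ball
        rw [lintegral_const_mul' _ _ hCt, lintegral_tsum fun k => ((hm k).const_mul _).aemeasurable]
        congr 2 with k
        rw [lintegral_const_mul _ (hm k),
          lintegral_indicator measurableSet_ball, lintegral_add_left measurable_const,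
          setLIntegral_const, mul_add, mul_left_comm, ENNReal.inv_mul_cancel (hpos k x) (hfin k x),
          mul_one]
    _ = C * ∑' k : ℤ, (∫⁻ x, G k x ^ p ∂μ +
        ∫⁻ x, (μ (sball 2 k x))⁻¹ * ∫⁻ y in sball 2 k x, G k y ^ p ∂μ ∂μ) := by
        have hm : ∀ k : ℤ, Measurable fun x =>
            (μ (sball 2 k x))⁻¹ * ∫⁻ y in sball 2 k x, G k y ^ p ∂μ := fun k =>
          (measurable_measure_ball μ _).inv.mul (measurable_setLIntegral_ball μ measurable_id
            (G := fun _ y => G k y ^ p) ((hGp k).comp measurable_snd) _)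
        have hm' : ∀ k : ℤ, Measurable fun x => G k x ^ p +
            (μ (sball 2 k x))⁻¹ * ∫⁻ y in sball 2 k x, G k y ^ p ∂μ := fun k => (hGp k).add (hm k)
        rw [lintegral_const_mul' _ _ hCt, lintegral_tsum fun k => (hm' k).aemeasurable]
        congr 2 with k
        rw [lintegral_add_left (hGp k)]
    _ ≤ C * ∑' k : ℤ, ((1 + D) * ∫⁻ x, G k x ^ p ∂μ) := by
        gcongr with k
        rw [add_mul, one_mul]
        gcongr
        refine lintegral_inv_measure_ball_mul_setLIntegral_le (hpos k) (hfin k) (fun x z hxz => ?_)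
          μ (hGp k)
        refine h.inv_le_of_ball_subset (scale_pos le_rfl k) (Metric.ball_subset_ball' ?_)
        rw [dist_comm]; linarith
    _ = C * (1 + D) * ∫⁻ x, ∑' k, g k x ^ p ∂μ := by
        rw [ENNReal.tsum_mul_left, mul_assoc, ← lintegral_tsum fun k => (hGp k).aemeasurable]
        congr 2
        refine lintegral_congr_ae ?_
        filter_upwards [hgG'] with x hx
        simp only [hx]

end IsRegularMeasure

end GradientUpperBound

/-! ### A Hajłasz gradient built from mean oscillations. -/

section GradientConstruction

section Weights

lemma ofReal_scale_two_rpow (k : ℤ) (n : ℝ) :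
    ENNReal.ofReal (scale 2 k) ^ n = (2 : ℝ≥0∞) ^ (-(k : ℝ) * n) := by
  have h1 : ENNReal.ofReal (scale 2 k) = (2 : ℝ≥0∞) ^ (-(k : ℝ)) := by
    rw [scale, ← Real.rpow_intCast, ← ENNReal.ofReal_rpow_of_pos two_pos, ENNReal.ofReal_ofNat]
    push_cast
    rfl
  rw [h1, ← ENNReal.rpow_mul]

lemma two_rpow_add (a b : ℝ) : (2 : ℝ≥0∞) ^ (a + b) = 2 ^ a * 2 ^ b :=
  ENNReal.rpow_add _ _ two_ne_zero ENNReal.ofNat_ne_top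

lemma one_le_edist_rpow_mul {X : Type*} [MetricSpace X] {n : ℝ} (hn : 0 < n) {x y : X} {k : ℤ}
    (h : scale 2 (k + 1) ≤ dist x y) : 1 ≤ edist x y ^ n * (2 : ℝ≥0∞) ^ (((k : ℝ) + 1) * n) := by
  calc (1 : ℝ≥0∞) = ENNReal.ofReal (scale 2 (k + 1)) ^ n * (2 : ℝ≥0∞) ^ (((k : ℝ) + 1) * n) := by
        rw [ofReal_scale_two_rpow, ← two_rpow_add]
        push_cast
        rw [neg_mul, neg_add_cancel, ENNReal.rpow_zero]
    _ ≤ _ := by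
        rw [edist_dist]
        gcongr

open Classical in
-- A geometric series dominated by its term of smallest radius. The weights are exact powers of 2,
-- so scales beyond the diameter need not be cut off.
lemma exists_tsum_two_rpow_le {n : ℝ} (hn : 0 < n) : ∃ K : ℝ≥0, ∀ {X : Type*} [MetricSpace X]
    {x z : X}, x ≠ z → ∑' k : ℤ, (if dist z x < scale 2 (k - 1) then
      (2 : ℝ≥0∞) ^ (((k : ℝ) + 1) * n) else 0) ≤ K * (edist x z ^ n)⁻¹ := by
  have hlt : (2 : ℝ≥0∞) ^ (-n) < 1 := ENNReal.rpow_lt_one_of_one_lt_of_neg (by norm_num) (by linarith)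
  have hKt : (2 : ℝ≥0∞) ^ (2 * n) * (1 - (2 : ℝ≥0∞) ^ (-n))⁻¹ ≠ ∞ :=
    ENNReal.mul_ne_top (ENNReal.rpow_ne_top_of_nonneg (by linarith) ENNReal.ofNat_ne_top)
      (ENNReal.inv_ne_top.2 (tsub_pos_of_lt hlt).ne')
  refine ⟨((2 : ℝ≥0∞) ^ (2 * n) * (1 - (2 : ℝ≥0∞) ^ (-n))⁻¹).toNNReal, fun {X} _ {x z} hxz => ?_⟩
  rw [ENNReal.coe_toNNReal hKt]
  obtain ⟨m, hm1, hm2⟩ := exists_scale (le_refl (2 : ℝ)) (dist_pos.2 hxz)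
  rw [tsum_int_eq_tsum_nat (m + 1)]
  swap
  · intro k hk
    rw [if_neg]
    rw [not_lt, dist_comm]
    exact (scale_anti le_rfl (by omega)).trans hm1
  have hinv : (2 : ℝ≥0∞) ^ ((m : ℝ) * n) ≤ (edist x z ^ n)⁻¹ := by
    rw [ENNReal.le_inv_iff_le_inv, ← ENNReal.rpow_neg, ← neg_mul, ← ofReal_scale_two_rpow, edist_dist]
    gcongr
  calc ∑' i : ℕ, (if dist z x < scale 2 (m + 1 - i - 1) then
        (2 : ℝ≥0∞) ^ ((((m + 1 - i : ℤ) : ℝ) + 1) * n) else 0)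
      ≤ ∑' i : ℕ, (2 : ℝ≥0∞) ^ ((m : ℝ) * n) * 2 ^ (2 * n) * ((2 : ℝ≥0∞) ^ (-n)) ^ i := by
        gcongr with i
        split_ifs
        · rw [← ENNReal.rpow_natCast, ← ENNReal.rpow_mul, ← two_rpow_add, ← two_rpow_add]
          refine le_of_eq ?_
          congr 1
          push_cast
          ring
        · exact zero_le
    _ = (2 : ℝ≥0∞) ^ (2 * n) * (1 - (2 : ℝ≥0∞) ^ (-n))⁻¹ * 2 ^ ((m : ℝ) * n) := by
        rw [ENNReal.tsum_mul_left, ENNReal.tsum_geometric]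
        ring
    _ ≤ _ := by gcongr

end Weights

variable {𝕜 X : Type*} [RCLike 𝕜] [MetricSpace X] [MeasurableSpace X]
  {μ : Measure X} {n s p : ℝ} {u w : X → 𝕜}

/-- The average of `|w x - w z| ^ p` over the ball `B(x, 2 ^ (1 - k))`. -/
def oscAverage (μ : Measure X) (p : ℝ) (w : X → 𝕜) (k : ℤ) (x : X) : ℝ≥0∞ :=
  (μ (sball 2 (k - 1) x))⁻¹ * ∫⁻ z in sball 2 (k - 1) x, ‖w x - w z‖ₑ ^ p ∂μ

lemma measurable_oscAverage [BorelSpace X] [SecondCountableTopology X] [SFinite μ]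
    (hw : Measurable w) (k : ℤ) : Measurable (oscAverage μ p w k) :=
  (measurable_measure_ball μ _).inv.mul
    (measurable_setLIntegral_ball μ measurable_id (measurable_enorm_sub_rpow hw p) _)

namespace IsRegularMeasure

variable {D c : ℝ≥0}

/-- Insert w(z) and average over z in B(x,2⁻ᵏ), a ball contained in the balls of twice the radius
about both x and y. -/
lemma enorm_sub_rpow_le_oscAverage [BorelSpace X] (h : IsRegularMeasure μ n D c) (hp : 1 < p)
    (hw : Measurable w) {x y : X} {k : ℤ}
    (hxy : dist x y < scale 2 k) :
    ‖w x - w y‖ₑ ^ p ≤ 2 ^ (p - 1) * D ^ 2 * (oscAverage μ p w k x + oscAverage μ p w k y) := by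
  have hr := scale_pos (le_refl (2 : ℝ)) k
  have hr2 : scale 2 (k - 1) = 2 * scale 2 k := scale_sub_one le_rfl k
  have hb0 := (h.ball_pos x _ hr).ne'
  have hbt := (h.ball_lt_top x _ hr).ne
  have hCt : (2 : ℝ≥0∞) ^ (p - 1) ≠ ∞ :=
    ENNReal.rpow_ne_top_of_nonneg (by linarith) ENNReal.ofNat_ne_top
  have hD1 : (1 : ℝ≥0∞) ≤ D := by exact_mod_cast h.one_le
  have hD2 : (D : ℝ≥0∞) ^ 2 ≠ 0 := pow_ne_zero 2 h.coe_ne_zero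
  have hD2t : (D : ℝ≥0∞) ^ 2 ≠ ∞ := ENNReal.pow_ne_top ENNReal.coe_ne_top
  have h1 : (μ (sball 2 k x))⁻¹ ≤ D ^ 2 * (μ (sball 2 (k - 1) x))⁻¹ := by
    refine inv_le_mul_inv_of_le_mul hD2 hD2t ?_
    rw [sball, hr2]
    refine (h.doubling x _ hr).trans ?_
    gcongr
    exact le_self_pow hD1 two_ne_zero
  have h2 : (μ (sball 2 k x))⁻¹ ≤ D ^ 2 * (μ (sball 2 (k - 1) y))⁻¹ := by
    refine inv_le_mul_inv_of_le_mul hD2 hD2t ?_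
    rw [sball, hr2]
    calc μ (Metric.ball y (2 * scale 2 k)) ≤ μ (Metric.ball x (2 * (2 * scale 2 k))) := by
          refine measure_mono (Metric.ball_subset_ball' ?_)
          rw [dist_comm]; linarith
      _ ≤ D * (D * μ (Metric.ball x (scale 2 k))) := by
          refine (h.doubling x _ (by positivity)).trans ?_
          gcongr
          exact h.doubling x _ hr
      _ = _ := by ring
  have hm : ∀ a, Measurable fun z => ‖w a - w z‖ₑ ^ p := fun a =>
    (measurable_enorm_sub_rpow hw p).comp measurable_prodMk_left
  have hx : sball 2 k x ⊆ sball 2 (k - 1) x := sball_anti le_rfl (by omega) x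
  have hy : sball 2 k x ⊆ sball 2 (k - 1) y := sball_subset_of_dist le_rfl hxy
  calc ‖w x - w y‖ₑ ^ p
      = (μ (sball 2 k x))⁻¹ * ∫⁻ _ in sball 2 k x, ‖w x - w y‖ₑ ^ p ∂μ := by
        rw [setLIntegral_const, mul_left_comm, ENNReal.inv_mul_cancel hb0 hbt, mul_one]
    _ ≤ (μ (sball 2 k x))⁻¹ *
        ∫⁻ z in sball 2 k x, 2 ^ (p - 1) * (‖w x - w z‖ₑ ^ p + ‖w y - w z‖ₑ ^ p) ∂μ := by
        gcongr with z
        exact enorm_sub_rpow_le hp _ _ _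
    _ = 2 ^ (p - 1) * ((μ (sball 2 k x))⁻¹ * ∫⁻ z in sball 2 k x, ‖w x - w z‖ₑ ^ p ∂μ +
        (μ (sball 2 k x))⁻¹ * ∫⁻ z in sball 2 k x, ‖w y - w z‖ₑ ^ p ∂μ) := by
        rw [lintegral_const_mul' _ _ hCt, lintegral_add_left (hm x)]
        ring
    _ ≤ 2 ^ (p - 1) * (D ^ 2 * (μ (sball 2 (k - 1) x))⁻¹ *
          ∫⁻ z in sball 2 (k - 1) x, ‖w x - w z‖ₑ ^ p ∂μ +
        D ^ 2 * (μ (sball 2 (k - 1) y))⁻¹ *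
          ∫⁻ z in sball 2 (k - 1) y, ‖w y - w z‖ₑ ^ p ∂μ) := by gcongr
    _ = _ := by
        simp only [oscAverage]
        ring

/-- The gradient is the p-th root of a constant times 2^((k+1)n) `oscAverage`. The weight
compensates d(x,y)ⁿ ≥ 2^(-(k+1)n), and subadditivity of t^(1/p) separates x from y. -/
lemma hajlaszNorm_le [BorelSpace X] [SecondCountableTopology X] [SFinite μ]
    (h : IsRegularMeasure μ n D c) (hn : 0 < n) (hp : 1 < p) (hsp : s * p = n)
    (hw : Measurable w) (huw : u =ᵐ[μ] w) :
    hajlaszNorm μ s p (ENNReal.ofReal p) u ≤ (2 ^ (p - 1) * D ^ 2 *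
      ∫⁻ x, ∑' k : ℤ, (2 : ℝ≥0∞) ^ (((k : ℝ) + 1) * n) * oscAverage μ p w k x ∂μ) ^ (1 / p) := by
  have hp0 : 0 < p := by linarith
  have hp1 : 0 ≤ 1 / p := by positivity
  have hC : (2 : ℝ≥0∞) ^ (p - 1) * D ^ 2 ≠ ∞ :=
    ENNReal.mul_ne_top (ENNReal.rpow_ne_top_of_nonneg (by linarith) ENNReal.ofNat_ne_top)
      (ENNReal.pow_ne_top ENNReal.coe_ne_top)
  obtain ⟨G, hG⟩ : ∃ G : ℤ → X → ℝ≥0∞, G = fun (k : ℤ) x => 2 ^ (p - 1) * D ^ 2 *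
    ((2 : ℝ≥0∞) ^ (((k : ℝ) + 1) * n) * oscAverage μ p w k x) := ⟨_, rfl⟩
  have hGm : ∀ k, Measurable (G k) := fun k => by
    rw [hG]; exact ((measurable_oscAverage hw k).const_mul _).const_mul _
  have hgrad : IsFracHajlaszGradient μ s u fun k x => G k x ^ (1 / p) := by
    refine ⟨fun k => ((hGm k).pow_const _).aemeasurable, {x | u x ≠ w x}, huw,
      fun k x y hx hy hk1 hk2 => ?_⟩
    rw [mem_ofPred_eq, not_not] at hx hy
    have h1 : scale 2 (k + 1) ≤ dist x y := by
      rw [scale, neg_add, ← sub_eq_add_neg]; exact hk1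
    have h2 := one_le_edist_rpow_mul hn h1
    have h3 : ‖w x - w y‖ₑ ^ p ≤ edist x y ^ n * (G k x + G k y) := by
      calc ‖w x - w y‖ₑ ^ p
          ≤ 1 * (2 ^ (p - 1) * D ^ 2 * (oscAverage μ p w k x + oscAverage μ p w k y)) := by
            rw [one_mul]; exact h.enorm_sub_rpow_le_oscAverage hp hw hk2
        _ ≤ edist x y ^ n * (2 : ℝ≥0∞) ^ (((k : ℝ) + 1) * n) *
            (2 ^ (p - 1) * D ^ 2 * (oscAverage μ p w k x + oscAverage μ p w k y)) := by gcongr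
        _ = _ := by rw [hG]; ring
    calc ‖u x - u y‖ₑ = (‖w x - w y‖ₑ ^ p) ^ (1 / p) := by
          rw [← ENNReal.rpow_mul, mul_one_div_cancel hp0.ne', ENNReal.rpow_one, hx, hy]
      _ ≤ (edist x y ^ n * (G k x + G k y)) ^ (1 / p) := by gcongr
      _ = edist x y ^ s * (G k x + G k y) ^ (1 / p) := by
          rw [ENNReal.mul_rpow_of_nonneg _ _ hp1, ← ENNReal.rpow_mul, ← hsp,
            mul_assoc, mul_one_div_cancel hp0.ne', mul_one]
      _ ≤ _ := by
          gcongr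
          exact ENNReal.rpow_add_le_add_rpow _ _ hp1 ((div_le_one hp0).2 hp.le)
  refine (iInf₂_le _ hgrad).trans_eq ?_
  rw [LpLqNorm_ofReal hp0, ← lintegral_const_mul' _ _ hC]
  congr 2 with x
  rw [← ENNReal.tsum_mul_left]
  congr with k
  rw [← ENNReal.rpow_mul, one_div_mul_cancel hp0.ne', ENNReal.rpow_one, hG]

lemma exists_lintegral_tsum_oscAverage_le [BorelSpace X]
    (h : IsRegularMeasure μ n D c) (hn : 0 < n) (hp : 0 < p) : ∃ K : ℝ≥0, ∀ w : X → 𝕜, Measurable w →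
      ∫⁻ x, ∑' k : ℤ, (2 : ℝ≥0∞) ^ (((k : ℝ) + 1) * n) * oscAverage μ p w k x ∂μ ≤
        K * energy μ p w := by
  classical
  obtain ⟨K, hK⟩ := exists_tsum_two_rpow_le hn
  have hc0 : (c : ℝ≥0∞) ≠ 0 := by exact_mod_cast h.comparable_pos.ne'
  refine ⟨c * K, fun w hw => ?_⟩
  rw [energy, ← lintegral_const_mul' _ _ ENNReal.coe_ne_top]
  refine lintegral_mono fun x => ?_
  have hm : Measurable fun z => ‖w x - w z‖ₑ ^ p :=
    (measurable_enorm_sub_rpow hw p).comp measurable_prodMk_left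
  rw [← lintegral_const_mul' _ _ ENNReal.coe_ne_top]
  calc ∑' k : ℤ, (2 : ℝ≥0∞) ^ (((k : ℝ) + 1) * n) * oscAverage μ p w k x
      = ∑' k : ℤ, ∫⁻ z, (2 : ℝ≥0∞) ^ (((k : ℝ) + 1) * n) * (μ (sball 2 (k - 1) x))⁻¹ *
        (sball 2 (k - 1) x).indicator (fun z => ‖w x - w z‖ₑ ^ p) z ∂μ := by
        congr with k
        rw [lintegral_const_mul _ (hm.indicator measurableSet_ball),
          lintegral_indicator measurableSet_ball, oscAverage, mul_assoc]
    _ = ∫⁻ z, ∑' k : ℤ, (2 : ℝ≥0∞) ^ (((k : ℝ) + 1) * n) * (μ (sball 2 (k - 1) x))⁻¹ *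
        (sball 2 (k - 1) x).indicator (fun z => ‖w x - w z‖ₑ ^ p) z ∂μ :=
        (lintegral_tsum fun k => ((hm.indicator measurableSet_ball).const_mul _).aemeasurable).symm
    _ ≤ _ := by
        refine lintegral_mono fun z => ?_
        rcases eq_or_ne x z with rfl | hxz
        · simp [indicator, hp]
        calc ∑' k : ℤ, (2 : ℝ≥0∞) ^ (((k : ℝ) + 1) * n) * (μ (sball 2 (k - 1) x))⁻¹ *
              (sball 2 (k - 1) x).indicator (fun z => ‖w x - w z‖ₑ ^ p) z
            ≤ ∑' k : ℤ, (if dist z x < scale 2 (k - 1) then (2 : ℝ≥0∞) ^ (((k : ℝ) + 1) * n) else 0) *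
              ((μ (Metric.ball x (dist x z)))⁻¹ * ‖w x - w z‖ₑ ^ p) := by
              refine ENNReal.tsum_le_tsum fun k => ?_
              split_ifs with hk
              · rw [indicator_of_mem (by exact hk), mul_assoc]
                gcongr
                rw [dist_comm]
                exact Metric.ball_subset_ball hk.le
              · rw [indicator_of_notMem (by exact hk), mul_zero, zero_mul]
          _ ≤ K * (edist x z ^ n)⁻¹ * ((μ (Metric.ball x (dist x z)))⁻¹ * ‖w x - w z‖ₑ ^ p) := by
              rw [ENNReal.tsum_mul_right]
              gcongr
              exact hK hxz
          _ ≤ K * (c * (μ (Metric.ball x (dist x z)))⁻¹) *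
              ((μ (Metric.ball x (dist x z)))⁻¹ * ‖w x - w z‖ₑ ^ p) := by
              gcongr
              exact inv_le_mul_inv_of_le_mul hc0 ENNReal.coe_ne_top (h.comparable x z hxz).2
          _ = _ := by
              push_cast
              ring

end IsRegularMeasure

theorem IsAhlforsRegular.isEnergySpace_hajlaszSpace [BorelSpace X] [Nontrivial X]
    (h : IsAhlforsRegular μ n) (hs : s ∈ Ioo 0 n) :
    IsEnergySpace μ (n / s) (hajlaszSpace 𝕜 μ s (n / s) (ENNReal.ofReal (n / s)))
      (hajlaszNorm μ s (n / s) (ENNReal.ofReal (n / s))) := by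
  have hs0 := hs.1
  have hn : 0 < n := hs.1.trans hs.2
  have hsp : s * (n / s) = n := by field_simp
  have hp : 1 < n / s := (one_lt_div hs.1).2 hs.2
  obtain ⟨p, hpe⟩ : ∃ p, p = n / s := ⟨_, rfl⟩
  rw [← hpe] at hsp hp ⊢
  have hp0 : 0 < p := by linarith
  obtain ⟨D, c, hr⟩ := h.exists_isRegularMeasure hn
  have := secondCountableTopology_of_measure_ball μ h.ball_pos h.ball_lt_top
  have := isLocallyFiniteMeasure_of_measure_ball μ h.ball_lt_top
  obtain ⟨K, hK⟩ := hr.exists_lintegral_tsum_oscAverage_le (𝕜 := 𝕜) hn hp0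
  obtain ⟨C, hC⟩ : ∃ C : ℝ≥0, (C : ℝ≥0∞) = 2 ^ (p - 1) :=
    ⟨2 ^ (p - 1), by rw [ENNReal.coe_rpow_of_nonneg _ (by linarith), ENNReal.coe_ofNat]⟩
  have hC0 : 0 < C := by
    have : (C : ℝ≥0∞) ≠ 0 := by
      rw [hC]; exact (ENNReal.rpow_pos two_pos ENNReal.ofNat_ne_top).ne'
    exact pos_iff_ne_zero.2 (by exact_mod_cast this)
  have hD0 : 0 < D := zero_lt_one.trans_le hr.one_le
  have h1 : ∀ u : X → 𝕜, AEMeasurable u μ → hajlaszNorm μ s p (ENNReal.ofReal p) u ≤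
      (((C * D ^ 2 * K) ^ (1 / p) : ℝ≥0) : ℝ≥0∞) * energy μ p u ^ (1 / p) := by
    intro u hu
    have hle := hr.hajlaszNorm_le hn hp hsp hu.measurable_mk hu.ae_eq_mk
    refine hle.trans ((ENNReal.rpow_le_rpow ?_ (by positivity)).trans
      (rpow_one_div_le_of_le_mul hp0 le_rfl))
    rw [energy_congr p hu.ae_eq_mk]
    push_cast
    rw [hC, mul_assoc _ (K : ℝ≥0∞)]
    gcongr
    exact hK _ hu.measurable_mk
  have h2 : ∀ u : X → 𝕜, energy μ p u ^ (1 / p) ≤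
      (((c * D * C * (1 + D)) ^ (1 / p) : ℝ≥0) : ℝ≥0∞) *
        hajlaszNorm μ s p (ENNReal.ofReal p) u := by
    intro u
    have hpos : 0 < (c * D * C * (1 + D)) ^ (1 / p) :=
      NNReal.rpow_pos (mul_pos (mul_pos (mul_pos hr.comparable_pos hD0) hC0) (by positivity))
    -- With the constant on the left, the infimum over gradients can be tested one gradient at a
    -- time.
    rw [← ENNReal.div_le_iff' (by exact_mod_cast hpos.ne') ENNReal.coe_ne_top]
    refine le_iInf₂ fun g hg => ENNReal.div_le_of_le_mul' ?_
    rw [LpLqNorm_ofReal hp0]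
    refine rpow_one_div_le_of_le_mul hp0 ?_
    push_cast
    rw [hC]
    exact hr.energy_le_of_gradient hp hsp hg
  refine ⟨fun u => ?_, ⟨_, h1⟩, ⟨_, fun u _ => h2 u⟩⟩
  rw [hajlaszSpace, mem_ofPred_eq]
  refine and_congr_right fun hu => ?_
  exact (energy_ne_top_iff_of_le hp0 (h1 u hu) (h2 u)).symm

end GradientConstruction

lemma IsAhlforsRegular.isFiniteMeasure_restrict_ball {X : Type*} [MetricSpace X]
    [MeasurableSpace X] [BorelSpace X] {μ : Measure X} {n : ℝ} (h : IsAhlforsRegular μ n)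
    (x : X) (r : ℝ) : IsFiniteMeasure (μ.restrict (Metric.ball x r)) := by
  refine ⟨?_⟩
  rw [Measure.restrict_apply_univ]
  refine (measure_mono (Metric.ball_subset_ball ?_)).trans_lt
    (h.ball_lt_top x (|r| + 1) (by positivity))
  linarith [le_abs_self r]

/-! ### One-point spaces: every function is constant and every seminorm is zero. -/

section Subsingleton

lemma eq_const_of_subsingleton {X β : Type*} [Subsingleton X] (u : X → β) (x : X) :
    u = fun _ => u x :=
  funext fun y => congrArg u (Subsingleton.elim y x)

variable {𝕜 X Y : Type*} [RCLike 𝕜] [MetricSpace X] [MeasurableSpace X]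
  [MetricSpace Y] [MeasurableSpace Y] [Subsingleton Y] {μX : Measure X}
  {μY : Measure Y} {n n₁ n₂ s p : ℝ}

lemma IsAhlforsRegular.averagesTendTo_of_subsingleton [BorelSpace Y] (h : IsAhlforsRegular μY n)
    (u : Y → 𝕜) (x : Y) : AveragesTendTo μY u x (u x) := by
  refine tendsto_const_nhds.congr' ?_
  filter_upwards [self_mem_nhdsWithin] with r hr
  rw [eq_const_of_subsingleton u x]
  exact (setAverage_const (h.ball_pos x r hr).ne' (h.ball_lt_top x r hr).ne _).symm

lemma IsAhlforsRegular.preciseRep_of_subsingleton [BorelSpace Y] (h : IsAhlforsRegular μY n)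
    (u : Y → 𝕜) : preciseRep μY u = u :=
  funext fun x => (h.averagesTendTo_of_subsingleton u x).preciseRep_eq

lemma IsAhlforsRegular.divergenceSet_of_subsingleton [BorelSpace Y] (h : IsAhlforsRegular μY n)
    (u : Y → 𝕜) : divergenceSet μY u = ∅ :=
  eq_empty_of_forall_notMem fun x hx => hx ⟨_, h.averagesTendTo_of_subsingleton u x⟩

lemma besovNorm_of_subsingleton (hp : 0 < p) (u : Y → 𝕜) : besovNorm μY s p u = 0 := by
  have : ∀ x y, ‖u x - u y‖ₑ ^ p / (edist x y ^ (s * p) * μY (Metric.ball x (dist x y))) = 0 :=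
    fun x y => by rw [Subsingleton.elim x y]; simp [hp]
  simp [besovNorm, this, hp]

lemma IsAhlforsRegular.besovSpace_of_subsingleton [BorelSpace Y] (h : IsAhlforsRegular μY n)
    (hp : 0 < p) : besovSpace 𝕜 μY s p = univ := by
  refine eq_univ_of_forall fun u => ⟨fun x r => ?_, ?_⟩
  · have := h.isFiniteMeasure_restrict_ball x r
    rw [eq_const_of_subsingleton u x]
    exact memLp_const _
  · rw [besovNorm_of_subsingleton hp]
    exact ENNReal.zero_lt_top

lemma hajlaszNorm_of_subsingleton (hp : 0 < p) (u : Y → 𝕜) :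
    hajlaszNorm μY s p (ENNReal.ofReal p) u = 0 := by
  have hg : IsFracHajlaszGradient μY s u fun _ _ => 0 := by
    refine ⟨fun k => aemeasurable_const, ∅, measure_empty, fun k x y _ _ _ _ => ?_⟩
    rw [Subsingleton.elim x y]
    simp
  refine le_antisymm ((iInf₂_le _ hg).trans_eq ?_) zero_le
  rw [LpLqNorm_ofReal hp]
  simp [hp]

lemma hajlaszSpace_of_subsingleton (hp : 0 < p) :
    hajlaszSpace 𝕜 μY s p (ENNReal.ofReal p) = univ := by
  refine eq_univ_of_forall fun u => ⟨Subsingleton.measurable.aemeasurable, ?_⟩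
  rw [hajlaszNorm_of_subsingleton hp]
  exact ENNReal.zero_lt_top

lemma IsAhlforsRegular.pullbackBounded_of_subsingleton [BorelSpace Y] (f : X ≃ₜ Y)
    (hY : IsAhlforsRegular μY n₂) {NX : (X → 𝕜) → ℝ≥0∞} (hNX : ∀ u, NX u = 0)
    (FY : Set (Y → 𝕜)) (NY : (Y → 𝕜) → ℝ≥0∞) : PullbackBounded μX μY f univ NX FY NY := by
  refine ⟨0, fun u _ => ?_⟩
  rw [hY.divergenceSet_of_subsingleton, hY.preciseRep_of_subsingleton]
  refine ⟨fun y r => ?_, dimH_empty, by simp, ae_eq_rfl, mem_univ _, by simp [hNX]⟩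
  have := hY.isFiniteMeasure_restrict_ball y r
  rw [eq_const_of_subsingleton u y]
  exact integrable_const _

lemma IsAhlforsRegular.inducesEquivalence_of_subsingleton [BorelSpace X] [BorelSpace Y]
    [Subsingleton X] (f : X ≃ₜ Y)
    (hX : IsAhlforsRegular μX n₁) (hY : IsAhlforsRegular μY n₂)
    {NX : (X → 𝕜) → ℝ≥0∞} (hNX : ∀ u, NX u = 0) {NY : (Y → 𝕜) → ℝ≥0∞} (hNY : ∀ u, NY u = 0) :
    InducesEquivalence μX μY f univ NX univ NY := by
  refine ⟨hY.pullbackBounded_of_subsingleton f hNX _ _,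
    hX.pullbackBounded_of_subsingleton f.symm hNY _ _, fun u _ => ?_, fun v _ => ?_⟩
  · rw [hX.preciseRep_of_subsingleton, hY.preciseRep_of_subsingleton, Function.comp_assoc,
      f.self_comp_symm, Function.comp_id]
  · rw [hX.preciseRep_of_subsingleton, hY.preciseRep_of_subsingleton, Function.comp_assoc,
      f.symm_comp_self, Function.comp_id]

end Subsingleton

end

end HajlaszBesov

theorem theorem5p1 {𝕜 X Y : Type*} [RCLike 𝕜]
    [MetricSpace X] [MeasurableSpace X] [BorelSpace X]
    [MetricSpace Y] [MeasurableSpace Y] [BorelSpace Y]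
    (μX : Measure X) (μY : Measure Y) (n₁ n₂ : ℝ) (hn₁ : 0 < n₁) (hn₂ : 0 < n₂)
    (hX : IsAhlforsRegular μX n₁) (hY : IsAhlforsRegular μY n₂)
    (f : X ≃ₜ Y) (hf : IsQuasisymmetric f)
    (s₁ s₂ : ℝ) (hs₁ : s₁ ∈ Set.Ioo 0 n₁) (hs₂ : s₂ ∈ Set.Ioo 0 n₂)
    (hs : n₁ / s₁ = n₂ / s₂) :
    InducesEquivalence μX μY f
      (hajlaszSpace 𝕜 μX s₁ (n₁ / s₁) (ENNReal.ofReal (n₁ / s₁)))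
      (hajlaszNorm μX s₁ (n₁ / s₁) (ENNReal.ofReal (n₁ / s₁)))
      (hajlaszSpace 𝕜 μY s₂ (n₂ / s₂) (ENNReal.ofReal (n₂ / s₂)))
      (hajlaszNorm μY s₂ (n₂ / s₂) (ENNReal.ofReal (n₂ / s₂))) ∧
    InducesEquivalence μX μY f
      (besovSpace 𝕜 μX s₁ (n₁ / s₁)) (besovNorm μX s₁ (n₁ / s₁))
      (besovSpace 𝕜 μY s₂ (n₂ / s₂)) (besovNorm μY s₂ (n₂ / s₂)) := by
  have hp : 1 < n₁ / s₁ := (one_lt_div hs₁.1).2 hs₁.2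
  have hp₁ : 0 < n₁ / s₁ := zero_lt_one.trans hp
  have hp₂ : 0 < n₂ / s₂ := hs ▸ hp₁
  -- On a one-point space the diameter is 0, so the regularity inequalities are vacuous and doubling
  -- for all radii cannot be derived from them.
  rcases subsingleton_or_nontrivial X with hsub | hnon
  · have : Subsingleton Y := f.symm.injective.subsingleton
    rw [hajlaszSpace_of_subsingleton hp₁, hajlaszSpace_of_subsingleton hp₂,
      hX.besovSpace_of_subsingleton hp₁, hY.besovSpace_of_subsingleton hp₂]
    exact ⟨hX.inducesEquivalence_of_subsingleton f hY (hajlaszNorm_of_subsingleton hp₁)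
        (hajlaszNorm_of_subsingleton hp₂),
      hX.inducesEquivalence_of_subsingleton f hY (besovNorm_of_subsingleton hp₁)
        (besovNorm_of_subsingleton hp₂)⟩
  · have : Nontrivial Y := f.injective.nontrivial
    have hX' := hX.isDoublingPerfect hn₁
    have hY' := hY.isDoublingPerfect hn₂
    have h₁ := hf.hasControlledDistortion
    have h₂ := hf.hasControlledDistortion_symm
    have hH := hY.isEnergySpace_hajlaszSpace (𝕜 := 𝕜) hs₂
    have hB := hY.isEnergySpace_besovSpace (𝕜 := 𝕜) hs₂
    rw [← hs] at hH hB ⊢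
    exact ⟨(hX.isEnergySpace_hajlaszSpace hs₁).inducesEquivalence hX' hY' h₁ h₂ hp hH,
      (hX.isEnergySpace_besovSpace hs₁).inducesEquivalence hX' hY' h₁ h₂ hp hB⟩
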